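/- All vector spaces and tensor products are over $\mathbb C$; a $\mathbb C[\partial]$-module $V$ has the operator $\partial$, and $V[\lambda_1,\dots,\lambda_n]=\mathbb C[\lambda_1,\dots,\lambda_n]\otimes V$. Let $(\mathcal L,[\cdot_\lambda\cdot],\alpha)$ be a multiplicative Hom-Lie conformal algebra: a $\mathbb C[\partial]$-module $\mathcal L$ with a $\mathbb C$-bilinear map $[\cdot_\lambda\cdot]:\mathcal L\times\mathcal L\to\mathcal L[\lambda]$ and a linear map $\alpha:\mathcal L\to\mathcal L$ with $\alpha\partial=\partial\alpha$ such that $[\partial x_\lambda y]=-\lambda[x_\lambda y]$, $[x_\lambda\partial y]=(\partial+\lambda)[x_\lambda y]$, $[x_\lambda y]=-[y_{-\lambda-\partial}x]$, $[\alpha(x)_\lambda[y_\mu z]]=[[x_\lambda y]_{\lambda+\mu}\alpha(z)]+[\alpha(y)_\mu[x_\lambda z]]$ and $\alpha([x_\lambda y])=[\alpha(x)_\lambda\alpha(y)]$. Let $(\rho,\mathcal M,\beta)$ be a representation of it: a $\mathbb C[\partial]$-module $\mathcal M$, a linear map $\beta:\mathcal M\to\mathcal M$ with $\beta\partial=\partial\beta$,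 and a bilinear map $(x,m)\mapsto\rho(x)_\lambda m\in\mathcal M[\lambda]$ with $\rho(\partial x)_\lambda m=-\lambda\rho(x)_\lambda m$, $\rho(x)_\lambda\partial m=(\partial+\lambda)\rho(x)_\lambda m$, $\beta(\rho(x)_\lambda m)=\rho(\alpha(x))_\lambda\beta(m)$ and $\rho([x_\lambda y])_{\lambda+\mu}\beta(m)=\rho(\alpha(x))_\lambda\rho(y)_\mu m-\rho(\alpha(y))_\mu\rho(x)_\lambda m$. For $p\ge1$ let $C^p_{\beta,\alpha}(\mathcal M,\mathcal L)$ be the space of linear maps $f_{\lambda_1,\dots,\lambda_{p-1}}:\mathcal M^{\otimes p}\to\mathcal L[\lambda_1,\dots,\lambda_{p-1}]$ such that (i) $\alpha(f_{\lambda_1,\dots,\lambda_{p-1}}(m_1,\dots,m_p))=f_{\lambda_1,\dots,\lambda_{p-1}}(\beta(m_1),\dots,\beta(m_p))$; (ii) replacing $m_i$ by $\partial m_i$ multiplies the value by $-\lambda_i$ if $i<p$, and by $\partial+\lambda_1+\dots+\lambda_{p-1}$ if $i=p$; (iii) for every $\tau\in S_p$, $f_{\lambda_1,\dots,\lambda_{p-1}}(m_1,\dots,m_p)=(-1)^\tau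 f_{\lambda_{\tau(1)},\dots,\lambda_{\tau(p-1)}}(m_{\tau(1)},\dots,m_{\tau(p)})$, where $\lambda_p$ is replaced by $\lambda_p^\dagger=-\lambda_1-\dots-\lambda_{p-1}-\partial$, with $\partial$ acting on the coefficients. Put $C^*_{\beta,\alpha}(\mathcal M,\mathcal L)=\bigoplus_{p\ge1}C^p_{\beta,\alpha}(\mathcal M,\mathcal L)$. On $V=\mathcal L\oplus\mathcal M$ let $a=\alpha+\beta$, let $(m_c+\rho)_\lambda(x+m,y+n)=[x_\lambda y]+\rho(x)_\lambda n-\rho(y)_{-\partial-\lambda}m$ be the semi-direct product bracket, and for $f$ with $p$ and $g$ with $q$ arguments in $V$ let $$(f\circledcirc g)_{\lambda_1,\dots,\lambda_{p+q-2}}(v_1,\dots,v_{p+q-1})=\sum_\tau(-1)^\tau f_{\lambda_{\tau(1)}+\dots+\lambda_{\tau(q)},\lambda_{\tau(q+1)},\dots,\lambda_{\tau(p+q-2)}}\bigl(g_{\lambda_{\tau(1)},\dots,\lambda_{\tau(q-1)}}(v_{\tau(1)},\dots,v_{\tau(q)}),a^{q-1}(v_{\tau(q+1)}),\dots,a^{q-1}(v_{\tau(p+q-1)})\bigr)$$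 with $\lambda_{p+q-1}$ replaced by $\lambda_{p+q-1}^\dagger$, the sum being over the permutations $\tau$ of $\{1,\dots,p+q-1\}$ with $\tau(1)<\dots<\tau(q)$ and $\tau(q+1)<\dots<\tau(p+q-1)$; and let $[f,g]_{NR}=f\circledcirc g-(-1)^{(p-1)(q-1)}g\circledcirc f$. Regard $f\in C^p_{\beta,\alpha}(\mathcal M,\mathcal L)$ as the map $(x_1+m_1,\dots,x_p+m_p)\mapsto f(m_1,\dots,m_p)\in\mathcal L\subset V$ on $V$. **Theorem.** (1) For $f\in C^p_{\beta,\alpha}(\mathcal M,\mathcal L)$ and $g\in C^q_{\beta,\alpha}(\mathcal M,\mathcal L)$ the map $$\{\!\!\{f,g\}\!\!\}=(-1)^p[[m_c+\rho,f]_{NR},g]_{NR}$$ again comes from a (unique) element of $C^{p+q}_{\beta,\alpha}(\mathcal M,\mathcal L)$, and the bilinear bracket so defined makes $C^*_{\beta,\alpha}(\mathcal M,\mathcal L)$, with $C^p_{\beta,\alpha}(\mathcal M,\mathcal L)$ in degree $p$, a graded Lie algebra: for $f,g,h$ of degrees $p,q,r$, $\{\!\!\{f,g\}\!\!\}=-(-1)^{pq}\{\!\!\{g,f\}\!\!\}$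 and $\{\!\!\{f,\{\!\!\{g,h\}\!\!\}\}\!\!\}=\{\!\!\{\{\!\!\{f,g\}\!\!\},h\}\!\!\}+(-1)^{pq}\{\!\!\{g,\{\!\!\{f,h\}\!\!\}\}\!\!\}$. (2) A linear map $T:\mathcal M\to\mathcal L$ with $\alpha T=T\beta$ is an $\mathcal O$-operator, that is, $T$ is $\mathbb C[\partial]$-linear and $[T(m)_\lambda T(n)]=T\bigl(\rho(T(m))_\lambda n-\rho(T(n))_{-\partial-\lambda}m\bigr)$ for all $m,n\in\mathcal M$, if and only if $T\in C^1_{\beta,\alpha}(\mathcal M,\mathcal L)$ and $\{\!\!\{T,T\}\!\!\}=0$. -/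

import Mathlib

open scoped TensorProduct DirectSum

set_option maxSynthPendingDepth 3

noncomputable section

namespace HomLieConformal

/-! A `ℂ[∂]`-module is a module over `Polynomial ℂ`, the variable acting as `∂`; the compatible
complex vector space structure is the one underlying it. -/

section Polynomials

variable (V : Type*) [AddCommGroup V] [Module ℂ V]

/-- `V[λ_i : i ∈ σ] = ℂ[λ_i : i ∈ σ] ⊗ V`. -/
abbrev PolyMod (σ : Type*) : Type _ := MvPolynomial σ ℂ ⊗[ℂ] V

/-- Replace each variable `λ_i` by the polynomial `ν i` in other variables. -/
def subst {σ τ : Type*} (ν : σ → MvPolynomial τ ℂ) : PolyMod V σ →ₗ[ℂ] PolyMod V τ :=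
  LinearMap.rTensor V (MvPolynomial.aeval ν).toLinearMap

variable [Module (Polynomial ℂ) V] [IsScalarTower ℂ (Polynomial ℂ) V]

/-- The operator `∂` of a `ℂ[∂]`-module. -/
def der : V →ₗ[ℂ] V := Algebra.lsmul ℂ ℂ V (Polynomial.X : Polynomial ℂ)

/-- The homomorphism `ℂ[λ_1, …, λ_{n+1}] → ℂ[λ_1, …, λ_n] ⊗ ℂ[∂]` which fixes `λ_1, …, λ_n` and
sends `λ_{n+1}` to `-(λ_1 + ⋯ + λ_n) - ∂`. -/
def daggerHom (n : ℕ) :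
    MvPolynomial (Fin (n + 1)) ℂ →ₐ[ℂ] MvPolynomial (Fin n) ℂ ⊗[ℂ] Polynomial ℂ :=
  MvPolynomial.aeval
    (Fin.lastCases (motive := fun _ => MvPolynomial (Fin n) ℂ ⊗[ℂ] Polynomial ℂ)
      (-((∑ i, MvPolynomial.X i) ⊗ₜ[ℂ] 1) - 1 ⊗ₜ[ℂ] Polynomial.X)
      (fun i => MvPolynomial.X i ⊗ₜ[ℂ] 1))

/-- The substitution `λ_{n+1} ↦ λ_{n+1}^† = -(λ_1 + ⋯ + λ_n) - ∂`, where `∂` acts on the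
coefficients in `V`. -/
def dagger (n : ℕ) : PolyMod V (Fin (n + 1)) →ₗ[ℂ] PolyMod V (Fin n) :=
  LinearMap.lTensor (MvPolynomial (Fin n) ℂ)
      (TensorProduct.lift (Algebra.lsmul ℂ ℂ V : Polynomial ℂ →ₐ[ℂ] Module.End ℂ V).toLinearMap)
    ∘ₗ (TensorProduct.assoc ℂ (MvPolynomial (Fin n) ℂ) (Polynomial ℂ) V).toLinearMap
    ∘ₗ LinearMap.rTensor V (daggerHom n).toLinearMap

end Polynomials

section Bilinear

variable {U V W : Type*} [AddCommGroup U] [Module ℂ U] [AddCommGroup V] [Module ℂ V]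
  [AddCommGroup W] [Module ℂ W]

/-- For a `λ`-product `b : (u, v) ↦ u_λ v ∈ W[λ]`, the element `u_ν v`, where `ν` is a polynomial
in the variables `λ_i`, `i ∈ σ`. -/
def lam {σ : Type*} (b : U →ₗ[ℂ] V →ₗ[ℂ] PolyMod W (Fin 1)) (ν : MvPolynomial σ ℂ) :
    U →ₗ[ℂ] V →ₗ[ℂ] PolyMod W σ :=
  b.compr₂ (subst W fun _ => ν)

/-- `u_ν P` for a polynomial `P` with coefficients in `V`, by linearity over `ℂ[λ_i : i ∈ σ]`. -/
def lamRight {σ : Type*} (b : U →ₗ[ℂ] V →ₗ[ℂ] PolyMod W (Fin 1)) (ν : MvPolynomial σ ℂ)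
    (u : U) (P : PolyMod V σ) : PolyMod W σ :=
  (lam b ν u).liftBaseChange (MvPolynomial σ ℂ) P

/-- `P_ν v` for a polynomial `P` with coefficients in `U`, by linearity over `ℂ[λ_i : i ∈ σ]`. -/
def lamLeft {σ : Type*} (b : U →ₗ[ℂ] V →ₗ[ℂ] PolyMod W (Fin 1)) (ν : MvPolynomial σ ℂ)
    (P : PolyMod U σ) (v : V) : PolyMod W σ :=
  ((lam b ν).flip v).liftBaseChange (MvPolynomial σ ℂ) P

/-- `(v, u) ↦ u_{-∂-λ} v`. -/
def lamOpp [Module (Polynomial ℂ) W] [IsScalarTower ℂ (Polynomial ℂ) W]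
    (b : U →ₗ[ℂ] V →ₗ[ℂ] PolyMod W (Fin 1)) : V →ₗ[ℂ] U →ₗ[ℂ] PolyMod W (Fin 1) :=
  ((lam b (MvPolynomial.X (1 : Fin 2))).compr₂ (dagger W 1)).flip

end Bilinear

section Algebras

variable (L : Type*) [AddCommGroup L] [Module ℂ L] [Module (Polynomial ℂ) L]
  [IsScalarTower ℂ (Polynomial ℂ) L]

/-- A Hom-Lie conformal algebra structure on the `ℂ[∂]`-module `L`. -/
structure HomLieConformalAlgebra where
  /-- the `λ`-bracket `(x, y) ↦ [x_λ y]` -/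
  bracket : L →ₗ[ℂ] L →ₗ[ℂ] PolyMod L (Fin 1)
  /-- the twist map -/
  α : L →ₗ[ℂ] L
  α_der : ∀ x, α (der L x) = der L (α x)
  der_left : ∀ x y, bracket (der L x) y = -((MvPolynomial.X 0 : MvPolynomial (Fin 1) ℂ) • bracket x y)
  der_right : ∀ x y, bracket x (der L y) =
    (der L).lTensor _ (bracket x y) + (MvPolynomial.X 0 : MvPolynomial (Fin 1) ℂ) • bracket x y
  skew : ∀ x y, bracket x y = -lamOpp bracket x y
  jacobi : ∀ x y z,
    lamRight bracket (MvPolynomial.X (0 : Fin 2)) (α x)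
        (lam bracket (MvPolynomial.X (1 : Fin 2)) y z) =
      lamLeft bracket (MvPolynomial.X (0 : Fin 2) + MvPolynomial.X 1)
        (lam bracket (MvPolynomial.X (0 : Fin 2)) x y) (α z) +
      lamRight bracket (MvPolynomial.X (1 : Fin 2)) (α y)
        (lam bracket (MvPolynomial.X (0 : Fin 2)) x z)

variable {L}

/-- The twist map preserves the `λ`-bracket: `α [x_λ y] = [α(x)_λ α(y)]`. -/
def HomLieConformalAlgebra.IsMultiplicative (H : HomLieConformalAlgebra L) : Prop :=
  ∀ x y, H.α.lTensor _ (H.bracket x y) = H.bracket (H.α x) (H.α y)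

variable (M : Type*) [AddCommGroup M] [Module ℂ M] [Module (Polynomial ℂ) M]
  [IsScalarTower ℂ (Polynomial ℂ) M]

/-- A representation `(ρ, M, β)` of a Hom-Lie conformal algebra on the `ℂ[∂]`-module `M`. The
fields `der_left` and `der_right` say that `ρ` is a `ℂ[∂]`-linear map from `L` to `gc(M)`. -/
structure Representation (H : HomLieConformalAlgebra L) where
  /-- the action `(x, m) ↦ ρ(x)_λ m` -/
  ρ : L →ₗ[ℂ] M →ₗ[ℂ] PolyMod M (Fin 1)
  /-- the twist map -/
  β : M →ₗ[ℂ] M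
  β_der : ∀ m, β (der M m) = der M (β m)
  der_left : ∀ x m, ρ (der L x) m = -((MvPolynomial.X 0 : MvPolynomial (Fin 1) ℂ) • ρ x m)
  der_right : ∀ x m, ρ x (der M m) =
    (der M).lTensor _ (ρ x m) + (MvPolynomial.X 0 : MvPolynomial (Fin 1) ℂ) • ρ x m
  twist : ∀ x m, β.lTensor _ (ρ x m) = ρ (H.α x) (β m)
  action : ∀ x y m,
    lamLeft ρ (MvPolynomial.X (0 : Fin 2) + MvPolynomial.X 1)
        (lam H.bracket (MvPolynomial.X (0 : Fin 2)) x y) (β m) =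
      lamRight ρ (MvPolynomial.X (0 : Fin 2)) (H.α x) (lam ρ (MvPolynomial.X (1 : Fin 2)) y m) -
      lamRight ρ (MvPolynomial.X (1 : Fin 2)) (H.α y) (lam ρ (MvPolynomial.X (0 : Fin 2)) x m)

variable {M}

/-- `T : M → L` is an `𝒪`-operator: it is `ℂ[∂]`-linear, `Tβ = αT`, and
`[T(m)_λ T(n)] = T(ρ(T m)_λ n - ρ(T n)_{-∂-λ} m)`. -/
def IsOOperator {H : HomLieConformalAlgebra L} (R : Representation M H) (T : M →ₗ[ℂ] L) : Prop :=
  (∀ m, T (der M m) = der L (T m)) ∧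
  (∀ m, T (R.β m) = H.α (T m)) ∧
  ∀ m n, H.bracket (T m) (T n) = T.lTensor _ (R.ρ (T m) n - lamOpp R.ρ m (T n))

end Algebras

section Cochains

variable (V W : Type*) [AddCommGroup V] [Module ℂ V] [AddCommGroup W] [Module ℂ W]

/-- The `ℂ`-linear maps `f_{λ_1, …, λ_n} : V^{⊗ (n+1)} → W[λ_1, …, λ_n]`. -/
abbrev ConfMap (n : ℕ) : Type _ := MultilinearMap ℂ (fun _ : Fin (n + 1) => V) (PolyMod W (Fin n))

variable {V W}

/-- A `ℂ`-linear map `V → W` as a map with one argument and no `λ`. -/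
def ofLinear (T : V →ₗ[ℂ] W) : ConfMap V W 0 :=
  (TensorProduct.mk ℂ (MvPolynomial (Fin 0) ℂ) W 1 ∘ₗ T).compMultilinearMap
    (MultilinearMap.ofSubsingleton ℂ V V (0 : Fin 1) LinearMap.id)

/-- A `λ`-product as a map with two arguments. -/
def ofBilinear (b : V →ₗ[ℂ] V →ₗ[ℂ] PolyMod W (Fin 1)) : ConfMap V W 1 :=
  MultilinearMap.mk' (fun x => b (x 0) (x 1))
    (by
      intro x i u v
      fin_cases i <;> simp)
    (by
      intro x i c u
      fin_cases i <;> simp)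

variable [Module (Polynomial ℂ) V] [IsScalarTower ℂ (Polynomial ℂ) V]
  [Module (Polynomial ℂ) W] [IsScalarTower ℂ (Polynomial ℂ) W]

/-- The space of `(n+1)`-cochains with respect to the twist maps `a` of `V` and `b` of `W`: the
maps `f_{λ_1, …, λ_n}` which intertwine the twist maps and are conformally sesquilinear and
conformally skew-symmetric. -/
def cochains (a : V →ₗ[ℂ] V) (b : W →ₗ[ℂ] W) (n : ℕ) : Submodule ℂ (ConfMap V W n) where
  carrier := {f |
    (∀ x, b.lTensor _ (f x) = f fun i => a (x i)) ∧
    (∀ x (i : Fin n), f (Function.update x i.castSucc (der V (x i.castSucc))) =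
      -((MvPolynomial.X i : MvPolynomial (Fin n) ℂ) • f x)) ∧
    (∀ x, f (Function.update x (Fin.last _) (der V (x (Fin.last _)))) =
      (der W).lTensor _ (f x) + (∑ i, MvPolynomial.X i : MvPolynomial (Fin n) ℂ) • f x) ∧
    (∀ x (τ : Equiv.Perm (Fin (n + 1))), f x =
      (τ.sign : ℤ) • dagger W n
        (subst W (fun i : Fin n => MvPolynomial.X (τ i.castSucc)) (f fun i => x (τ i))))}
  add_mem' := by
    rintro f g ⟨f1, f2, f3, f4⟩ ⟨g1, g2, g3, g4⟩
    refine ⟨fun x => ?_, fun x i => ?_, fun x => ?_, fun x τ => ?_⟩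
    · simp only [add_apply, map_add, f1, g1]
    · simp only [add_apply, f2, g2, smul_add, neg_add]
    · simp only [add_apply, f3, g3, smul_add, map_add]
      abel
    · simp only [add_apply, map_add, smul_add]
      rw [← f4 x τ, ← g4 x τ]
  zero_mem' := by
    refine ⟨fun x => ?_, fun x i => ?_, fun x => ?_, fun x τ => ?_⟩ <;> simp
  smul_mem' := by
    rintro c f ⟨f1, f2, f3, f4⟩
    refine ⟨fun x => ?_, fun x i => ?_, fun x => ?_, fun x τ => ?_⟩
    · simp only [smul_apply, map_smul, f1]
    · simp only [smul_apply, f2, smul_neg, smul_comm c]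
    · simp only [smul_apply, f3, smul_add, map_smul, smul_comm c]
    · simp only [smul_apply, map_smul]
      rw [smul_comm, ← f4 x τ]

end Cochains

section NijenhuisRichardson

variable {V : Type*} [AddCommGroup V] [Module ℂ V]

/-- The shuffles `τ(1) < ⋯ < τ(l+1)`, `τ(l+2) < ⋯ < τ(k+l+1)`. -/
def shuffles (k l : ℕ) : Finset (Equiv.Perm (Fin (k + l + 1))) :=
  Finset.univ.filter fun τ => ∀ i j : Fin (k + l + 1),
    i < j → ((j : ℕ) < l + 1 ∨ l + 1 ≤ (i : ℕ)) → τ i < τ j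

/-- The positions `1, …, l+1` among `1, …, k+l+1`. -/
def headIdx (k l : ℕ) (i : Fin (l + 1)) : Fin (k + l + 1) := ⟨i, by omega⟩

/-- The positions `l+2, …, k+l+1` among `1, …, k+l+1`. -/
def tailIdx (k l : ℕ) (j : Fin k) : Fin (k + l + 1) := ⟨l + 1 + j, by omega⟩

/-- The subscripts `λ_{τ(1)}, …, λ_{τ(l)}` of the inner map. -/
def innerVar (k l : ℕ) (τ : Equiv.Perm (Fin (k + l + 1))) (i : Fin l) :
    MvPolynomial (Fin (k + l + 1)) ℂ :=
  MvPolynomial.X (τ (headIdx k l i.castSucc))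

/-- The `k` subscripts `λ_{τ(1)} + ⋯ + λ_{τ(l+1)}, λ_{τ(l+2)}, …, λ_{τ(k+l)}` of the outer map. -/
def outerVar (k l : ℕ) (τ : Equiv.Perm (Fin (k + l + 1))) (j : Fin k) :
    MvPolynomial (Fin (k + l + 1)) ℂ :=
  if (j : ℕ) = 0 then ∑ i, MvPolynomial.X (τ (headIdx k l i))
  else MvPolynomial.X (τ ⟨l + j, by omega⟩)

/-- `f_{ν_1, …, ν_k}(P, y_1, …, y_k)` for a polynomial `P` with coefficients in `V`, by linearity
over the polynomial ring. -/
def plug {σ : Type*} {k : ℕ} (f : ConfMap V V k) (ν : Fin k → MvPolynomial σ ℂ)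
    (P : PolyMod V σ) (y : Fin k → V) : PolyMod V σ :=
  (subst V ν ∘ₗ f.toLinearMap (Fin.cons 0 y) 0).liftBaseChange (MvPolynomial σ ℂ) P

/-- The summand of `f ⊚ g` belonging to `τ`, before the substitution for `λ_{k+l+1}`:
`f_{λ_{τ(1)}+⋯+λ_{τ(l+1)}, λ_{τ(l+2)}, …}(g_{λ_{τ(1)}, …, λ_{τ(l)}}(x_{τ(1)}, …, x_{τ(l+1)}),
a^l(x_{τ(l+2)}), …, a^l(x_{τ(k+l+1)}))`. -/
def circTerm (a : V →ₗ[ℂ] V) {k l : ℕ} (f : ConfMap V V k) (g : ConfMap V V l)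
    (τ : Equiv.Perm (Fin (k + l + 1))) (x : Fin (k + l + 1) → V) :
    PolyMod V (Fin (k + l + 1)) :=
  plug f (outerVar k l τ)
    (subst V (innerVar k l τ) (g fun i => x (τ (headIdx k l i))))
    (fun j => (a ^ l) (x (τ (tailIdx k l j))))

section lemmas

theorem plug_tmul {σ : Type*} {k : ℕ} (f : ConfMap V V k) (ν : Fin k → MvPolynomial σ ℂ)
    (q : MvPolynomial σ ℂ) (v : V) (y : Fin k → V) :
    plug f ν (q ⊗ₜ[ℂ] v) y = q • subst V ν (f (Fin.cons v y)) := by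
  simp [plug, LinearMap.liftBaseChange_tmul]

theorem plug_add {σ : Type*} {k : ℕ} (f : ConfMap V V k) (ν : Fin k → MvPolynomial σ ℂ)
    (P Q : PolyMod V σ) (y : Fin k → V) :
    plug f ν (P + Q) y = plug f ν P y + plug f ν Q y := by
  simp [plug]

theorem plug_smul {σ : Type*} {k : ℕ} (f : ConfMap V V k) (ν : Fin k → MvPolynomial σ ℂ)
    (c : ℂ) (P : PolyMod V σ) (y : Fin k → V) :
    plug f ν (c • P) y = c • plug f ν P y := by
  unfold plug
  rw [← LinearMap.restrictScalars_apply ℂ, map_smul, LinearMap.restrictScalars_apply]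

theorem plug_zero {σ : Type*} {k : ℕ} (f : ConfMap V V k) (ν : Fin k → MvPolynomial σ ℂ)
    (y : Fin k → V) : plug f ν 0 y = 0 := by
  simp [plug]

theorem plug_add_left {σ : Type*} {k : ℕ} (f g : ConfMap V V k) (ν : Fin k → MvPolynomial σ ℂ)
    (P : PolyMod V σ) (y : Fin k → V) :
    plug (f + g) ν P y = plug f ν P y + plug g ν P y := by
  induction P using TensorProduct.induction_on with
  | zero => simp [plug_zero]
  | tmul q v => simp [plug_tmul]
  | add P Q hP hQ => rw [plug_add, plug_add, plug_add, hP, hQ]; abel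

theorem plug_smul_left {σ : Type*} {k : ℕ} (c : ℂ) (f : ConfMap V V k)
    (ν : Fin k → MvPolynomial σ ℂ) (P : PolyMod V σ) (y : Fin k → V) :
    plug (c • f) ν P y = c • plug f ν P y := by
  induction P using TensorProduct.induction_on with
  | zero => simp [plug_zero]
  | tmul q v => simp [plug_tmul, smul_comm c]
  | add P Q hP hQ => rw [plug_add, plug_add, hP, hQ, smul_add]

theorem plug_update_add {σ : Type*} {k : ℕ} (f : ConfMap V V k) (ν : Fin k → MvPolynomial σ ℂ)
    (P : PolyMod V σ) (y : Fin k → V) (j : Fin k) (u v : V) :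
    plug f ν P (Function.update y j (u + v)) =
      plug f ν P (Function.update y j u) + plug f ν P (Function.update y j v) := by
  induction P using TensorProduct.induction_on with
  | zero => simp [plug_zero]
  | tmul q w => simp only [plug_tmul, Fin.cons_update, MultilinearMap.map_update_add, map_add,
      smul_add]
  | add P Q hP hQ => rw [plug_add, plug_add, plug_add, hP, hQ]; abel

theorem plug_update_smul {σ : Type*} {k : ℕ} (f : ConfMap V V k) (ν : Fin k → MvPolynomial σ ℂ)
    (P : PolyMod V σ) (y : Fin k → V) (j : Fin k) (c : ℂ) (u : V) :
    plug f ν P (Function.update y j (c • u)) = c • plug f ν P (Function.update y j u) := by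
  induction P using TensorProduct.induction_on with
  | zero => simp [plug_zero]
  | tmul q w => simp only [plug_tmul, Fin.cons_update, MultilinearMap.map_update_smul, map_smul,
      smul_comm c]
  | add P Q hP hQ => rw [plug_add, plug_add, hP, hQ, smul_add]

theorem idx_cases (k l : ℕ) (i : Fin (k + l + 1)) :
    (∃ j, i = headIdx k l j) ∨ ∃ j, i = tailIdx k l j := by
  by_cases h : (i : ℕ) < l + 1
  · exact Or.inl ⟨⟨i, h⟩, rfl⟩
  · refine Or.inr ⟨⟨i - (l + 1), by omega⟩, ?_⟩
    ext
    simp only [tailIdx]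
    omega

theorem headIdx_injective (k l : ℕ) : Function.Injective (headIdx k l) := fun i j h => by
  simpa [headIdx, Fin.ext_iff] using h

theorem tailIdx_injective (k l : ℕ) : Function.Injective (tailIdx k l) := fun i j h => by
  simpa [tailIdx, Fin.ext_iff] using h

theorem headIdx_ne_tailIdx (k l : ℕ) (i : Fin (l + 1)) (j : Fin k) :
    headIdx k l i ≠ tailIdx k l j := by
  simp only [headIdx, tailIdx, ne_eq, Fin.mk.injEq]
  omega

theorem update_head_head {V : Type*} {k l : ℕ} (τ : Equiv.Perm (Fin (k + l + 1))) (x : Fin (k + l + 1) → V)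
    (j : Fin (l + 1)) (v : V) :
    (fun i => Function.update x (τ (headIdx k l j)) v (τ (headIdx k l i))) =
      Function.update (fun i => x (τ (headIdx k l i))) j v :=
  Function.update_comp_eq_of_injective x (τ.injective.comp (headIdx_injective k l)) j v

theorem update_head_tail (a : V →ₗ[ℂ] V) {k l : ℕ} (τ : Equiv.Perm (Fin (k + l + 1)))
    (x : Fin (k + l + 1) → V) (j : Fin (l + 1)) (v : V) :
    (fun i => (a ^ l) (Function.update x (τ (headIdx k l j)) v (τ (tailIdx k l i)))) =
      fun i => (a ^ l) (x (τ (tailIdx k l i))) := by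
  funext i
  rw [Function.update_of_ne]
  exact fun h => headIdx_ne_tailIdx k l j i (τ.injective h).symm

theorem update_tail_head {V : Type*} {k l : ℕ} (τ : Equiv.Perm (Fin (k + l + 1)))
    (x : Fin (k + l + 1) → V) (j : Fin k) (v : V) :
    (fun i => Function.update x (τ (tailIdx k l j)) v (τ (headIdx k l i))) =
      fun i => x (τ (headIdx k l i)) := by
  funext i
  rw [Function.update_of_ne]
  exact fun h => headIdx_ne_tailIdx k l i j (τ.injective h)

theorem update_tail_tail (a : V →ₗ[ℂ] V) {k l : ℕ} (τ : Equiv.Perm (Fin (k + l + 1)))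
    (x : Fin (k + l + 1) → V) (j : Fin k) (v : V) :
    (fun i => (a ^ l) (Function.update x (τ (tailIdx k l j)) v (τ (tailIdx k l i)))) =
      Function.update (fun i => (a ^ l) (x (τ (tailIdx k l i)))) j ((a ^ l) v) := by
  funext i
  by_cases h : i = j
  · subst h
    simp
  · rw [Function.update_of_ne h, Function.update_of_ne]
    exact fun h' => h (tailIdx_injective k l (τ.injective h'))

theorem circTerm_update_add (a : V →ₗ[ℂ] V) {k l : ℕ} (f : ConfMap V V k) (g : ConfMap V V l)
    (τ : Equiv.Perm (Fin (k + l + 1))) (x : Fin (k + l + 1) → V) (i : Fin (k + l + 1)) (u v : V) :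
    circTerm a f g τ (Function.update x i (u + v)) =
      circTerm a f g τ (Function.update x i u) + circTerm a f g τ (Function.update x i v) := by
  obtain ⟨i, rfl⟩ := τ.surjective i
  unfold circTerm
  rcases idx_cases k l i with ⟨j, rfl⟩ | ⟨j, rfl⟩
  · simp only [update_head_head, update_head_tail, MultilinearMap.map_update_add, map_add, plug_add]
  · simp only [update_tail_head, update_tail_tail, map_add, plug_update_add]

theorem circTerm_update_smul (a : V →ₗ[ℂ] V) {k l : ℕ} (f : ConfMap V V k) (g : ConfMap V V l)
    (τ : Equiv.Perm (Fin (k + l + 1))) (x : Fin (k + l + 1) → V) (i : Fin (k + l + 1)) (c : ℂ)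
    (u : V) :
    circTerm a f g τ (Function.update x i (c • u)) =
      c • circTerm a f g τ (Function.update x i u) := by
  obtain ⟨i, rfl⟩ := τ.surjective i
  unfold circTerm
  rcases idx_cases k l i with ⟨j, rfl⟩ | ⟨j, rfl⟩
  · simp only [update_head_head, update_head_tail, MultilinearMap.map_update_smul, map_smul,
      plug_smul]
  · simp only [update_tail_head, update_tail_tail, map_smul, plug_update_smul]

end lemmas

variable [Module (Polynomial ℂ) V] [IsScalarTower ℂ (Polynomial ℂ) V]

/-- The circle product `f ⊚ g`: the signed sum of `circTerm` over the shuffles, with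
`λ_{k+l+1} ↦ λ_{k+l+1}^†`. -/
def circ (a : V →ₗ[ℂ] V) {k l : ℕ} (f : ConfMap V V k) (g : ConfMap V V l) :
    ConfMap V V (k + l) :=
  MultilinearMap.mk'
    (fun x => dagger V (k + l) (∑ τ ∈ shuffles k l, (τ.sign : ℤ) • circTerm a f g τ x))
    (by
      intro x i u v
      simp only [circTerm_update_add, smul_add, Finset.sum_add_distrib, map_add])
    (by
      intro x i c u
      simp only [circTerm_update_smul, smul_comm _ c, ← Finset.smul_sum, map_smul])

/-- The circle product as a bilinear map. -/
def circBilin (a : V →ₗ[ℂ] V) (k l : ℕ) :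
    ConfMap V V k →ₗ[ℂ] ConfMap V V l →ₗ[ℂ] ConfMap V V (k + l) :=
  LinearMap.mk₂ ℂ (circ a)
    (by
      intro f f' g
      ext x
      simp [circ, circTerm, plug_add_left, smul_add, Finset.sum_add_distrib])
    (by
      intro c f g
      ext x
      simp [circ, circTerm, plug_smul_left, smul_comm _ c, ← Finset.smul_sum])
    (by
      intro f g g'
      ext x
      simp [circ, circTerm, plug_add, smul_add, Finset.sum_add_distrib])
    (by
      intro c f g
      ext x
      simp [circ, circTerm, plug_smul, smul_comm _ c, ← Finset.smul_sum])

end NijenhuisRichardson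

section Graded

/-- Extend bilinear maps on the summands bilinearly to the direct sum. -/
def bilinExt {A : ℕ → Type*} [∀ n, AddCommGroup (A n)] [∀ n, Module ℂ (A n)]
    {P : Type*} [AddCommGroup P] [Module ℂ P] (N : ∀ k l, A k →ₗ[ℂ] A l →ₗ[ℂ] P) :
    (⨁ n, A n) →ₗ[ℂ] (⨁ n, A n) →ₗ[ℂ] P :=
  DirectSum.toModule ℂ ℕ _ fun k =>
    (DirectSum.toModule ℂ ℕ (A k →ₗ[ℂ] P) fun l => (N k l).flip).flip

theorem bilinExt_lof {A : ℕ → Type*} [∀ n, AddCommGroup (A n)] [∀ n, Module ℂ (A n)]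
    {P : Type*} [AddCommGroup P] [Module ℂ P] (N : ∀ k l, A k →ₗ[ℂ] A l →ₗ[ℂ] P)
    (k l : ℕ) (x : A k) (y : A l) :
    bilinExt N (DirectSum.lof ℂ ℕ A k x) (DirectSum.lof ℂ ℕ A l y) = N k l x y := by
  simp [bilinExt]

variable (V : Type*) [AddCommGroup V] [Module ℂ V]

/-- All maps `V^{⊗ (n+1)} → V[λ_1, …, λ_n]`, `n ≥ 0`, together. -/
abbrev GradedConfMap : Type _ := ⨁ n : ℕ, ConfMap V V n

variable {V} [Module (Polynomial ℂ) V] [IsScalarTower ℂ (Polynomial ℂ) V]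

/-- The circle product on the graded space. -/
def circTotal (a : V →ₗ[ℂ] V) :
    GradedConfMap V →ₗ[ℂ] GradedConfMap V →ₗ[ℂ] GradedConfMap V :=
  bilinExt (A := ConfMap V V) fun k l => (circBilin a k l).compr₂ (DirectSum.lof ℂ ℕ (ConfMap V V) (k + l))

/-- The Nijenhuis-Richardson bracket `[f, g] = f ⊚ g - (-1)^{kl} g ⊚ f` for `f` with `k + 1` and
`g` with `l + 1` arguments, extended bilinearly. -/
def nrBracket (a : V →ₗ[ℂ] V) :
    GradedConfMap V →ₗ[ℂ] GradedConfMap V →ₗ[ℂ] GradedConfMap V :=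
  bilinExt (A := ConfMap V V) fun k l =>
    (circTotal a).compl₁₂ (DirectSum.lof ℂ ℕ (ConfMap V V) k) (DirectSum.lof ℂ ℕ (ConfMap V V) l) +
    (-(-1 : ℂ) ^ (k * l)) •
      ((circTotal a).compl₁₂ (DirectSum.lof ℂ ℕ (ConfMap V V) l)
        (DirectSum.lof ℂ ℕ (ConfMap V V) k)).flip

/-- A bilinear bracket `B` on `⨁_{p ≥ 1} A^p` makes it a graded Lie algebra. -/
structure IsGradedLieBracket {A : ℕ+ → Type*} [∀ p, AddCommGroup (A p)] [∀ p, Module ℂ (A p)]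
    (B : (⨁ p, A p) →ₗ[ℂ] (⨁ p, A p) →ₗ[ℂ] (⨁ p, A p)) : Prop where
  degree : ∀ (p q : ℕ+) (x : A p) (y : A q), ∃ z : A (p + q),
    B (DirectSum.lof ℂ ℕ+ A p x) (DirectSum.lof ℂ ℕ+ A q y) = DirectSum.lof ℂ ℕ+ A (p + q) z
  skew : ∀ (p q : ℕ+) (x : A p) (y : A q),
    B (DirectSum.lof ℂ ℕ+ A p x) (DirectSum.lof ℂ ℕ+ A q y) =
      -((-1 : ℂ) ^ (p * q : ℕ) • B (DirectSum.lof ℂ ℕ+ A q y) (DirectSum.lof ℂ ℕ+ A p x))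
  jacobi : ∀ (p q r : ℕ+) (x : A p) (y : A q) (z : A r),
    B (DirectSum.lof ℂ ℕ+ A p x) (B (DirectSum.lof ℂ ℕ+ A q y) (DirectSum.lof ℂ ℕ+ A r z)) =
      B (B (DirectSum.lof ℂ ℕ+ A p x) (DirectSum.lof ℂ ℕ+ A q y)) (DirectSum.lof ℂ ℕ+ A r z) +
      (-1 : ℂ) ^ (p * q : ℕ) •
        B (DirectSum.lof ℂ ℕ+ A q y) (B (DirectSum.lof ℂ ℕ+ A p x) (DirectSum.lof ℂ ℕ+ A r z))

end Graded

section Derived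

variable {L M : Type*} [AddCommGroup L] [Module ℂ L] [Module (Polynomial ℂ) L]
  [IsScalarTower ℂ (Polynomial ℂ) L] [AddCommGroup M] [Module ℂ M] [Module (Polynomial ℂ) M]
  [IsScalarTower ℂ (Polynomial ℂ) M]
  {H : HomLieConformalAlgebra L} (R : Representation M H)

/-- The `λ`-bracket of the semi-direct product on `L ⊕ M`:
`[(x + m)_λ (y + n)] = [x_λ y] + ρ(x)_λ n - ρ(y)_{-∂-λ} m`. -/
def Representation.semidirectBracket :
    (L × M) →ₗ[ℂ] (L × M) →ₗ[ℂ] PolyMod (L × M) (Fin 1) :=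
  (H.bracket.compl₁₂ (LinearMap.fst ℂ L M) (LinearMap.fst ℂ L M)).compr₂
      ((LinearMap.inl ℂ L M).lTensor _) +
  ((R.ρ.compl₁₂ (LinearMap.fst ℂ L M) (LinearMap.snd ℂ L M)) -
    ((lamOpp R.ρ).compl₁₂ (LinearMap.snd ℂ L M) (LinearMap.fst ℂ L M))).compr₂
      ((LinearMap.inr ℂ L M).lTensor _)

/-- The twist map `α + β` of the semi-direct product. -/
def Representation.semidirectTwist : (L × M) →ₗ[ℂ] (L × M) := H.α.prodMap R.β

/-- The element `m_c + ρ`, that is, the semi-direct product bracket as a map with two arguments. -/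
def Representation.mcElement : GradedConfMap (L × M) :=
  DirectSum.lof ℂ ℕ (ConfMap (L × M) (L × M)) 1 (ofBilinear R.semidirectBracket)

/-- The lift `f̂((x_1, m_1), …, (x_p, m_p)) = (f(m_1, …, m_p), 0)` to `L ⊕ M`. -/
def lift (n : ℕ) : ConfMap M L n →ₗ[ℂ] ConfMap (L × M) (L × M) n where
  toFun f := ((LinearMap.inl ℂ L M).lTensor _).compMultilinearMap
    (f.compLinearMap fun _ => LinearMap.snd ℂ L M)
  map_add' f g := by ext x; simp
  map_smul' c f := by ext x; simp

/-- The cochain space `C^p_{β,α}(M, L)`. -/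
abbrev Representation.C (p : ℕ+) : Submodule ℂ (ConfMap M L p.natPred) :=
  cochains R.β H.α p.natPred

/-- The graded space `C^*_{β,α}(M, L) = ⨁_{p ≥ 1} C^p_{β,α}(M, L)`. -/
abbrev Representation.GradedC : Type _ := ⨁ p : ℕ+, R.C p

/-- The homogeneous element of `C^*_{β,α}(M, L)` given by a `p`-cochain. -/
abbrev Representation.of (p : ℕ+) (f : R.C p) : R.GradedC :=
  DirectSum.lof ℂ ℕ+ (fun p => R.C p) p f

/-- The lift on the whole graded space. -/
def Representation.liftTotal : R.GradedC →ₗ[ℂ] GradedConfMap (L × M) :=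
  DirectSum.toModule ℂ ℕ+ _ fun p =>
    DirectSum.lof ℂ ℕ (ConfMap (L × M) (L × M)) p.natPred ∘ₗ lift p.natPred ∘ₗ (R.C p).subtype

/-- `B` is the derived bracket `{{f, g}} = (-1)^p [[m_c + ρ, f], g]`, `f` a `p`-cochain, cochains
on `M` with values in `L` being identified with their lifts to `L ⊕ M`. -/
def Representation.IsDerivedBracket (B : R.GradedC →ₗ[ℂ] R.GradedC →ₗ[ℂ] R.GradedC) : Prop :=
  ∀ (p q : ℕ+) (f : R.C p) (g : R.C q),
    R.liftTotal (B (R.of p f) (R.of q g)) =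
      (-1 : ℂ) ^ (p : ℕ) •
        nrBracket R.semidirectTwist
          (nrBracket R.semidirectTwist R.mcElement (R.liftTotal (R.of p f)))
          (R.liftTotal (R.of q g))

end Derived

end HomLieConformal

end

/-!
The theorem is proved by turning conformal cochains into alternating functions, so that the
substitution `λ_{n+1} ↦ λ_{n+1}^†` disappears from the calculations.

Let `WeightModule V σ` be the direct sum of the modules `V[λ_i : i ∈ σ] / (∂ + ν)` over all
polynomials `ν` in the `λ_i`. A map `f` with `n + 1` arguments gives the function `hat σ n f` of
lists of `n + 1` pairs `(v_i, ν_i)`, whose value is the class of `f_{ν_1, …, ν_n}(v_1, …, v_{n+1})`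
in the summand of index `ν_1 + ⋯ + ν_{n+1}`. In that summand `∂` acts as
`-(ν_1 + ⋯ + ν_{n+1})`, so the last spectral parameter is on the same footing as the others, and
`f` is a cochain if and only if it intertwines the twist maps and `hat σ n f` is sesquilinear in
every entry and alternating (`hat_isSesq`, `hat_isAlt`, `mem_cochains_of_hat`). Nothing is lost:
`f` is recovered from the generic list `(v_i, λ_i)` (`eq_of_hat_generic`), because
`V[λ_1, …, λ_{n+1}] / (∂ + λ_1 + ⋯ + λ_{n+1})` is `V[λ_1, …, λ_n]` by way of `dagger`.

A sesquilinear function extends to the weight module in its first argument (`plugFst`), and the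
circle product becomes a shuffle product with respect to the evaluation pairing (`hat_circ`).
Associativity of shuffle products (`wedge_assoc`) and the exchange of two factors
(`wedge_exchange`) show that the associator of the circle product is graded symmetric in its last
two arguments (`preLie_hat`), so the Nijenhuis-Richardson bracket satisfies the graded Jacobi
identity on cochains (`nrBracket_jacobi`).

On `L ⊕ M` call a map of weight `d` if conjugation by `(x, m) ↦ (x, 2 m)` multiplies it by `2^d`
(`HasWeight`). Weights add under the bracket, the semi-direct product bracket has weight `0`, and
a map with `n + 1` arguments has weight `n + 1` if and only if it is the lift of a map on `M` with
values in `L`, whereas it vanishes if its weight is larger. Hence `{{f, g}}` is again a lift, and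
lifts commute. The Nijenhuis-Richardson square of the semi-direct product bracket vanishes: being
of weight `0` it needs to be tested only with at most one argument in `M`, which may be put last,
and then it is the Hom-Jacobi identity or the representation property
(`circ_semidirectBracket_self`). The derived bracket of a square-zero element of degree one on
commuting elements is a graded Lie bracket (`derived_skew`, `derived_jacobi`), which is the first
part.

For the second part, a linear map `T` is a cochain if and only if it is `ℂ[∂]`-linear and
intertwines the twist maps, and bracketing twice with the square-zero operator `(x, m) ↦ (T m, 0)`
yields twice the defect in the defining identity of an `𝒪`-operator
(`nrBracket_nrBracket_ofLinear_eq_zero_iff`).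
-/

noncomputable section

namespace HomLieConformal

/-! ### Shuffle products of functions of lists -/

section Wedge

variable {X Y U W Z U' W' Z' Z₁ Z₂ : Type*} [AddCommGroup U] [AddCommGroup W] [AddCommGroup Z]
  [AddCommGroup U'] [AddCommGroup W'] [AddCommGroup Z'] [AddCommGroup Z₁] [AddCommGroup Z₂]

/-- A pairing that is additive in both arguments. -/
structure BiAdditive (p : U → W → Z) : Prop where
  add_left : ∀ u u' w, p (u + u') w = p u w + p u' w
  add_right : ∀ u w w', p u (w + w') = p u w + p u w'

namespace BiAdditive

variable {p : U → W → Z} (hp : BiAdditive p)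
include hp

theorem zero_left (w : W) : p 0 w = 0 := by
  simpa using hp.add_left 0 0 w

theorem zero_right (u : U) : p u 0 = 0 := by
  simpa using hp.add_right u 0 0

theorem zsmul_left (n : ℤ) (u : U) (w : W) : p (n • u) w = n • p u w :=
  map_zsmul (AddMonoidHom.mk' (fun u => p u w) fun u u' => hp.add_left u u' w) n u

theorem zsmul_right (n : ℤ) (u : U) (w : W) : p u (n • w) = n • p u w :=
  map_zsmul (AddMonoidHom.mk' (fun w => p u w) fun w w' => hp.add_right u w w') n w

end BiAdditive

/-- The sign `(-1)^n` on lists of length `n`. -/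
def signed (A : List X → U) : List X → U := fun L => (-1 : ℤ) ^ L.length • A L

/-- The function vanishes on lists of length different from `m`. -/
def IsHom (m : ℕ) (A : List X → U) : Prop := ∀ L, L.length ≠ m → A L = 0

/-- The shuffle product with respect to a pairing `p`: the signed sum, over all ways to split a
list into two complementary sublists `S` and `T`, of `p (A S) (B T)`. It is defined by recursion
on the list, whose first entry goes to `S` or to `T`; in the second case it has to pass the
entries of `S`, which accounts for the sign. -/
def wedge (p : U → W → Z) : (List X → U) → (List X → W) → List X → Z
  | A, B, [] => p (A []) (B [])
  | A, B, x :: L =>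
    wedge p (fun T => A (x :: T)) B L + wedge p (signed A) (fun T => B (x :: T)) L

theorem signed_signed (A : List X → U) : signed (signed A) = A := by
  funext L
  simp [signed, smul_smul, ← mul_pow]

theorem signed_cons (A : List X → U) (x : X) :
    (fun T => signed A (x :: T)) = (-1 : ℤ) • signed (fun T => A (x :: T)) := by
  funext T
  simp [signed, pow_succ]

theorem IsHom.signed_eq {m : ℕ} {A : List X → U} (h : IsHom m A) :
    signed A = (-1 : ℤ) ^ m • A := by
  funext L
  by_cases hL : L.length = m
  · simp [signed, hL]
  · simp [signed, h L hL]

theorem IsHom.cons {m : ℕ} {A : List X → U} (h : IsHom (m + 1) A) (x : X) :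
    IsHom m fun T => A (x :: T) := fun L hL => h _ (by simpa using hL)

theorem IsHom.cons_zero {A : List X → U} (h : IsHom 0 A) (x : X) :
    (fun T => A (x :: T)) = 0 := funext fun T => h _ (by simp)

theorem IsHom.signed {m : ℕ} {A : List X → U} (h : IsHom m A) : IsHom m (signed A) :=
  fun L hL => by simp [HomLieConformal.signed, h L hL]

variable {p : U → W → Z}

/-- Naturality of the shuffle product in all its data. -/
theorem map_wedge (hp : BiAdditive p) {p' : U' → W' → Z'} (hp' : BiAdditive p') (φ : Z →+ Z')
    (s : X → Y) {A : List X → U} {B : List X → W} {A' : List Y → U'} {B' : List Y → W'}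
    (h : ∀ S T, φ (p (A S) (B T)) = p' (A' (S.map s)) (B' (T.map s))) (L : List X) :
    φ (wedge p A B L) = wedge p' A' B' (L.map s) := by
  induction L generalizing A B A' B' with
  | nil => exact h [] []
  | cons x L ih =>
    simp only [wedge, map_add, List.map_cons]
    rw [ih (A' := fun T => A' (s x :: T)) (B' := B'), ih (A' := signed A')
      (B' := fun T => B' (s x :: T))]
    · intro S T
      simp only [signed, hp.zsmul_left, hp'.zsmul_left, map_zsmul, h, List.length_map,
        List.map_cons]
    · intro S T
      simpa using h (x :: S) T

theorem map_wedge' (hp : BiAdditive p) {p' : U' → W' → Z'} (hp' : BiAdditive p') (φ : Z →+ Z')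
    {A : List X → U} {B : List X → W} {A' : List X → U'} {B' : List X → W'}
    (h : ∀ S T, φ (p (A S) (B T)) = p' (A' S) (B' T)) (L : List X) :
    φ (wedge p A B L) = wedge p' A' B' L := by
  simpa using map_wedge hp hp' φ id (A' := A') (B' := B') (by simpa using h) L

theorem wedge_zero_left (hp : BiAdditive p) (B : List X → W) (L : List X) :
    wedge p 0 B L = 0 := by
  have := map_wedge' hp hp (0 : Z →+ Z) (A := 0) (B := B) (A' := 0) (B' := B)
    (by simp [hp.zero_left]) L
  simpa using this.symm

theorem wedge_zero_right (hp : BiAdditive p) (A : List X → U) (L : List X) :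
    wedge p A 0 L = 0 := by
  have := map_wedge' hp hp (0 : Z →+ Z) (A := A) (B := 0) (A' := A) (B' := 0)
    (by simp [hp.zero_right]) L
  simpa using this.symm

theorem wedge_zsmul_left (hp : BiAdditive p) (n : ℤ) (A : List X → U) (B : List X → W)
    (L : List X) : wedge p (n • A) B L = n • wedge p A B L :=
  (map_wedge' hp hp (zsmulAddGroupHom n) (by simp [hp.zsmul_left]) L).symm

theorem wedge_zsmul_right (hp : BiAdditive p) (n : ℤ) (A : List X → U) (B : List X → W)
    (L : List X) : wedge p A (n • B) L = n • wedge p A B L :=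
  (map_wedge' hp hp (zsmulAddGroupHom n) (by simp [hp.zsmul_right]) L).symm

theorem wedge_add_right (hp : BiAdditive p) (A : List X → U) (B B' : List X → W)
    (L : List X) : wedge p A (fun T => B T + B' T) L = wedge p A B L + wedge p A B' L := by
  induction L generalizing A B B' with
  | nil => exact hp.add_right _ _ _
  | cons x L ih =>
    simp only [wedge, ih]
    abel

theorem wedge_signed (hp : BiAdditive p) (A : List X → U) (B : List X → W) (L : List X) :
    wedge p (signed A) (signed B) L = signed (wedge p A B) L := by
  induction L generalizing A B with
  | nil => simp [wedge, signed]
  | cons x L ih =>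
    have h : signed (wedge p A B) (x :: L) =
        (-1 : ℤ) • (signed (wedge p (fun T => A (x :: T)) B) L +
          signed (wedge p (signed A) (fun T => B (x :: T))) L) := by
      simp [signed, wedge, pow_succ]
    rw [h, ← ih, ← ih, wedge, signed_cons, signed_cons, wedge_zsmul_left hp,
      wedge_zsmul_right hp, smul_add]

theorem wedge_eq_zero_of_lt (hp : BiAdditive p) {m : ℕ} {A : List X → U} (hA : IsHom m A)
    (B : List X → W) (L : List X) (h : L.length < m) : wedge p A B L = 0 := by
  induction L generalizing A B m with
  | nil => rw [wedge, hA _ (by simp at h ⊢; omega), hp.zero_left]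
  | cons x L ih =>
    obtain ⟨m, rfl⟩ : ∃ k, m = k + 1 := ⟨m - 1, by simp at h; omega⟩
    simp only [List.length_cons] at h
    rw [wedge, ih (hA.cons x) _ (by omega), ih hA.signed _ (by omega), add_zero]

theorem wedge_isHom (hp : BiAdditive p) {m n : ℕ} {A : List X → U} {B : List X → W}
    (hA : IsHom m A) (hB : IsHom n B) : IsHom (m + n) (wedge p A B) := by
  intro L hL
  induction L generalizing A B m n with
  | nil =>
    rw [wedge]
    rcases Nat.eq_zero_or_pos m with rfl | hm
    · rw [hB _ (by simp at hL ⊢; omega), hp.zero_right]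
    · rw [hA _ (by simp; omega), hp.zero_left]
  | cons x L ih =>
    rw [wedge]
    have h1 : wedge p (fun T => A (x :: T)) B L = 0 := by
      cases m with
      | zero => rw [hA.cons_zero, wedge_zero_left hp]
      | succ m => exact ih (hA.cons x) hB (by simp at hL; omega)
    have h2 : wedge p (signed A) (fun T => B (x :: T)) L = 0 := by
      cases n with
      | zero => rw [hB.cons_zero, wedge_zero_right hp]
      | succ n => exact ih hA.signed (hB.cons x) (by simp at hL; omega)
    rw [h1, h2, add_zero]

/-- Associativity of the shuffle product, for pairings that are associative together. -/
theorem wedge_assoc {q : Z₁ → W' → Z'} {p₁ : U → W → Z₁} {p₂ : W → W' → Z₂} {q' : U → Z₂ → Z'}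
    (hq : BiAdditive q) (hp₁ : BiAdditive p₁) (hq' : BiAdditive q')
    (h : ∀ u w w', q (p₁ u w) w' = q' u (p₂ w w'))
    (A : List X → U) (B : List X → W) (C : List X → W') (L : List X) :
    wedge q (wedge p₁ A B) C L = wedge q' A (wedge p₂ B C) L := by
  induction L generalizing A B C with
  | nil => exact h _ _ _
  | cons x L ih =>
    have e1 : (fun T => wedge p₁ A B (x :: T)) = fun T =>
        wedge p₁ (fun T => A (x :: T)) B T + wedge p₁ (signed A) (fun T => B (x :: T)) T := rfl
    have e2 : (fun T => wedge p₂ B C (x :: T)) = fun T =>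
        wedge p₂ (fun T => B (x :: T)) C T + wedge p₂ (signed B) (fun T => C (x :: T)) T := rfl
    have e3 : signed (wedge p₁ A B) = wedge p₁ (signed A) (signed B) :=
      funext fun T => (wedge_signed hp₁ A B T).symm
    -- additivity in the first argument, for functions with values in `Z₁`
    have e4 : ∀ (A A' : List X → Z₁), wedge q (fun T => A T + A' T) C L =
        wedge q A C L + wedge q A' C L := by
      intro A A'
      clear ih e1 e2 e3
      induction L generalizing A A' C with
      | nil => exact hq.add_left _ _ _
      | cons x L ih =>
        simp only [wedge]
        rw [ih, show signed (fun T => A T + A' T) = fun T => signed A T + signed A' T from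
          funext fun T => smul_add _ _ _, ih]
        abel
    rw [wedge, wedge, e1, e2, e3, e4, wedge_add_right hq', ih, ih, ih]
    abel

/-- Graded commutativity of the shuffle product, for pairings that take two values of degrees `m`
and `n` one after the other. -/
theorem wedge_exchange {m n : ℕ} {p₁ : U → Z₁ → Z} {p₂ : W → W' → Z₁} {q₁ : W → Z₂ → Z}
    {q₂ : U → W' → Z₂} (hp₁ : BiAdditive p₁) (hp₂ : BiAdditive p₂) (hq₁ : BiAdditive q₁)
    (hq₂ : BiAdditive q₂) (h : ∀ u w w', p₁ u (p₂ w w') = q₁ w (q₂ u w'))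
    {A : List X → U} {B : List X → W} (hA : IsHom m A) (hB : IsHom n B) (C : List X → W')
    (L : List X) :
    wedge p₁ A (wedge p₂ B C) L = (-1 : ℤ) ^ (m * n) • wedge q₁ B (wedge q₂ A C) L := by
  induction L generalizing A B C m n with
  | nil =>
    simp only [wedge]
    rcases Nat.eq_zero_or_pos m with rfl | hm
    · simp [h]
    · rw [hA _ (by simp; omega), hp₁.zero_left, hq₂.zero_left, hq₁.zero_right, smul_zero]
  | cons x L ih =>
    have e1 : (fun T => wedge p₂ B C (x :: T)) = fun T =>
        wedge p₂ (fun T => B (x :: T)) C T + wedge p₂ (signed B) (fun T => C (x :: T)) T := rfl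
    have e2 : (fun T => wedge q₂ A C (x :: T)) = fun T =>
        wedge q₂ (fun T => A (x :: T)) C T + wedge q₂ (signed A) (fun T => C (x :: T)) T := rfl
    -- if `m = 0`, then `A (x :: T) = 0` for all `T`, and likewise for `B`
    have z1 : ∀ (D : List X → U), wedge p₁ D (wedge p₂ (0 : List X → W) C) L = 0 := fun D => by
      rw [show wedge p₂ (0 : List X → W) C = 0 from funext (wedge_zero_left hp₂ C),
        wedge_zero_right hp₁]
    have z2 : ∀ (D : List X → W), wedge q₁ D (wedge q₂ (0 : List X → U) C) L = 0 := fun D => by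
      rw [show wedge q₂ (0 : List X → U) C = 0 from funext (wedge_zero_left hq₂ C),
        wedge_zero_right hq₁]
    -- `x` is an argument of `A`, of `B` or of `C`; in the first two cases the sign `(-1)^(m * n)`
    -- of the induction hypothesis, for a degree lowered by one, is completed by `signed`
    have i1 : wedge p₁ (fun T => A (x :: T)) (wedge p₂ B C) L =
        (-1 : ℤ) ^ (m * n) • wedge q₁ (signed B) (wedge q₂ (fun T => A (x :: T)) C) L := by
      cases m with
      | zero => rw [hA.cons_zero, wedge_zero_left hp₁, z2, smul_zero]
      | succ m =>
        rw [ih (hA.cons x) hB, hB.signed_eq, wedge_zsmul_left hq₁, smul_smul, ← pow_add,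
          show (m + 1) * n + n = m * n + 2 * n by ring, pow_add, pow_mul (-1) 2]
        simp
    have i2 : wedge p₁ (signed A) (wedge p₂ (fun T => B (x :: T)) C) L =
        (-1 : ℤ) ^ (m * n) • wedge q₁ (fun T => B (x :: T)) (wedge q₂ A C) L := by
      cases n with
      | zero => rw [hB.cons_zero, wedge_zero_left hq₁, z1, smul_zero]
      | succ n =>
        rw [hA.signed_eq, wedge_zsmul_left hp₁, ih hA (hB.cons x), smul_smul, ← pow_add,
          show m + m * n = m * (n + 1) by ring]
    have i3 : wedge p₁ (signed A) (wedge p₂ (signed B) (fun T => C (x :: T))) L =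
        (-1 : ℤ) ^ (m * n) •
          wedge q₁ (signed B) (wedge q₂ (signed A) (fun T => C (x :: T))) L :=
      ih hA.signed hB.signed _
    rw [wedge, wedge, e1, e2, wedge_add_right hp₁, wedge_add_right hq₁, i1, i2, i3]
    simp only [smul_add]
    abel

/-- The function changes sign when two neighbouring entries are exchanged. -/
def IsAlt (A : List X → U) : Prop :=
  ∀ L₁ x y L₂, A (L₁ ++ x :: y :: L₂) = -A (L₁ ++ y :: x :: L₂)

theorem IsAlt.cons {A : List X → U} (h : IsAlt A) (x : X) : IsAlt fun T => A (x :: T) :=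
  fun L₁ y z L₂ => h (x :: L₁) y z L₂

theorem IsAlt.signed {A : List X → U} (h : IsAlt A) : IsAlt (signed A) := fun L₁ y z L₂ => by
  simp [HomLieConformal.signed, h L₁ y z L₂]

theorem IsAlt.comp_map {A : List Y → U} (h : IsAlt A) (s : X → Y) :
    IsAlt fun T => A (T.map s) := fun L₁ y z L₂ => by
  simp only [List.map_append, List.map_cons]
  exact h _ _ _ _

theorem wedge_isAlt (hp : BiAdditive p) {A : List X → U} {B : List X → W} (hA : IsAlt A)
    (hB : IsAlt B) : IsAlt (wedge p A B) := by
  intro L₁ x y L₂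
  induction L₁ generalizing A B with
  | nil =>
    have h1 : (fun T => A (x :: y :: T)) = (-1 : ℤ) • fun T => A (y :: x :: T) :=
      funext fun T => by simpa using hA [] x y T
    have h2 : (fun T => B (x :: y :: T)) = (-1 : ℤ) • fun T => B (y :: x :: T) :=
      funext fun T => by simpa using hB [] x y T
    simp only [List.nil_append, wedge]
    rw [h1, h2, signed_signed, signed_cons, signed_cons, wedge_zsmul_left hp,
      wedge_zsmul_left hp, wedge_zsmul_left hp, wedge_zsmul_right hp]
    simp only [neg_smul, one_smul]
    abel
  | cons z L₁ ih =>
    simp only [List.cons_append, wedge]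
    rw [ih (hA.cons z) hB, ih hA.signed (hB.cons z)]
    abel

end Wedge

/-! ### Substitutions and the operation `dagger` -/

section Substitution

variable {V W : Type*} [AddCommGroup V] [Module ℂ V] [AddCommGroup W] [Module ℂ W]
  {σ τ υ : Type*}

theorem subst_tmul (ν : σ → MvPolynomial τ ℂ) (r : MvPolynomial σ ℂ) (v : V) :
    subst V ν (r ⊗ₜ[ℂ] v) = MvPolynomial.aeval ν r ⊗ₜ[ℂ] v := rfl

theorem subst_smul (ν : σ → MvPolynomial τ ℂ) (r : MvPolynomial σ ℂ) (P : PolyMod V σ) :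
    subst V ν (r • P) = MvPolynomial.aeval ν r • subst V ν P := by
  induction P using TensorProduct.induction_on with
  | zero => simp
  | tmul q v => simp [subst_tmul, TensorProduct.smul_tmul']
  | add P Q hP hQ => simp only [smul_add, map_add, hP, hQ]

theorem subst_subst (ν : σ → MvPolynomial τ ℂ) (μ : τ → MvPolynomial υ ℂ) (P : PolyMod V σ) :
    subst V μ (subst V ν P) = subst V (fun i => MvPolynomial.aeval μ (ν i)) P := by
  induction P using TensorProduct.induction_on with
  | zero => simp
  | tmul q v =>
    simp only [subst_tmul]
    congr 1
    rw [← AlgHom.comp_apply, MvPolynomial.comp_aeval]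
  | add P Q hP hQ => simp only [map_add, hP, hQ]

theorem subst_X (P : PolyMod V σ) : subst V MvPolynomial.X P = P := by
  induction P using TensorProduct.induction_on with
  | zero => simp
  | tmul q v => simp [subst_tmul]
  | add P Q hP hQ => simp only [map_add, hP, hQ]

theorem subst_lTensor (ν : σ → MvPolynomial τ ℂ) (φ : V →ₗ[ℂ] W) (P : PolyMod V σ) :
    subst W ν (φ.lTensor _ P) = φ.lTensor _ (subst V ν P) := by
  induction P using TensorProduct.induction_on with
  | zero => simp
  | tmul q v => simp [subst_tmul]
  | add P Q hP hQ => simp only [map_add, hP, hQ]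

theorem lTensor_polySmul (φ : V →ₗ[ℂ] W) (r : MvPolynomial σ ℂ) (P : PolyMod V σ) :
    φ.lTensor _ (r • P) = r • φ.lTensor _ P :=
  map_smul (φ.baseChange (MvPolynomial σ ℂ)) r P

variable [Module (Polynomial ℂ) V] [IsScalarTower ℂ (Polynomial ℂ) V]
  [Module (Polynomial ℂ) W] [IsScalarTower ℂ (Polynomial ℂ) W]

theorem dagger_one (n : ℕ) (v : V) : dagger V n (1 ⊗ₜ[ℂ] v) = 1 ⊗ₜ[ℂ] v := by
  simp [dagger, Algebra.TensorProduct.one_def]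

theorem dagger_tmul (n : ℕ) (r : MvPolynomial (Fin (n + 1)) ℂ) (v : V) :
    dagger V n (r ⊗ₜ[ℂ] v) = LinearMap.lTensor (MvPolynomial (Fin n) ℂ)
      ((Algebra.lsmul ℂ ℂ V : Polynomial ℂ →ₐ[ℂ] Module.End ℂ V).toLinearMap.flip v)
      (daggerHom n r) := by
  simp only [dagger, LinearMap.comp_apply, LinearMap.rTensor_tmul, AlgHom.toLinearMap_apply]
  generalize daggerHom n r = q
  induction q using TensorProduct.induction_on with
  | zero => simp
  | tmul a b => simp
  | add a b ha hb => simp only [TensorProduct.add_tmul, map_add] at ha hb ⊢; rw [ha, hb]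

theorem dagger_castSucc_smul (n : ℕ) (i : Fin n) (P : PolyMod V (Fin (n + 1))) :
    dagger V n ((MvPolynomial.X i.castSucc : MvPolynomial (Fin (n + 1)) ℂ) • P) =
      (MvPolynomial.X i : MvPolynomial (Fin n) ℂ) • dagger V n P := by
  induction P using TensorProduct.induction_on with
  | zero => simp
  | tmul r v =>
    rw [TensorProduct.smul_tmul', smul_eq_mul, dagger_tmul, dagger_tmul, map_mul]
    rw [show daggerHom n (MvPolynomial.X i.castSucc) = MvPolynomial.X i ⊗ₜ[ℂ] 1 by
      simp [daggerHom]]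
    generalize daggerHom n r = q
    induction q using TensorProduct.induction_on with
    | zero => simp
    | tmul a b => simp [TensorProduct.smul_tmul']
    | add a b ha hb => simp only [mul_add, map_add, smul_add, ha, hb]
  | add P Q hP hQ => simp only [smul_add, map_add, hP, hQ]

theorem dagger_last_smul (n : ℕ) (P : PolyMod V (Fin (n + 1))) :
    dagger V n ((MvPolynomial.X (Fin.last n) : MvPolynomial (Fin (n + 1)) ℂ) • P) =
      -((∑ i, MvPolynomial.X i : MvPolynomial (Fin n) ℂ) • dagger V n P) -
        (der V).lTensor _ (dagger V n P) := by
  induction P using TensorProduct.induction_on with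
  | zero => simp
  | tmul r v =>
    rw [TensorProduct.smul_tmul', smul_eq_mul, dagger_tmul, dagger_tmul, map_mul]
    rw [show daggerHom n (MvPolynomial.X (Fin.last n)) =
      -((∑ i, MvPolynomial.X i) ⊗ₜ[ℂ] 1) - 1 ⊗ₜ[ℂ] Polynomial.X by simp [daggerHom]]
    generalize daggerHom n r = q
    induction q using TensorProduct.induction_on with
    | zero => simp
    | tmul a b =>
      simp [sub_mul, TensorProduct.smul_tmul', der]
    | add a b ha hb =>
      simp only [mul_add, map_add, smul_add, ha, hb]
      abel
  | add P Q hP hQ =>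
    simp only [smul_add, map_add, hP, hQ]
    abel

omit [Module (Polynomial ℂ) V] [IsScalarTower ℂ (Polynomial ℂ) V] in
/-- Induction on polynomials with coefficients in `V` through the monomials. -/
theorem polyMod_induction {C : PolyMod V σ → Prop} (h1 : ∀ v, C (1 ⊗ₜ v))
    (hX : ∀ i P, C P → C ((MvPolynomial.X i : MvPolynomial σ ℂ) • P))
    (hadd : ∀ P Q, C P → C Q → C (P + Q)) (P : PolyMod V σ) : C P := by
  induction P using TensorProduct.induction_on with
  | zero => simpa using h1 0
  | tmul r v =>
    induction r using MvPolynomial.induction_on generalizing v with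
    | C c =>
      have : (MvPolynomial.C c : MvPolynomial σ ℂ) ⊗ₜ[ℂ] v = 1 ⊗ₜ (c • v) := by
        rw [← TensorProduct.smul_tmul, MvPolynomial.C_eq_smul_one]
      rw [this]
      exact h1 _
    | add p q hp hq => rw [TensorProduct.add_tmul]; exact hadd _ _ (hp v) (hq v)
    | mul_X p i hp =>
      have := hX i _ (hp v)
      rwa [TensorProduct.smul_tmul', smul_eq_mul, mul_comm] at this
  | add P Q hP hQ => exact hadd _ _ hP hQ

theorem dagger_lTensor (n : ℕ) {φ : V →ₗ[ℂ] W} (hφ : ∀ v, φ (der V v) = der W (φ v))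
    (P : PolyMod V (Fin (n + 1))) : dagger W n (φ.lTensor _ P) = φ.lTensor _ (dagger V n P) := by
  induction P using polyMod_induction with
  | h1 v => simp [dagger_one]
  | hX i P hP =>
    rw [lTensor_polySmul]
    cases i using Fin.lastCases with
    | cast i => rw [dagger_castSucc_smul, dagger_castSucc_smul, hP, lTensor_polySmul]
    | last =>
      have hc : φ ∘ₗ der V = der W ∘ₗ φ := LinearMap.ext hφ
      rw [dagger_last_smul, dagger_last_smul, hP, map_sub, map_neg, lTensor_polySmul,
        ← LinearMap.lTensor_comp_apply, ← LinearMap.lTensor_comp_apply, hc]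
  | hadd P Q hP hQ => simp only [map_add, hP, hQ]

theorem dagger_subst_castSucc (n : ℕ) (P : PolyMod V (Fin n)) :
    dagger V n (subst V (fun i => MvPolynomial.X i.castSucc) P) = P := by
  induction P using polyMod_induction with
  | h1 v => simp [subst_tmul, dagger_one]
  | hX i P hP => rw [subst_smul, MvPolynomial.aeval_X, dagger_castSucc_smul, hP]
  | hadd P Q hP hQ => simp only [map_add, hP, hQ]

/-- After the substitution of `dagger`, the operator `∂ + λ_1 + ⋯ + λ_{n+1}` vanishes. -/
theorem dagger_total (n : ℕ) (P : PolyMod V (Fin (n + 1))) :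
    dagger V n ((der V).lTensor _ P +
      (∑ i, MvPolynomial.X i : MvPolynomial (Fin (n + 1)) ℂ) • P) = 0 := by
  rw [map_add, dagger_lTensor n (fun _ => rfl), Fin.sum_univ_castSucc, add_smul, map_add,
    dagger_last_smul, Finset.sum_smul, map_sum, Finset.sum_smul]
  simp only [dagger_castSucc_smul]
  abel

end Substitution

/-! ### The module `⨁_ν V[λ_i] / (∂ + ν)` -/

section WeightModule

variable (V : Type*) [AddCommGroup V] [Module ℂ V] [Module (Polynomial ℂ) V]
  [IsScalarTower ℂ (Polynomial ℂ) V] (σ : Type*)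

/-- The operator that is `∂ + ν` on the summand of index `ν`. -/
def weightRel : (MvPolynomial σ ℂ →₀ PolyMod V σ) →ₗ[MvPolynomial σ ℂ]
    (MvPolynomial σ ℂ →₀ PolyMod V σ) :=
  Finsupp.lsum ℕ fun ν => Finsupp.lsingle ν ∘ₗ
    ((der V).baseChange (MvPolynomial σ ℂ) + ν • LinearMap.id)

/-- The direct sum of the quotients `V[λ_i : i ∈ σ] / (∂ + ν)` over all polynomials `ν` in the
`λ_i`. The class of `P` in the summand of index `ν` stands for `P` with spectral parameter `ν`;
dividing by `∂ + ν` puts the last argument of a cochain on a par with the others. -/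
def WeightModule : Type _ :=
  (MvPolynomial σ ℂ →₀ PolyMod V σ) ⧸ LinearMap.range (weightRel V σ)

instance : AddCommGroup (WeightModule V σ) :=
  inferInstanceAs (AddCommGroup (_ ⧸ LinearMap.range (weightRel V σ)))

instance : Module (MvPolynomial σ ℂ) (WeightModule V σ) :=
  inferInstanceAs (Module _ (_ ⧸ LinearMap.range (weightRel V σ)))

instance : Module ℂ (WeightModule V σ) :=
  inferInstanceAs (Module ℂ (_ ⧸ LinearMap.range (weightRel V σ)))

instance : IsScalarTower ℂ (MvPolynomial σ ℂ) (WeightModule V σ) :=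
  inferInstanceAs (IsScalarTower ℂ _ (_ ⧸ LinearMap.range (weightRel V σ)))

variable {V σ}

/-- The class of a polynomial in the summand of index `ν`. -/
def cls (ν : MvPolynomial σ ℂ) : PolyMod V σ →ₗ[MvPolynomial σ ℂ] WeightModule V σ :=
  (LinearMap.range (weightRel V σ)).mkQ ∘ₗ Finsupp.lsingle ν

/-- The class of an element of `V` with spectral parameter `ν`. -/
def gen (x : V × MvPolynomial σ ℂ) : WeightModule V σ := cls x.2 (1 ⊗ₜ x.1)

theorem cls_tmul (ν r : MvPolynomial σ ℂ) (v : V) : cls ν (r ⊗ₜ[ℂ] v) = r • gen (v, ν) := by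
  rw [gen, ← map_smul, TensorProduct.smul_tmul', smul_eq_mul, mul_one]

theorem cls_eq_zero_iff (ν : MvPolynomial σ ℂ) (P : PolyMod V σ) :
    cls ν P = 0 ↔ Finsupp.single ν P ∈ LinearMap.range (weightRel V σ) :=
  Submodule.Quotient.mk_eq_zero _

theorem weightRel_single (ν : MvPolynomial σ ℂ) (P : PolyMod V σ) :
    weightRel V σ (Finsupp.single ν P) = Finsupp.single ν ((der V).lTensor _ P + ν • P) := by
  rw [weightRel, Finsupp.lsum_single, LinearMap.comp_apply, Finsupp.lsingle_apply,
    LinearMap.add_apply, LinearMap.baseChange_eq_ltensor, LinearMap.smul_apply,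
    LinearMap.id_apply]

theorem cls_der (ν : MvPolynomial σ ℂ) (P : PolyMod V σ) :
    cls ν ((der V).lTensor _ P) = -(ν • cls ν P) := by
  rw [eq_neg_iff_add_eq_zero, ← map_smul, ← map_add, cls_eq_zero_iff]
  exact ⟨Finsupp.single ν P, weightRel_single ν P⟩

/-- The summands of the weight module do not interact: a class with parameter `ν` vanishes only if
the polynomial is a multiple of `∂ + ν`. -/
theorem exists_of_cls_eq_zero {ν : MvPolynomial σ ℂ} {P : PolyMod V σ} (h : cls ν P = 0) :
    ∃ Q, P = (der V).lTensor _ Q + ν • Q := by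
  rw [cls_eq_zero_iff] at h
  obtain ⟨z, hz⟩ := h
  have key : ∀ z, weightRel V σ z ν = (der V).lTensor _ (z ν) + ν • z ν := by
    intro z
    induction z using Finsupp.induction_linear with
    | zero => simp
    | add f g hf hg =>
      simp only [map_add, Finsupp.add_apply, hf, hg, smul_add]
      abel
    | single μ Q =>
      by_cases hμ : μ = ν
      · subst hμ
        simp [weightRel_single]
      · simp [weightRel_single, hμ]
  refine ⟨z ν, ?_⟩
  rw [← key, hz]
  simp

/-- No information is lost on passing to the quotient: polynomials in `λ_1, …, λ_n` are
recovered from their classes with parameter `λ_1 + ⋯ + λ_{n+1}`. -/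
theorem eq_of_cls_eq {n : ℕ} {P Q : PolyMod V (Fin n)}
    (h : cls (∑ i, MvPolynomial.X i : MvPolynomial (Fin (n + 1)) ℂ)
        (subst V (fun i => MvPolynomial.X i.castSucc) P) =
      cls (∑ i, MvPolynomial.X i) (subst V (fun i => MvPolynomial.X i.castSucc) Q)) : P = Q := by
  rw [← sub_eq_zero, ← map_sub, ← map_sub] at h
  obtain ⟨Z, hZ⟩ := exists_of_cls_eq_zero h
  have := congrArg (dagger V n) hZ
  rw [dagger_subst_castSucc, dagger_total] at this
  exact sub_eq_zero.1 this

/-- In the quotient, `λ_{n+1}^†` may be replaced by the parameter of the last argument. -/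
theorem cls_subst_dagger {n : ℕ} (ν : Fin (n + 1) → MvPolynomial σ ℂ)
    (P : PolyMod V (Fin (n + 1))) :
    cls (∑ i, ν i) (subst V (fun i => ν i.castSucc) (dagger V n P)) =
      cls (∑ i, ν i) (subst V ν P) := by
  induction P using polyMod_induction with
  | h1 v => simp [subst_tmul, dagger_one]
  | hX i P hP =>
    cases i using Fin.lastCases with
    | cast i =>
      rw [dagger_castSucc_smul, subst_smul, subst_smul, map_smul, map_smul, hP]
      simp
    | last =>
      rw [dagger_last_smul, map_sub, map_neg, subst_smul, subst_lTensor, map_sub, map_neg,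
        map_smul, cls_der, hP, subst_smul, map_smul, sub_neg_eq_add, neg_add_eq_sub, ← sub_smul]
      congr 1
      simp [Fin.sum_univ_castSucc]
  | hadd P Q hP hQ => simp only [map_add, hP, hQ]

section Extension

variable {N : Type*} [AddCommGroup N] [Module ℂ N] [Module (MvPolynomial σ ℂ) N]
  [IsScalarTower ℂ (MvPolynomial σ ℂ) N]

omit [Module ℂ N] [IsScalarTower ℂ (MvPolynomial σ ℂ) N] in
/-- Two linear maps that agree on all `gen x` are equal. -/
theorem weightModule_ext {f g : WeightModule V σ →ₗ[MvPolynomial σ ℂ] N}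
    (h : ∀ x, f (gen x) = g (gen x)) : f = g := by
  refine Submodule.linearMap_qext _ (Finsupp.lhom_ext' fun ν => ?_)
  refine LinearMap.ext fun P => ?_
  change f (cls ν P) = g (cls ν P)
  induction P using TensorProduct.induction_on with
  | zero => simp
  | tmul r v => rw [cls_tmul, map_smul, map_smul, h]
  | add P Q hP hQ => simp only [map_add, hP, hQ]

/-- A function of `v` and its spectral parameter `ν` that is linear in `v` and such that `∂ v` is
replaced by `-ν v`. -/
structure IsSesqAt (φ : V × MvPolynomial σ ℂ → N) : Prop where
  add : ∀ v w ν, φ (v + w, ν) = φ (v, ν) + φ (w, ν)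
  smul : ∀ (c : ℂ) v ν, φ (c • v, ν) = c • φ (v, ν)
  der : ∀ v ν, φ (der V v, ν) = -(ν • φ (v, ν))

/-- The weight module is universal for functions that are sesquilinear in one argument. -/
theorem exists_extendGen {φ : V × MvPolynomial σ ℂ → N} (h : IsSesqAt φ) :
    ∃ f : WeightModule V σ →ₗ[MvPolynomial σ ℂ] N, ∀ x, f (gen x) = φ x := by
  let φ' : MvPolynomial σ ℂ → V →ₗ[ℂ] N := fun ν =>
    { toFun := fun v => φ (v, ν)
      map_add' := fun v w => h.add v w ν
      map_smul' := fun c v => h.smul c v ν }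
  have h0 : LinearMap.range (weightRel V σ) ≤ LinearMap.ker
      (Finsupp.lsum ℕ fun ν => LinearMap.liftBaseChange (MvPolynomial σ ℂ) (φ' ν)) := by
    rintro _ ⟨z, rfl⟩
    rw [LinearMap.mem_ker]
    induction z using Finsupp.induction_linear with
    | zero => simp
    | add f g hf hg => rw [map_add, map_add, hf, hg, add_zero]
    | single ν P =>
      induction P using TensorProduct.induction_on with
      | zero => simp
      | tmul r v =>
        rw [weightRel_single, Finsupp.lsum_single]
        simp [φ', h.der, smul_smul, mul_comm]
      | add P Q hP hQ => rw [Finsupp.single_add, map_add, map_add, hP, hQ, add_zero]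
  refine ⟨Submodule.liftQ _ _ h0, fun x => ?_⟩
  change (Finsupp.lsum ℕ _) (Finsupp.single x.2 (1 ⊗ₜ x.1)) = _
  simp [φ']

open Classical in
/-- The linear map on the weight module with prescribed values on the `gen x`, and `0` if there
is none. -/
def extendGen (φ : V × MvPolynomial σ ℂ → N) : WeightModule V σ →ₗ[MvPolynomial σ ℂ] N :=
  if h : ∃ f : WeightModule V σ →ₗ[MvPolynomial σ ℂ] N, ∀ x, f (gen x) = φ x then h.choose
  else 0

theorem extendGen_gen {φ : V × MvPolynomial σ ℂ → N} (h : IsSesqAt φ)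
    (x : V × MvPolynomial σ ℂ) : extendGen φ (gen x) = φ x := by
  rw [extendGen, dif_pos (exists_extendGen h)]
  exact (exists_extendGen h).choose_spec x

end Extension

end WeightModule

/-! ### Shuffle permutations -/

section Shuffles

/-- The permutations of `N` positions that are increasing on the first `m` positions and on the
remaining ones. -/
def shufflePerms (m N : ℕ) : Finset (Equiv.Perm (Fin N)) :=
  Finset.univ.filter fun τ => ∀ i j : Fin N, i < j → ((j : ℕ) < m ∨ m ≤ (i : ℕ)) → τ i < τ j

theorem mem_shufflePerms {m N : ℕ} {τ : Equiv.Perm (Fin N)} : τ ∈ shufflePerms m N ↔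
    ∀ i j : Fin N, i < j → ((j : ℕ) < m ∨ m ≤ (i : ℕ)) → τ i < τ j := by
  simp [shufflePerms]

/-- The extension of a permutation by the fixed point `0`. -/
def fixZero {N : ℕ} (e : Equiv.Perm (Fin N)) : Equiv.Perm (Fin (N + 1)) :=
  Equiv.Perm.decomposeFin.symm (0, e)

theorem fixZero_zero {N : ℕ} (e : Equiv.Perm (Fin N)) : fixZero e 0 = 0 := by
  simp [fixZero]

theorem fixZero_succ {N : ℕ} (e : Equiv.Perm (Fin N)) (i : Fin N) :
    fixZero e i.succ = (e i).succ := by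
  simp [fixZero]

theorem sign_fixZero {N : ℕ} (e : Equiv.Perm (Fin N)) : (fixZero e).sign = e.sign := by
  simp [fixZero, Equiv.Perm.decomposeFin.symm_sign]

theorem fixZero_injective (N : ℕ) : Function.Injective (fixZero (N := N)) := fun e e' h => by
  simpa [fixZero] using h

theorem exists_fixZero {N : ℕ} {τ : Equiv.Perm (Fin (N + 1))} (h : τ 0 = 0) :
    ∃ e, τ = fixZero e := by
  obtain ⟨⟨p, e⟩, rfl⟩ := Equiv.Perm.decomposeFin.symm.surjective τ
  rw [Equiv.Perm.decomposeFin_symm_apply_zero] at h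
  exact ⟨e, by rw [h, fixZero]⟩

theorem fixZero_mem_shufflePerms {m N : ℕ} (e : Equiv.Perm (Fin N)) :
    fixZero e ∈ shufflePerms (m + 1) (N + 1) ↔ e ∈ shufflePerms m N := by
  rw [mem_shufflePerms, mem_shufflePerms]
  constructor
  · intro h i j hij hm
    have := h i.succ j.succ (by simpa using hij) (by simpa using hm)
    simpa [fixZero_succ] using this
  · intro h i j hij hm
    cases j using Fin.cases with
    | zero => simp at hij
    | succ j =>
      cases i using Fin.cases with
      | zero => simp [fixZero_zero, fixZero_succ]
      | succ i =>
        simp only [fixZero_succ, Fin.succ_lt_succ_iff] at hij ⊢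
        exact h i j hij (by simpa using hm)

/-- The cycle that moves position `m` to the front sends the positions other than `m` to
`1, …, N` in increasing order. -/
theorem cycleRange_eq_succ {N : ℕ} {m i : Fin (N + 1)} (h : (i : ℕ) ≠ m) (j : Fin N)
    (hj : (j : ℕ) = if (i : ℕ) < m then (i : ℕ) else i - 1) : m.cycleRange i = j.succ := by
  rcases lt_or_gt_of_ne h with h1 | h1
  · rw [Fin.cycleRange_of_lt h1]
    rw [if_pos h1] at hj
    ext
    rw [Fin.val_add_one_of_lt' (by omega), Fin.val_succ, hj]
  · rw [Fin.cycleRange_of_gt h1]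
    rw [if_neg (not_lt_of_gt h1)] at hj
    ext
    rw [Fin.val_succ, hj]
    omega

/-- A shuffle of all positions that puts the smallest entry first in the tail is a shuffle of the
other entries, preceded by the cycle that moves position `m` to the front. -/
theorem fixZero_mul_cycleRange_mem {N : ℕ} (m : Fin (N + 1)) (e : Equiv.Perm (Fin N)) :
    fixZero e * m.cycleRange ∈ shufflePerms m (N + 1) ↔ e ∈ shufflePerms m N := by
  rw [mem_shufflePerms, mem_shufflePerms]
  have hm := m.2
  constructor
  · intro h i j hij hc
    have hij' : (i : ℕ) < j := hij
    have e1 : ∀ i : Fin N,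
        m.cycleRange (if (i : ℕ) < m then i.castSucc else i.succ) = i.succ := by
      intro i
      split_ifs with hi
      · exact cycleRange_eq_succ (by rw [Fin.val_castSucc]; omega) i (by simp [hi])
      · refine cycleRange_eq_succ (by rw [Fin.val_succ]; omega) i ?_
        rw [Fin.val_succ, if_neg (by omega), Nat.add_sub_cancel]
    have := h (if (i : ℕ) < m then i.castSucc else i.succ)
      (if (j : ℕ) < m then j.castSucc else j.succ)
      (by
        split_ifs <;> rw [Fin.lt_def] <;> simp only [Fin.val_castSucc, Fin.val_succ] <;> omega)
      (by split_ifs <;> simp only [Fin.val_castSucc, Fin.val_succ] <;> omega)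
    rw [Equiv.Perm.mul_apply, Equiv.Perm.mul_apply, e1, e1, fixZero_succ, fixZero_succ,
      Fin.succ_lt_succ_iff] at this
    exact this
  · intro h i j hij hc
    have hij' : (i : ℕ) < j := hij
    rw [Equiv.Perm.mul_apply, Equiv.Perm.mul_apply]
    have hjm : (j : ℕ) ≠ m := by omega
    obtain ⟨j', hj'⟩ : ∃ j' : Fin N, (j' : ℕ) = if (j : ℕ) < m then (j : ℕ) else j - 1 :=
      ⟨⟨if (j : ℕ) < m then (j : ℕ) else j - 1, by split_ifs <;> omega⟩, rfl⟩
    rw [cycleRange_eq_succ hjm j' hj', fixZero_succ]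
    by_cases him : (i : ℕ) = m
    · rw [Fin.cycleRange_of_eq (Fin.ext him), fixZero_zero]
      exact Fin.succ_pos _
    · obtain ⟨i', hi'⟩ : ∃ i' : Fin N, (i' : ℕ) = if (i : ℕ) < m then (i : ℕ) else i - 1 :=
        ⟨⟨if (i : ℕ) < m then (i : ℕ) else i - 1, by split_ifs <;> omega⟩, rfl⟩
      rw [cycleRange_eq_succ him i' hi', fixZero_succ, Fin.succ_lt_succ_iff]
      apply h
      · rw [Fin.lt_def]
        split_ifs at hi' hj' <;> omega
      · split_ifs at hi' hj' <;> omega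

/-- A shuffle that does not put the smallest entry first in the head puts it first in the tail. -/
theorem mem_shufflePerms_zero_or {m N : ℕ} (hm : m ≤ N) {τ : Equiv.Perm (Fin (N + 1))}
    (h : τ ∈ shufflePerms m (N + 1)) (h0 : ¬(τ 0 = 0 ∧ 0 < m)) :
    τ ⟨m, by omega⟩ = 0 := by
  rw [mem_shufflePerms] at h
  obtain ⟨j, hj⟩ := τ.surjective 0
  rcases lt_trichotomy (j : ℕ) m with hlt | heq | hgt
  · exfalso
    rcases Nat.eq_zero_or_pos j with hz | hz
    · exact h0 ⟨by rwa [show j = 0 from Fin.ext hz] at hj, by omega⟩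
    · have := h 0 j hz (Or.inl hlt)
      rw [hj] at this
      exact absurd this (by simp)
  · rw [← hj]
    exact congrArg τ (Fin.ext heq.symm)
  · exfalso
    have := h ⟨m, by omega⟩ j hgt (Or.inr le_rfl)
    rw [hj] at this
    exact absurd this (by simp)

variable {X U W Z : Type*} [AddCommGroup U] [AddCommGroup W] [AddCommGroup Z]
  {p : U → W → Z}

theorem ofFn_fixZero {N : ℕ} (x : Fin (N + 1) → X) (e : Equiv.Perm (Fin N)) :
    List.ofFn (fun i => x (fixZero e i)) = x 0 :: List.ofFn fun i => x (e i).succ := by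
  simp [List.ofFn_succ, fixZero_zero, fixZero_succ]

theorem take_ofFn_cycleRange {N : ℕ} (x : Fin (N + 1) → X) (m : Fin (N + 1))
    (e : Equiv.Perm (Fin N)) :
    (List.ofFn fun i => x ((fixZero e * m.cycleRange) i)).take m =
      (List.ofFn fun i => x (e i).succ).take m := by
  have hm := m.2
  refine List.ext_getElem (by simp; omega) fun i h1 h2 => ?_
  simp only [List.length_take, List.length_ofFn] at h1 h2
  simp only [List.getElem_take, List.getElem_ofFn, Equiv.Perm.mul_apply]
  rw [cycleRange_eq_succ (j := ⟨i, by omega⟩) (by simp; omega)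
    (by simp; omega), fixZero_succ]

theorem drop_ofFn_cycleRange {N : ℕ} (x : Fin (N + 1) → X) (m : Fin (N + 1))
    (e : Equiv.Perm (Fin N)) :
    (List.ofFn fun i => x ((fixZero e * m.cycleRange) i)).drop m =
      x 0 :: (List.ofFn fun i => x (e i).succ).drop m := by
  have hm := m.2
  refine List.ext_getElem (by simp; omega) fun i h1 h2 => ?_
  simp only [List.length_drop, List.length_ofFn] at h1
  cases i with
  | zero =>
    simp only [List.getElem_drop, List.getElem_ofFn, Equiv.Perm.mul_apply,
      List.getElem_cons_zero]
    rw [Fin.cycleRange_of_eq (by simp), fixZero_zero]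
  | succ i =>
    simp only [List.getElem_drop, List.getElem_ofFn, Equiv.Perm.mul_apply,
      List.getElem_cons_succ]
    rw [cycleRange_eq_succ (j := ⟨m + i, by omega⟩) (by simp)
      (by simp), fixZero_succ]

/-- The shuffle product is the signed sum over the shuffle permutations. In the induction, a
shuffle puts the smallest entry first in the head or first in the tail. -/
theorem wedge_ofFn (hp : BiAdditive p) {m : ℕ} {A : List X → U} (hA : IsHom m A)
    (B : List X → W) {N : ℕ} (x : Fin N → X) :
    wedge p A B (List.ofFn x) = ∑ τ ∈ shufflePerms m N, (τ.sign : ℤ) •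
      p (A ((List.ofFn fun i => x (τ i)).take m)) (B ((List.ofFn fun i => x (τ i)).drop m)) := by
  induction N generalizing m A B with
  | zero =>
    have : shufflePerms m 0 = Finset.univ :=
      Finset.filter_true_of_mem fun τ _ i => i.elim0
    simp [this, wedge]
  | succ N ih =>
    -- the recursion for `wedge` on the first entry is matched with the two kinds of shuffles
    rcases Nat.lt_or_ge N m with hNm | hNm
    · -- either the head is the whole list, or both sides vanish
      rcases Nat.eq_or_lt_of_le hNm with rfl | hlt
      · have h2 : wedge p (signed A) (fun T => B (x 0 :: T)) (List.ofFn fun i => x i.succ) = 0 :=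
          wedge_eq_zero_of_lt hp hA.signed _ _ (by simp)
        rw [List.ofFn_succ, wedge, h2, add_zero, ih (hA.cons _)]
        have hmem : ∀ τ ∈ shufflePerms N.succ (N + 1), τ 0 = 0 := by
          intro τ hτ
          rw [mem_shufflePerms] at hτ
          obtain ⟨j, hj⟩ := τ.surjective 0
          by_contra hne
          have hj0 : j ≠ 0 := by
            rintro rfl
            exact hne hj
          have := hτ 0 j (Fin.pos_of_ne_zero hj0) (Or.inl j.2)
          rw [hj] at this
          exact absurd this (by simp)
        refine Finset.sum_bij (fun e _ => fixZero e)
          (fun e he => (fixZero_mem_shufflePerms e).2 he)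
          (fun e _ e' _ h => fixZero_injective N h) (fun τ hτ => ?_) (fun e _ => ?_)
        · obtain ⟨e, rfl⟩ := exists_fixZero (hmem τ hτ)
          exact ⟨e, (fixZero_mem_shufflePerms e).1 hτ, rfl⟩
        · rw [sign_fixZero, ofFn_fixZero, List.take_succ_cons, List.drop_succ_cons]
      · rw [wedge_eq_zero_of_lt hp hA _ _ (by simpa using hlt)]
        refine (Finset.sum_eq_zero fun τ _ => ?_).symm
        rw [hA _ (by simp; omega), hp.zero_left, smul_zero]
    · rw [List.ofFn_succ, wedge,
        ← Finset.sum_filter_add_sum_filter_not _ (fun τ => τ 0 = 0 ∧ 0 < m)]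
      congr 1
      · cases m with
        | zero =>
          rw [hA.cons_zero, wedge_zero_left hp]
          simp
        | succ m =>
          rw [ih (hA.cons _)]
          refine Finset.sum_bij (fun e _ => fixZero e) (fun e he => ?_)
            (fun e _ e' _ h => fixZero_injective N h) (fun τ hτ => ?_) (fun e _ => ?_)
          · exact Finset.mem_filter.2 ⟨(fixZero_mem_shufflePerms e).2 he, fixZero_zero e,
              Nat.succ_pos m⟩
          · obtain ⟨h1, h2, -⟩ := Finset.mem_filter.1 hτ
            obtain ⟨e, rfl⟩ := exists_fixZero h2
            exact ⟨e, (fixZero_mem_shufflePerms e).1 h1, rfl⟩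
          · rw [sign_fixZero, ofFn_fixZero, List.take_succ_cons, List.drop_succ_cons]
      · rw [hA.signed_eq, wedge_zsmul_left hp, ih hA, Finset.smul_sum]
        let m' : Fin (N + 1) := ⟨m, by omega⟩
        refine Finset.sum_bij (fun e _ => fixZero e * m'.cycleRange) (fun e he => ?_)
          (fun e _ e' _ h => fixZero_injective N (mul_right_cancel h)) (fun τ hτ => ?_)
          (fun e _ => ?_)
        · refine Finset.mem_filter.2 ⟨(fixZero_mul_cycleRange_mem m' e).2 he, ?_⟩
          rintro ⟨h1, h2⟩
          rw [Equiv.Perm.mul_apply] at h1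
          have h3 : m'.cycleRange 0 = 0 :=
            (fixZero e).injective (h1.trans (fixZero_zero e).symm)
          have h4 := congrArg Fin.val
            (m'.cycleRange.injective (h3.trans (Fin.cycleRange_self m').symm))
          exact absurd h4.symm h2.ne'
        · obtain ⟨h1, h2⟩ := Finset.mem_filter.1 hτ
          have h3 : τ m' = 0 := mem_shufflePerms_zero_or hNm h1 h2
          obtain ⟨e, he⟩ : ∃ e, τ * m'.cycleRange⁻¹ = fixZero e := by
            apply exists_fixZero
            have h5 : m'.cycleRange⁻¹ 0 = m' := by
              rw [Equiv.Perm.inv_eq_iff_eq, Fin.cycleRange_self]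
            rw [Equiv.Perm.mul_apply, h5, h3]
          have h4 : τ = fixZero e * m'.cycleRange := by rw [← he, inv_mul_cancel_right]
          refine ⟨e, ?_, h4.symm⟩
          rw [h4] at h1
          exact (fixZero_mul_cycleRange_mem m' e).1 h1
        · have h1 := take_ofFn_cycleRange x m' e
          have h2 := drop_ofFn_cycleRange x m' e
          rw [show m = (m' : ℕ) from rfl, h1, h2, smul_smul, map_mul, sign_fixZero,
            Fin.sign_cycleRange]
          congr 1
          push_cast
          ring

end Shuffles

/-! ### Sesquilinear functions of lists -/

section Sesquilinear

variable {V : Type*} [AddCommGroup V] [Module ℂ V] [Module (Polynomial ℂ) V]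
  [IsScalarTower ℂ (Polynomial ℂ) V] {σ : Type*}
  {N : Type*} [AddCommGroup N] [Module ℂ N] [Module (MvPolynomial σ ℂ) N]
  [IsScalarTower ℂ (MvPolynomial σ ℂ) N]
  {N' : Type*} [AddCommGroup N'] [Module ℂ N'] [Module (MvPolynomial σ ℂ) N']
  [IsScalarTower ℂ (MvPolynomial σ ℂ) N']

/-- A function of lists of elements of `V` with spectral parameters that is sesquilinear in every
entry. -/
def IsSesq (A : List (V × MvPolynomial σ ℂ) → N) : Prop :=
  ∀ L₁ L₂, IsSesqAt fun x => A (L₁ ++ x :: L₂)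

theorem IsSesqAt.map {φ : V × MvPolynomial σ ℂ → N} (h : IsSesqAt φ)
    (f : N →ₗ[MvPolynomial σ ℂ] N') : IsSesqAt fun x => f (φ x) where
  add v w ν := by rw [h.add, map_add]
  smul c v ν := by rw [h.smul, f.map_smul_of_tower]
  der v ν := by rw [h.der, map_neg, map_smul]

omit [IsScalarTower ℂ (MvPolynomial σ ℂ) N] in
theorem IsSesqAt.zsmul {φ : V × MvPolynomial σ ℂ → N} (h : IsSesqAt φ) (n : ℤ) :
    IsSesqAt fun x => n • φ x where
  add v w ν := by rw [h.add, smul_add]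
  smul c v ν := by rw [h.smul, smul_comm]
  der v ν := by rw [h.der, smul_neg, smul_comm]

omit [IsScalarTower ℂ (MvPolynomial σ ℂ) N] in
theorem IsSesqAt.add' {φ ψ : V × MvPolynomial σ ℂ → N} (h : IsSesqAt φ) (h' : IsSesqAt ψ) :
    IsSesqAt fun x => φ x + ψ x where
  add v w ν := by rw [h.add, h'.add]; abel
  smul c v ν := by rw [h.smul, h'.smul, smul_add]
  der v ν := by rw [h.der, h'.der, smul_add, neg_add]

omit [IsScalarTower ℂ (MvPolynomial σ ℂ) N] in
theorem IsSesq.cons {A : List (V × MvPolynomial σ ℂ) → N} (h : IsSesq A)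
    (x : V × MvPolynomial σ ℂ) : IsSesq fun T => A (x :: T) := fun L₁ L₂ => h (x :: L₁) L₂

omit [IsScalarTower ℂ (MvPolynomial σ ℂ) N] in
theorem IsSesq.at_head {A : List (V × MvPolynomial σ ℂ) → N} (h : IsSesq A)
    (T : List (V × MvPolynomial σ ℂ)) : IsSesqAt fun x => A (x :: T) := h [] T

omit [IsScalarTower ℂ (MvPolynomial σ ℂ) N] in
theorem IsSesq.signed {A : List (V × MvPolynomial σ ℂ) → N} (h : IsSesq A) :
    IsSesq (signed A) := fun L₁ L₂ => by
  have : (fun x => HomLieConformal.signed A (L₁ ++ x :: L₂)) = fun x =>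
      (-1 : ℤ) ^ (L₁.length + (L₂.length + 1)) • A (L₁ ++ x :: L₂) := by
    funext x
    simp [HomLieConformal.signed]
  rw [this]
  exact (h L₁ L₂).zsmul _

variable {U W Z : Type*} [AddCommGroup U] [Module ℂ U] [Module (MvPolynomial σ ℂ) U]
  [IsScalarTower ℂ (MvPolynomial σ ℂ) U]
  [AddCommGroup W] [Module ℂ W] [Module (MvPolynomial σ ℂ) W]
  [IsScalarTower ℂ (MvPolynomial σ ℂ) W]
  [AddCommGroup Z] [Module ℂ Z] [Module (MvPolynomial σ ℂ) Z]
  [IsScalarTower ℂ (MvPolynomial σ ℂ) Z]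

omit [Module ℂ W] [IsScalarTower ℂ (MvPolynomial σ ℂ) W] in
theorem wedge_isSesqAt_left (p : U →ₗ[MvPolynomial σ ℂ] W →ₗ[MvPolynomial σ ℂ] Z)
    {A : V × MvPolynomial σ ℂ → List (V × MvPolynomial σ ℂ) → U}
    (hA : ∀ T, IsSesqAt fun x => A x T) (B : List (V × MvPolynomial σ ℂ) → W)
    (L : List (V × MvPolynomial σ ℂ)) :
    IsSesqAt fun x => wedge (fun u w => p u w) (A x) B L := by
  induction L generalizing A B with
  | nil => exact (hA []).map (p.flip (B []))
  | cons y L ih => exact (ih (fun T => hA (y :: T)) B).add' (ih (fun T => (hA T).zsmul _) _)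

omit [Module ℂ U] [IsScalarTower ℂ (MvPolynomial σ ℂ) U] in
theorem wedge_isSesqAt_right (p : U →ₗ[MvPolynomial σ ℂ] W →ₗ[MvPolynomial σ ℂ] Z)
    (A : List (V × MvPolynomial σ ℂ) → U)
    {B : V × MvPolynomial σ ℂ → List (V × MvPolynomial σ ℂ) → W}
    (hB : ∀ T, IsSesqAt fun x => B x T) (L : List (V × MvPolynomial σ ℂ)) :
    IsSesqAt fun x => wedge (fun u w => p u w) A (B x) L := by
  induction L generalizing A B with
  | nil => exact (hB []).map (p (A []))
  | cons y L ih => exact (ih _ hB).add' (ih _ fun T => hB (y :: T))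

theorem wedge_isSesq (p : U →ₗ[MvPolynomial σ ℂ] W →ₗ[MvPolynomial σ ℂ] Z)
    {A : List (V × MvPolynomial σ ℂ) → U} {B : List (V × MvPolynomial σ ℂ) → W}
    (hA : IsSesq A) (hB : IsSesq B) : IsSesq (wedge (fun u w => p u w) A B) := by
  intro L₁ L₂
  induction L₁ generalizing A B with
  | nil =>
    exact (wedge_isSesqAt_left p (fun T => hA.at_head T) B L₂).add'
      (wedge_isSesqAt_right p _ (fun T => hB.at_head T) L₂)
  | cons y L₁ ih => exact (ih (hA.cons y) hB).add' (ih hA.signed (hB.cons y))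

/-- The first argument is made to range over the weight module. -/
def plugFst (A : List (V × MvPolynomial σ ℂ) → N) (T : List (V × MvPolynomial σ ℂ)) :
    WeightModule V σ →ₗ[MvPolynomial σ ℂ] N := extendGen fun x => A (x :: T)

theorem plugFst_gen {A : List (V × MvPolynomial σ ℂ) → N} (hA : IsSesq A)
    (T : List (V × MvPolynomial σ ℂ)) (x : V × MvPolynomial σ ℂ) :
    plugFst A T (gen x) = A (x :: T) := extendGen_gen (hA.at_head T) x

theorem plugFst_isSesq {A : List (V × MvPolynomial σ ℂ) → N} (hA : IsSesq A) :
    IsSesq (plugFst A) := fun L₁ L₂ =>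
  { add := fun v w ν => weightModule_ext fun x => by
      simpa only [plugFst_gen hA, LinearMap.add_apply, List.cons_append] using (hA (x :: L₁)
        L₂).add v w ν
    smul := fun c v ν => weightModule_ext fun x => by
      simpa only [plugFst_gen hA, LinearMap.smul_apply, List.cons_append] using (hA (x :: L₁)
        L₂).smul c v ν
    der := fun v ν => weightModule_ext fun x => by
      simpa only [plugFst_gen hA, LinearMap.neg_apply, LinearMap.smul_apply, List.cons_append] using
        (hA (x :: L₁) L₂).der v ν }

theorem plugFst_isAlt {A : List (V × MvPolynomial σ ℂ) → N} (hA : IsSesq A) (h : IsAlt A) :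
    IsAlt (plugFst A) := fun L₁ y z L₂ => weightModule_ext fun x => by
  simpa only [plugFst_gen hA, LinearMap.neg_apply, List.cons_append] using h (x :: L₁) y z L₂

theorem plugFst_isHom {n : ℕ} {A : List (V × MvPolynomial σ ℂ) → N} (hA : IsSesq A)
    (h : IsHom (n + 1) A) : IsHom n (plugFst A) := fun L hL => weightModule_ext fun x => by
  simpa only [plugFst_gen hA, LinearMap.zero_apply] using h (x :: L) (by simpa using hL)

/-- For alternating functions, exchanging two arguments in the weight module gives a sign. -/
theorem plugFst_plugFst_swap {A : List (V × MvPolynomial σ ℂ) → N} (hA : IsSesq A)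
    (h : IsAlt A) (T : List (V × MvPolynomial σ ℂ)) (P Q : WeightModule V σ) :
    plugFst (plugFst A) T P Q = -plugFst (plugFst A) T Q P := by
  have : plugFst (plugFst A) T = -(plugFst (plugFst A) T).flip :=
    weightModule_ext fun x => weightModule_ext fun y => by
      have h1 := plugFst_gen (plugFst_isSesq hA) T
      rw [h1, plugFst_gen hA, LinearMap.neg_apply, LinearMap.neg_apply, LinearMap.flip_apply, h1,
        plugFst_gen hA]
      exact h [] y x T
  conv_lhs => rw [this]
  rfl

/-- The endomorphism of the weight module induced by an endomorphism of `V`. -/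
def twistWeight (σ : Type*) (a : V →ₗ[ℂ] V) :
    WeightModule V σ →ₗ[MvPolynomial σ ℂ] WeightModule V σ :=
  extendGen fun x => gen (a x.1, x.2)

theorem gen_isSesqAt : IsSesqAt (gen : V × MvPolynomial σ ℂ → WeightModule V σ) where
  add v w ν := by simp [gen, TensorProduct.tmul_add]
  smul c v ν := by
    rw [gen, gen, TensorProduct.tmul_smul, LinearMap.map_smul_of_tower]
  der v ν := by
    rw [gen, gen, ← cls_der]
    simp

theorem twistWeight_gen {a : V →ₗ[ℂ] V} (ha : ∀ v, a (der V v) = der V (a v))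
    (x : V × MvPolynomial σ ℂ) : twistWeight σ a (gen x) = gen (a x.1, x.2) :=
  extendGen_gen (φ := fun x => gen (a x.1, x.2))
    { add := fun v w ν => by simpa using gen_isSesqAt.add (a v) (a w) ν
      smul := fun c v ν => by simpa using gen_isSesqAt.smul c (a v) ν
      der := fun v ν => by simpa [ha] using gen_isSesqAt.der (a v) ν } x

theorem twistWeight_cls {a : V →ₗ[ℂ] V} (ha : ∀ v, a (der V v) = der V (a v))
    (ν : MvPolynomial σ ℂ) (P : PolyMod V σ) :
    twistWeight σ a (cls ν P) = cls ν (a.lTensor _ P) := by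
  induction P using TensorProduct.induction_on with
  | zero => simp
  | tmul r v => rw [LinearMap.lTensor_tmul, cls_tmul, cls_tmul, map_smul, twistWeight_gen ha]
  | add P Q hP hQ => simp only [map_add, hP, hQ]

end Sesquilinear

/-! ### The function of lists attached to a conformal map -/

section Hat

variable {V : Type*} [AddCommGroup V] [Module ℂ V] [Module (Polynomial ℂ) V]
  [IsScalarTower ℂ (Polynomial ℂ) V] {σ : Type*}

/-- The function `((v_1, ν_1), …, (v_{n+1}, ν_{n+1})) ↦ f_{ν_1, …, ν_n}(v_1, …, v_{n+1})`, with
values in the summand of index `ν_1 + ⋯ + ν_{n+1}` of the weight module; it vanishes on lists of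
other lengths. -/
def hat (σ : Type*) (n : ℕ) :
    ConfMap V V n →ₗ[ℂ] List (V × MvPolynomial σ ℂ) → WeightModule V σ where
  toFun f L := if L.length = n + 1 then
    cls (L.map Prod.snd).sum (subst V (fun i : Fin n => (L.getD i 0).2)
      (f fun i => (L.getD i 0).1)) else 0
  map_add' f g := by
    funext L
    simp only [add_apply, map_add, Pi.add_apply]
    split_ifs <;> simp
  map_smul' c f := by
    funext L
    simp only [smul_apply, map_smul, Pi.smul_apply, RingHom.id_apply,
      LinearMap.map_smul_of_tower]
    split_ifs <;> simp

theorem hat_isHom {n : ℕ} (f : ConfMap V V n) : IsHom (n + 1) (hat σ n f) :=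
  fun _ hL => if_neg hL

theorem hat_ofFn {n : ℕ} (f : ConfMap V V n) (x : Fin (n + 1) → V × MvPolynomial σ ℂ) :
    hat σ n f (List.ofFn x) =
      cls (∑ i, (x i).2) (subst V (fun i => (x i.castSucc).2) (f fun i => (x i).1)) := by
  have h : ∀ i : Fin (n + 1), (List.ofFn x).getD i 0 = x i := fun i => by
    rw [List.getD_eq_getElem _ _ (by rw [List.length_ofFn]; exact i.2), List.getElem_ofFn]
  have h1 : hat σ n f (List.ofFn x) = if (List.ofFn x).length = n + 1 then
    cls ((List.ofFn x).map Prod.snd).sum (subst V (fun i : Fin n => ((List.ofFn x).getD i 0).2)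
      (f fun i => ((List.ofFn x).getD i 0).1)) else 0 := rfl
  rw [h1, if_pos (by simp)]
  simp only [h]
  have h' : ∀ i : Fin n, (List.ofFn x).getD i 0 = x i.castSucc := fun i => h i.castSucc
  simp only [h', List.map_ofFn, List.sum_ofFn, Function.comp_apply]

theorem exists_eq_ofFn {X : Type*} {n : ℕ} (L : List X) (h : L.length = n) :
    ∃ x : Fin n → X, L = List.ofFn x := by
  subst h
  exact ⟨L.get, (List.ofFn_get L).symm⟩

theorem exists_append_cons_eq_ofFn {X : Type*} {n : ℕ} (x₀ : X) (L₁ L₂ : List X)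
    (h : L₁.length + L₂.length = n) :
    ∃ (y : Fin (n + 1) → X) (i : Fin (n + 1)),
      ∀ x, L₁ ++ x :: L₂ = List.ofFn (Function.update y i x) := by
  obtain ⟨y, hy⟩ := exists_eq_ofFn (n := n + 1) (L₁ ++ x₀ :: L₂) (by simp; omega)
  refine ⟨y, ⟨L₁.length, by omega⟩, fun x => List.ext_getElem (by simp; omega)
    fun i h1 h2 => ?_⟩
  have h3 : i < (L₁ ++ x₀ :: L₂).length := by simpa using h1
  have h4 : (L₁ ++ x₀ :: L₂)[i] = y ⟨i, by simpa using h2⟩ := by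
    simp [hy, -List.ofFn_succ]
  rw [List.getElem_ofFn]
  by_cases hi : i = L₁.length
  · subst hi
    simp
  · rw [Function.update_of_ne (by simpa [Fin.ext_iff] using hi), ← h4]
    rcases lt_or_gt_of_ne hi with hlt | hgt
    · rw [List.getElem_append_left hlt, List.getElem_append_left hlt]
    · rw [List.getElem_append_right hgt.le, List.getElem_append_right hgt.le]
      obtain ⟨j, hj⟩ : ∃ j, i - L₁.length = j + 1 := ⟨i - L₁.length - 1, by omega⟩
      simp [hj]

theorem hat_isSesq {a b : V →ₗ[ℂ] V} {n : ℕ} {f : ConfMap V V n} (hf : f ∈ cochains a b n) :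
    IsSesq (hat σ n f) := by
  intro L₁ L₂
  by_cases hL : L₁.length + L₂.length = n
  · obtain ⟨y, i, hy⟩ := exists_append_cons_eq_ofFn (0 : V × MvPolynomial σ ℂ) L₁ L₂ hL
    have h1 : ∀ v (ν : MvPolynomial σ ℂ), (fun j => (Function.update y i (v, ν) j).1) =
        Function.update (fun j => (y j).1) i v := by
      intro v ν
      funext j
      by_cases hj : j = i
      · subst hj; simp
      · simp [hj]
    have h2 : ∀ v (ν : MvPolynomial σ ℂ) j, (Function.update y i (v, ν) j).2 =
        Function.update (fun j => (y j).2) i ν j := by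
      intro v ν j
      by_cases hj : j = i
      · subst hj; simp
      · simp [hj]
    simp only [hy]
    refine ⟨fun v w ν => ?_, fun c v ν => ?_, fun v ν => ?_⟩
    · simp only [hat_ofFn, h1, h2, MultilinearMap.map_update_add, map_add]
    · simp only [hat_ofFn, h1, h2, MultilinearMap.map_update_smul, map_smul,
        LinearMap.map_smul_of_tower]
    · simp only [hat_ofFn, h1, h2]
      obtain ⟨-, hf2, hf3, -⟩ := hf
      cases i using Fin.lastCases with
      | cast i =>
        have := hf2 (Function.update (fun j => (y j).1) i.castSucc v) i
        rw [Function.update_self, Function.update_idem] at this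
        rw [this, map_neg, map_neg, subst_smul, map_smul, MvPolynomial.aeval_X,
          Function.update_self]
      | last =>
        have := hf3 (Function.update (fun j => (y j).1) (Fin.last n) v)
        rw [Function.update_self, Function.update_idem] at this
        rw [this, map_add, map_add, subst_lTensor, cls_der, subst_smul, map_smul, map_sum,
          Fin.sum_univ_castSucc, Function.update_self]
        simp only [MvPolynomial.aeval_X, add_smul]
        abel
  · have : (fun x => hat σ n f (L₁ ++ x :: L₂)) = fun _ => 0 :=
      funext fun x => hat_isHom f _ (by simp; omega)
    rw [this]
    exact ⟨by simp, by simp, by simp⟩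

theorem hat_perm {a b : V →ₗ[ℂ] V} {n : ℕ} {f : ConfMap V V n} (hf : f ∈ cochains a b n)
    (x : Fin (n + 1) → V × MvPolynomial σ ℂ) (τ : Equiv.Perm (Fin (n + 1))) :
    hat σ n f (List.ofFn x) = (τ.sign : ℤ) • hat σ n f (List.ofFn fun i => x (τ i)) := by
  rw [hat_ofFn, hat_ofFn, hf.2.2.2 _ τ, map_zsmul, map_zsmul,
    cls_subst_dagger (fun i => (x i).2), subst_subst]
  simp only [MvPolynomial.aeval_X]
  rw [Equiv.sum_comp τ fun i => (x i).2]

theorem hat_isAlt {a b : V →ₗ[ℂ] V} {n : ℕ} {f : ConfMap V V n} (hf : f ∈ cochains a b n) :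
    IsAlt (hat σ n f) := by
  intro L₁ x y L₂
  by_cases hL : (L₁ ++ x :: y :: L₂).length = n + 1
  · obtain ⟨z, hz⟩ := exists_eq_ofFn _ hL
    simp only [List.length_append, List.length_cons] at hL
    have hne : (⟨L₁.length, by omega⟩ : Fin (n + 1)) ≠ ⟨L₁.length + 1, by omega⟩ := by simp
    rw [hz, hat_perm hf z (Equiv.swap ⟨L₁.length, by omega⟩ ⟨L₁.length + 1, by omega⟩),
      Equiv.Perm.sign_swap hne]
    simp only [Units.val_neg, Units.val_one, neg_smul, one_smul]
    refine congrArg Neg.neg (congrArg (hat σ n f) ?_)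
    have hz' : ∀ i : Fin (n + 1), z i = (L₁ ++ x :: y :: L₂)[i]'(by simp; omega) := by
      simp [hz, -List.ofFn_succ]
    refine List.ext_getElem (by simp; omega) fun i h1 h2 => ?_
    rw [List.length_ofFn] at h1
    rw [List.getElem_ofFn, hz']
    rcases lt_trichotomy i L₁.length with h | h | h
    · simp only [Equiv.swap_apply_of_ne_of_ne (a := (⟨L₁.length, by omega⟩ : Fin (n + 1)))
        (b := ⟨L₁.length + 1, by omega⟩) (x := ⟨i, h1⟩) (by simp; omega) (by simp; omega)]
      simp [List.getElem_append_left h]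
    · subst h
      simp [Equiv.swap_apply_left]
    · by_cases h' : i = L₁.length + 1
      · subst h'
        simp [Equiv.swap_apply_right]
      · simp only [Equiv.swap_apply_of_ne_of_ne (a := (⟨L₁.length, by omega⟩ : Fin (n + 1)))
          (b := ⟨L₁.length + 1, by omega⟩) (x := ⟨i, by omega⟩) (by simp; omega)
          (by simp; omega)]
        obtain ⟨j, hj⟩ : ∃ j, i = L₁.length + (j + 2) := ⟨i - L₁.length - 2, by omega⟩
        subst hj
        simp
  · rw [hat_isHom f _ hL, hat_isHom f, neg_zero]
    simpa using hL

theorem hat_twist {a b : V →ₗ[ℂ] V} (hb : ∀ v, b (der V v) = der V (b v)) {n : ℕ}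
    {f : ConfMap V V n} (hf : ∀ x, b.lTensor _ (f x) = f fun i => a (x i))
    (L : List (V × MvPolynomial σ ℂ)) :
    hat σ n f (L.map (Prod.map a id)) = twistWeight σ b (hat σ n f L) := by
  by_cases hL : L.length = n + 1
  · obtain ⟨x, rfl⟩ := exists_eq_ofFn _ hL
    rw [List.map_ofFn, hat_ofFn, hat_ofFn, twistWeight_cls hb, ← subst_lTensor, hf]
    simp
  · rw [hat_isHom f _ hL, hat_isHom f _ (by simpa using hL), map_zero]

/-- The list of the arguments `v_i` with parameters `λ_i`. -/
def generic {n : ℕ} (x : Fin n → V) : List (V × MvPolynomial (Fin n) ℂ) :=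
  List.ofFn fun i => (x i, MvPolynomial.X i)

/-- A map is determined by the value of its function of lists on the generic list. -/
theorem eq_of_hat_generic {n : ℕ} {f g : ConfMap V V n} {x y : Fin (n + 1) → V}
    (h : hat _ n f (generic x) = hat _ n g (generic y)) : f x = g y := by
  rw [generic, generic, hat_ofFn, hat_ofFn] at h
  exact eq_of_cls_eq h

theorem IsAlt.perm {X U : Type*} [AddCommGroup U] {A : List X → U} (hA : IsAlt A) {n : ℕ}
    (τ : Equiv.Perm (Fin (n + 1))) (x : Fin (n + 1) → X) :
    A (List.ofFn x) = (τ.sign : ℤ) • A (List.ofFn fun i => x (τ i)) := by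
  have hτ : τ ∈ Submonoid.closure
      (Set.range fun i : Fin n => Equiv.swap i.castSucc i.succ) := by
    rw [Equiv.Perm.mclosure_swap_castSucc_succ]
    trivial
  induction hτ using Submonoid.closure_induction generalizing x with
  | one => simp
  | mul τ τ' _ _ h h' =>
    rw [h x, h' fun i => x (τ i), smul_smul, map_mul]
    rfl
  | mem τ hτ =>
    obtain ⟨i, rfl⟩ := hτ
    simp only
    rw [Equiv.Perm.sign_swap (by simp [Fin.ext_iff])]
    have h0 : ∀ z : Fin (n + 1) → X, List.ofFn z = (List.ofFn z).take i ++
        z i.castSucc :: z i.succ :: (List.ofFn z).drop (i + 2) := by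
      intro z
      conv_lhs => rw [← List.take_append_drop i (List.ofFn z),
        List.drop_eq_getElem_cons (by rw [List.length_ofFn]; omega),
        List.drop_eq_getElem_cons (by rw [List.length_ofFn]; omega)]
      rw [List.getElem_ofFn, List.getElem_ofFn]
      rfl
    have h1 : (List.ofFn fun j => x (Equiv.swap i.castSucc i.succ j)).take i =
        (List.ofFn x).take i := by
      refine List.ext_getElem (by simp) fun j h1 h2 => ?_
      simp only [List.length_take, List.length_ofFn] at h1
      rw [List.getElem_take, List.getElem_take, List.getElem_ofFn, List.getElem_ofFn,
        Equiv.swap_apply_of_ne_of_ne (by simp [Fin.ext_iff]; omega)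
          (by simp [Fin.ext_iff]; omega)]
    have h2 : (List.ofFn fun j => x (Equiv.swap i.castSucc i.succ j)).drop (i + 2) =
        (List.ofFn x).drop (i + 2) := by
      refine List.ext_getElem (by simp) fun j h1 h2 => ?_
      simp only [List.length_drop, List.length_ofFn] at h1
      rw [List.getElem_drop, List.getElem_drop, List.getElem_ofFn, List.getElem_ofFn,
        Equiv.swap_apply_of_ne_of_ne (by simp [Fin.ext_iff]; omega)
          (by simp [Fin.ext_iff]; omega)]
    rw [h0 x, h0 fun j => x (Equiv.swap i.castSucc i.succ j), h1, h2, Equiv.swap_apply_left,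
      Equiv.swap_apply_right, hA]
    simp

/-- The conditions on a cochain can be read off from its function of lists. -/
theorem mem_cochains_of_hat {a b : V →ₗ[ℂ] V} {n : ℕ} {f : ConfMap V V n}
    (h1 : ∀ x, b.lTensor _ (f x) = f fun i => a (x i))
    (h2 : IsSesq (hat (Fin (n + 1)) n f)) (h3 : IsAlt (hat (Fin (n + 1)) n f)) :
    f ∈ cochains a b n := by
  -- the coefficient of the sesquilinearity relation is the parameter of the argument
  have hder : ∀ (x : Fin (n + 1) → V) i,
      cls (∑ i, MvPolynomial.X i : MvPolynomial (Fin (n + 1)) ℂ)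
        (subst V (fun i => MvPolynomial.X i.castSucc)
          (f (Function.update x i (der V (x i))))) =
      -((MvPolynomial.X i : MvPolynomial (Fin (n + 1)) ℂ) • cls (∑ i, MvPolynomial.X i)
        (subst V (fun i => MvPolynomial.X i.castSucc) (f x))) := by
    intro x i
    -- the generic list with its entry of index `i` replaced
    have e : ∀ v, generic (Function.update x i v) = (generic x).take i ++
        (v, MvPolynomial.X i) :: (generic x).drop (i + 1) := by
      intro v
      have e1 : (generic (Function.update x i v)) =
          (generic (Function.update x i v)).take i ++ (v, MvPolynomial.X i) ::
          (generic (Function.update x i v)).drop (i + 1) := by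
        conv_lhs => rw [← List.take_append_drop i (generic (Function.update x i v)),
          List.drop_eq_getElem_cons (by rw [generic, List.length_ofFn]; omega)]
        simp [generic, -List.ofFn_succ]
      rw [e1]
      congr 1
      · refine List.ext_getElem (by simp [generic]) fun j h1 h2 => ?_
        simp only [generic, List.length_take, List.length_ofFn] at h1
        simp only [generic, List.getElem_take, List.getElem_ofFn]
        rw [Function.update_of_ne (by simp [Fin.ext_iff]; omega)]
      · congr 1
        refine List.ext_getElem (by simp [generic]) fun j h1 h2 => ?_
        simp only [generic, List.getElem_drop, List.getElem_ofFn]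
        rw [Function.update_of_ne (by simp [Fin.ext_iff]; omega)]
    have := (h2 ((generic x).take i) ((generic x).drop (i + 1))).der (x i) (MvPolynomial.X i)
    rw [← e, ← e, Function.update_eq_self] at this
    simpa only [generic, hat_ofFn] using this
  refine ⟨h1, fun x i => eq_of_cls_eq ?_, fun x => eq_of_cls_eq ?_, fun x τ => eq_of_cls_eq ?_⟩
  · rw [hder, map_neg, map_neg, subst_smul, map_smul, MvPolynomial.aeval_X]
  · rw [hder, map_add, map_add, subst_lTensor, cls_der, subst_smul, map_smul, map_sum]
    simp only [MvPolynomial.aeval_X]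
    rw [Fin.sum_univ_castSucc, add_smul]
    abel
  · have := h3.perm τ fun i => (x i, MvPolynomial.X i)
    rw [hat_ofFn, hat_ofFn, Equiv.sum_comp τ
      (fun i => (MvPolynomial.X i : MvPolynomial (Fin (n + 1)) ℂ))] at this
    rw [this, map_zsmul, map_zsmul,
      cls_subst_dagger (fun i => (MvPolynomial.X i : MvPolynomial (Fin (n + 1)) ℂ)), subst_X]

end Hat

/-! ### The circle product as a shuffle product -/

section Circle

variable {V : Type*} [AddCommGroup V] [Module ℂ V] {σ τ : Type*}

theorem subst_plug {k : ℕ} (f : ConfMap V V k) (ν : Fin k → MvPolynomial σ ℂ)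
    (μ : σ → MvPolynomial τ ℂ) (P : PolyMod V σ) (y : Fin k → V) :
    subst V μ (plug f ν P y) =
      plug f (fun j => MvPolynomial.aeval μ (ν j)) (subst V μ P) y := by
  induction P using TensorProduct.induction_on with
  | zero => simp [plug_zero]
  | tmul r v => rw [plug_tmul, subst_smul, subst_subst, subst_tmul, plug_tmul]
  | add P Q hP hQ => rw [plug_add, map_add, map_add, plug_add, hP, hQ]

theorem shuffles_eq (k l : ℕ) : shuffles k l = shufflePerms (l + 1) (k + l + 1) := by
  ext τ
  simp [shuffles, shufflePerms]

theorem take_ofFn_head {X : Type*} (k l : ℕ) (y : Fin (k + l + 1) → X) :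
    (List.ofFn y).take (l + 1) = List.ofFn fun i => y (headIdx k l i) := by
  refine List.ext_getElem (by simp) fun i h1 h2 => ?_
  rw [List.getElem_take, List.getElem_ofFn, List.getElem_ofFn]
  rfl

theorem drop_ofFn_tail {X : Type*} (k l : ℕ) (y : Fin (k + l + 1) → X) :
    (List.ofFn y).drop (l + 1) = List.ofFn fun j => y (tailIdx k l j) := by
  refine List.ext_getElem (by simp) fun i h1 h2 => ?_
  rw [List.getElem_drop, List.getElem_ofFn, List.getElem_ofFn]
  rfl

variable [Module (Polynomial ℂ) V] [IsScalarTower ℂ (Polynomial ℂ) V]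

/-- Inserting a polynomial as the first argument of `hat σ k f` is `plug`, on the level of
classes. -/
theorem plugFst_hat_cls {a b : V →ₗ[ℂ] V} {k : ℕ} {f : ConfMap V V k} (hf : f ∈ cochains a b k)
    (μ : MvPolynomial σ ℂ) (P : PolyMod V σ) (t : Fin k → V × MvPolynomial σ ℂ) :
    plugFst (hat σ k f) (List.ofFn t) (cls μ P) =
      cls (μ + ∑ j, (t j).2) (plug f
        (fun j => (Fin.cons μ (fun j => (t j).2) : Fin (k + 1) → MvPolynomial σ ℂ) j.castSucc)
        P fun j => (t j).1) := by
  induction P using TensorProduct.induction_on with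
  | zero => simp [plug_zero]
  | tmul r v =>
    have h : (v, μ) :: List.ofFn t = List.ofFn (Fin.cons (v, μ) t) := by
      simp [List.ofFn_succ]
    have h1 : ∀ i, ((Fin.cons (v, μ) t : Fin (k + 1) → V × MvPolynomial σ ℂ) i).1 =
        (Fin.cons v (fun j => (t j).1) : Fin (k + 1) → V) i :=
      fun i => by cases i using Fin.cases <;> simp
    have h2 : ∀ i, ((Fin.cons (v, μ) t : Fin (k + 1) → V × MvPolynomial σ ℂ) i).2 =
        (Fin.cons μ (fun j => (t j).2) : Fin (k + 1) → MvPolynomial σ ℂ) i :=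
      fun i => by cases i using Fin.cases <;> simp
    rw [cls_tmul, map_smul, plugFst_gen (hat_isSesq hf), h, hat_ofFn, plug_tmul, map_smul]
    simp only [h1, h2]
    rw [Fin.sum_univ_succ]
    simp only [Fin.cons_zero, Fin.cons_succ]
  | add P Q hP hQ => rw [plug_add, map_add, map_add, map_add, hP, hQ]

/-- The circle product in terms of functions of lists: the value of the inner map is inserted as
the first argument of the outer one, the remaining arguments being twisted by `b`. -/
def circHat (b : V →ₗ[ℂ] V) (A B : List (V × MvPolynomial σ ℂ) → WeightModule V σ) :
    List (V × MvPolynomial σ ℂ) → WeightModule V σ :=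
  wedge (fun (P : WeightModule V σ) (h : WeightModule V σ →ₗ[MvPolynomial σ ℂ] WeightModule V σ) =>
    h P) B fun T => plugFst A (T.map (Prod.map b id))

theorem biAdditive_eval {N N' : Type*} [AddCommGroup N] [Module (MvPolynomial σ ℂ) N]
    [AddCommGroup N'] [Module (MvPolynomial σ ℂ) N'] :
    BiAdditive fun (P : N) (h : N →ₗ[MvPolynomial σ ℂ] N') => h P :=
  ⟨by simp, by simp⟩

theorem IsHom.comp_map {X Y U : Type*} [AddCommGroup U] {m : ℕ} {A : List Y → U} (h : IsHom m A)
    (s : X → Y) : IsHom m fun T => A (T.map s) := fun L hL => h _ (by simpa using hL)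

/-- The summand of the circle product belonging to `τ` is the summand of the shuffle product. -/
theorem cls_circTerm {a b : V →ₗ[ℂ] V} {k l : ℕ} {f : ConfMap V V k} (hf : f ∈ cochains a b k)
    (c : V →ₗ[ℂ] V) (g : ConfMap V V l) (τ : Equiv.Perm (Fin (k + l + 1)))
    (y : Fin (k + l + 1) → V × MvPolynomial σ ℂ) :
    cls (∑ i, (y i).2) (subst V (fun i => (y i).2) (circTerm c f g τ fun i => (y i).1)) =
      plugFst (hat σ k f)
        (((List.ofFn fun i => y (τ i)).drop (l + 1)).map (Prod.map (c ^ l : V →ₗ[ℂ] V) id))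
        (hat σ l g ((List.ofFn fun i => y (τ i)).take (l + 1))) := by
  rw [take_ofFn_head k l (fun i => y (τ i)), drop_ofFn_tail k l (fun i => y (τ i)),
    hat_ofFn, List.map_ofFn, plugFst_hat_cls hf, circTerm, subst_plug, subst_subst]
  have hsum : ∑ i, (y i).2 =
      ∑ i, (y (τ (headIdx k l i))).2 + ∑ j, (y (τ (tailIdx k l j))).2 := by
    rw [← Equiv.sum_comp τ, ← List.sum_ofFn, ← List.sum_take_add_sum_drop _ (l + 1),
      take_ofFn_head k l fun i => (y (τ i)).2, drop_ofFn_tail k l fun i => (y (τ i)).2,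
      List.sum_ofFn, List.sum_ofFn]
  -- the subscripts of the outer map are the parameters of its arguments, the first of which is
  -- the value of the inner map, with the sum of the parameters of its arguments
  have houter : ∀ j : Fin k, MvPolynomial.aeval (fun i => (y i).2) (outerVar k l τ j) =
      (Fin.cons (∑ i, (y (τ (headIdx k l i))).2) (fun j => (y (τ (tailIdx k l j))).2) :
        Fin (k + 1) → MvPolynomial σ ℂ) j.castSucc := by
    rintro ⟨j, hj⟩
    cases j with
    | zero => simp [outerVar]
    | succ j =>
      have : (⟨j + 1, hj⟩ : Fin k).castSucc = Fin.succ ⟨j, by omega⟩ := rfl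
      rw [this, Fin.cons_succ]
      simp only [outerVar, Nat.add_eq_zero_iff, one_ne_zero, and_false, if_false,
        MvPolynomial.aeval_X, tailIdx]
      congr 4
      ring
  simp only [houter, innerVar, MvPolynomial.aeval_X, Function.comp_apply, Prod.map_fst,
    Prod.map_snd, id_eq, hsum]

/-- The circle product is a shuffle product: `λ_{k+l+1}^†` is the parameter of the last argument
in the weight module, so that the last variable needs no separate treatment. -/
theorem hat_circ {a b : V →ₗ[ℂ] V} {k l : ℕ} {f : ConfMap V V k} (hf : f ∈ cochains a b k)
    (c : V →ₗ[ℂ] V) (g : ConfMap V V l) :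
    hat σ (k + l) (circ c f g) = circHat (c ^ l : V →ₗ[ℂ] V) (hat σ k f) (hat σ l g) := by
  funext L
  by_cases hL : L.length = k + l + 1
  · obtain ⟨y, rfl⟩ := exists_eq_ofFn _ hL
    rw [circHat, wedge_ofFn biAdditive_eval (hat_isHom g), hat_ofFn]
    change cls _ (subst V _ (dagger V (k + l) _)) = _
    rw [cls_subst_dagger (fun i => (y i).2), map_sum, map_sum, ← shuffles_eq]
    refine Finset.sum_congr rfl fun τ _ => ?_
    rw [map_zsmul, map_zsmul, cls_circTerm hf]
  · rw [hat_isHom _ _ hL, circHat, wedge_isHom biAdditive_eval (hat_isHom g)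
      ((plugFst_isHom (hat_isSesq hf) (hat_isHom f)).comp_map _)]
    omega

theorem pow_apply_der {a : V →ₗ[ℂ] V} (ha : ∀ v, a (der V v) = der V (a v)) (n : ℕ) (v : V) :
    (a ^ n : V →ₗ[ℂ] V) (der V v) = der V ((a ^ n : V →ₗ[ℂ] V) v) := by
  induction n with
  | zero => simp
  | succ n ih => rw [pow_succ', Module.End.mul_apply, ih, ha, Module.End.mul_apply]

theorem IsSesq.comp_map {N : Type*} [AddCommGroup N] [Module ℂ N] [Module (MvPolynomial σ ℂ) N]
    {A : List (V × MvPolynomial σ ℂ) → N} (h : IsSesq A) {b : V →ₗ[ℂ] V}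
    (hb : ∀ v, b (der V v) = der V (b v)) :
    IsSesq fun T => A (T.map (Prod.map b id)) := fun L₁ L₂ => by
  have := h (L₁.map (Prod.map b id)) (L₂.map (Prod.map b id))
  simp only [List.map_append, List.map_cons]
  exact
    { add := fun v w ν => by simpa using this.add (b v) (b w) ν
      smul := fun c v ν => by simpa using this.smul c (b v) ν
      der := fun v ν => by simpa [hb] using this.der (b v) ν }

theorem circHat_isSesq {b : V →ₗ[ℂ] V} (hb : ∀ v, b (der V v) = der V (b v))
    {A B : List (V × MvPolynomial σ ℂ) → WeightModule V σ} (hA : IsSesq A) (hB : IsSesq B) :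
    IsSesq (circHat b A B) :=
  wedge_isSesq LinearMap.applyₗ hB ((plugFst_isSesq hA).comp_map hb)

theorem circHat_isAlt (b : V →ₗ[ℂ] V)
    {A B : List (V × MvPolynomial σ ℂ) → WeightModule V σ} (hA : IsSesq A) (hA' : IsAlt A)
    (hB : IsAlt B) : IsAlt (circHat b A B) :=
  wedge_isAlt biAdditive_eval hB ((plugFst_isAlt hA hA').comp_map _)

/-- Maps that intertwine `s` up to a scalar are stable under the circle product. -/
theorem circ_intertwine {a s : V →ₗ[ℂ] V} (hs : ∀ v, s (der V v) = der V (s v))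
    (has : ∀ v, a (s v) = s (a v)) {k l : ℕ} {f : ConfMap V V k} {g : ConfMap V V l} {c d : ℂ}
    (hf : ∀ x, f (fun i => s (x i)) = c • s.lTensor _ (f x))
    (hg : ∀ x, g (fun i => s (x i)) = d • s.lTensor _ (g x)) (x : Fin (k + l + 1) → V) :
    circ a f g (fun i => s (x i)) = (c * d) • s.lTensor _ (circ a f g x) := by
  have hpow : ∀ n v, (a ^ n : V →ₗ[ℂ] V) (s v) = s ((a ^ n : V →ₗ[ℂ] V) v) := by
    intro n v
    induction n with
    | zero => simp
    | succ n ih => rw [pow_succ', Module.End.mul_apply, ih, has, Module.End.mul_apply]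
  have hplug : ∀ (ν : Fin k → MvPolynomial (Fin (k + l + 1)) ℂ) P (y : Fin k → V),
      plug f ν (s.lTensor _ P) (fun j => s (y j)) = c • s.lTensor _ (plug f ν P y) := by
    intro ν P y
    induction P using TensorProduct.induction_on with
    | zero => simp [plug_zero]
    | tmul r v =>
      have : (Fin.cons (s v) fun j => s (y j) : Fin (k + 1) → V) =
          fun i => s ((Fin.cons v y : Fin (k + 1) → V) i) := by
        funext i
        cases i using Fin.cases <;> simp
      rw [LinearMap.lTensor_tmul, plug_tmul, plug_tmul, this, hf, map_smul, lTensor_polySmul,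
        subst_lTensor, smul_comm]
    | add P Q hP hQ => rw [map_add, plug_add, plug_add, map_add, smul_add, hP, hQ]
  have hterm : ∀ τ, circTerm a f g τ (fun i => s (x i)) =
      (c * d) • s.lTensor _ (circTerm a f g τ x) := by
    intro τ
    simp only [circTerm]
    rw [hg (fun i => x (τ (headIdx k l i))), map_smul, plug_smul, subst_lTensor]
    simp only [hpow]
    rw [hplug, smul_smul, mul_comm]
  change dagger V (k + l) _ = (c * d) • s.lTensor _ (dagger V (k + l) _)
  simp only [hterm]
  rw [← dagger_lTensor _ hs, ← map_smul]
  congr 1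
  rw [map_sum, Finset.smul_sum]
  refine Finset.sum_congr rfl fun τ _ => ?_
  rw [map_zsmul, smul_comm]

theorem circ_mem_cochains {a : V →ₗ[ℂ] V} (ha : ∀ v, a (der V v) = der V (a v)) {k l : ℕ}
    {f : ConfMap V V k} {g : ConfMap V V l} (hf : f ∈ cochains a a k)
    (hg : g ∈ cochains a a l) : circ a f g ∈ cochains a a (k + l) := by
  refine mem_cochains_of_hat (fun x => ?_) ?_ ?_
  · have := circ_intertwine ha (fun _ => rfl) (c := 1) (d := 1)
      (fun x => by rw [one_smul, hf.1]) (fun x => by rw [one_smul, hg.1]) x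
    rw [this, mul_one, one_smul]
  · rw [hat_circ hf]
    exact circHat_isSesq (pow_apply_der ha l) (hat_isSesq hf) (hat_isSesq hg)
  · rw [hat_circ hf]
    exact circHat_isAlt _ (hat_isSesq hf) (hat_isAlt hf) (hat_isAlt hg)

end Circle

/-! ### The pre-Lie identity -/

section PreLie

variable {V : Type*} [AddCommGroup V] [Module ℂ V] [Module (Polynomial ℂ) V]
  [IsScalarTower ℂ (Polynomial ℂ) V] {σ : Type*}

/-- The values of two maps `B` and `C` are inserted as the first two arguments of `A`. -/
def circHat₂ (b c : V →ₗ[ℂ] V) (A B C : List (V × MvPolynomial σ ℂ) → WeightModule V σ) :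
    List (V × MvPolynomial σ ℂ) → WeightModule V σ :=
  wedge (fun (P : WeightModule V σ)
      (h : WeightModule V σ →ₗ[MvPolynomial σ ℂ] WeightModule V σ) => h P) C
    (wedge (fun (Q : WeightModule V σ) (h : WeightModule V σ →ₗ[MvPolynomial σ ℂ]
        WeightModule V σ →ₗ[MvPolynomial σ ℂ] WeightModule V σ) =>
          (h.flip (twistWeight σ c Q)) ∘ₗ twistWeight σ b)
      B fun T => plugFst (plugFst A) (T.map (Prod.map (b ∘ₗ c) id)))

theorem biAdditive_flip_comp (s t : WeightModule V σ →ₗ[MvPolynomial σ ℂ] WeightModule V σ) :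
    BiAdditive fun (Q : WeightModule V σ) (h : WeightModule V σ →ₗ[MvPolynomial σ ℂ]
        WeightModule V σ →ₗ[MvPolynomial σ ℂ] WeightModule V σ) => (h.flip (s Q)) ∘ₗ t :=
  ⟨fun u u' w => by ext; simp, fun u w w' => by ext; simp⟩

omit [Module (Polynomial ℂ) V] [IsScalarTower ℂ (Polynomial ℂ) V] in
theorem map_map_twist (b c : V →ₗ[ℂ] V) (T : List (V × MvPolynomial σ ℂ)) :
    (T.map (Prod.map c id)).map (Prod.map b id) = T.map (Prod.map (b ∘ₗ c) id) := by
  simp [Function.comp_def, Prod.map]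

theorem wedge_comp_map {X Y U W Z : Type*} [AddCommGroup U] [AddCommGroup W] [AddCommGroup Z]
    {p : U → W → Z} (hp : BiAdditive p) (s : X → Y) (A : List Y → U) (B : List Y → W)
    (L : List X) : wedge p A B (L.map s) =
      wedge p (fun T => A (T.map s)) (fun T => B (T.map s)) L :=
  (map_wedge hp hp (AddMonoidHom.id Z) s (A := fun T => A (T.map s)) (B := fun T => B (T.map s))
    (fun _ _ => rfl) L).symm

/-- Inserting into `A ∘ B`: the new argument goes either to `B` or to `A`. -/
theorem plugFst_circHat {b : V →ₗ[ℂ] V} (hb : ∀ v, b (der V v) = der V (b v))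
    {A B : List (V × MvPolynomial σ ℂ) → WeightModule V σ} (hA : IsSesq A) (hB : IsSesq B)
    (T : List (V × MvPolynomial σ ℂ)) :
    plugFst (circHat b A B) T =
      wedge (fun (f g : WeightModule V σ →ₗ[MvPolynomial σ ℂ] WeightModule V σ) => g ∘ₗ f)
        (plugFst B) (fun T => plugFst A (T.map (Prod.map b id))) T +
      wedge (fun (Q : WeightModule V σ) (h : WeightModule V σ →ₗ[MvPolynomial σ ℂ]
        WeightModule V σ →ₗ[MvPolynomial σ ℂ] WeightModule V σ) =>
          (h.flip Q) ∘ₗ twistWeight σ b)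
        (signed B) (fun T => plugFst (plugFst A) (T.map (Prod.map b id))) T := by
  refine weightModule_ext fun x => ?_
  have hcomp : BiAdditive fun (f g : WeightModule V σ →ₗ[MvPolynomial σ ℂ] WeightModule V σ) =>
      g ∘ₗ f := ⟨fun u u' w => by ext; simp, fun u w w' => by ext; simp⟩
  have hflip : BiAdditive fun (Q : WeightModule V σ) (h : WeightModule V σ →ₗ[MvPolynomial σ ℂ]
        WeightModule V σ →ₗ[MvPolynomial σ ℂ] WeightModule V σ) =>
          (h.flip Q) ∘ₗ twistWeight σ b := biAdditive_flip_comp LinearMap.id (twistWeight σ b)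
  let ev : (WeightModule V σ →ₗ[MvPolynomial σ ℂ] WeightModule V σ) →+ WeightModule V σ :=
    ((LinearMap.applyₗ (gen x)).toAddMonoidHom)
  have hev : ∀ h, ev h = h (gen x) := fun h => rfl
  rw [plugFst_gen (circHat_isSesq hb hA hB), LinearMap.add_apply, ← hev, ← hev,
    map_wedge' hcomp biAdditive_eval ev (A' := fun T => B (x :: T))
      (B' := fun T => plugFst A (T.map (Prod.map b id)))
      (fun S T => by rw [hev, LinearMap.comp_apply, plugFst_gen hB]),
    map_wedge' hflip biAdditive_eval ev (A' := signed B)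
      (B' := fun T => plugFst A ((x :: T).map (Prod.map b id)))
      (fun S T => by
        rw [hev, LinearMap.comp_apply, twistWeight_gen hb, LinearMap.flip_apply,
          plugFst_gen (plugFst_isSesq hA)]
        rfl)]
  rfl

/-- The associator of the circle product consists of the terms in which both inner maps are inserted
into `A`. The sign comes from moving the value of `C` past the arguments of `B`. -/
theorem circHat_circHat {b c : V →ₗ[ℂ] V} (hb : ∀ v, b (der V v) = der V (b v))
    {n : ℕ} {A B C : List (V × MvPolynomial σ ℂ) → WeightModule V σ} (hA : IsSesq A)
    (hB : IsSesq B) (hB' : IsHom n B)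
    (hBc : ∀ L, B (L.map (Prod.map c id)) = twistWeight σ c (B L))
    (L : List (V × MvPolynomial σ ℂ)) :
    circHat c (circHat b A B) C L =
      circHat (b ∘ₗ c) A (circHat c B C) L + (-1 : ℤ) ^ n • circHat₂ b c A B C L := by
  have hcomp : BiAdditive fun (f g : WeightModule V σ →ₗ[MvPolynomial σ ℂ] WeightModule V σ) =>
      g ∘ₗ f := ⟨fun u u' w => by ext; simp, fun u w w' => by ext; simp⟩
  have hflip : BiAdditive fun (Q : WeightModule V σ) (h : WeightModule V σ →ₗ[MvPolynomial σ ℂ]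
        WeightModule V σ →ₗ[MvPolynomial σ ℂ] WeightModule V σ) =>
          (h.flip Q) ∘ₗ twistWeight σ b := biAdditive_flip_comp LinearMap.id (twistWeight σ b)
  have hflip' := biAdditive_flip_comp (twistWeight σ c) (twistWeight σ b)
  have e1 : (fun T => plugFst (circHat b A B) (T.map (Prod.map c id))) = fun T =>
      wedge (fun (f g : WeightModule V σ →ₗ[MvPolynomial σ ℂ] WeightModule V σ) => g ∘ₗ f)
        (fun T => plugFst B (T.map (Prod.map c id)))
        (fun T => plugFst A (T.map (Prod.map (b ∘ₗ c) id))) T +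
      wedge (fun (Q : WeightModule V σ) (h : WeightModule V σ →ₗ[MvPolynomial σ ℂ]
        WeightModule V σ →ₗ[MvPolynomial σ ℂ] WeightModule V σ) =>
          (h.flip (twistWeight σ c Q)) ∘ₗ twistWeight σ b)
        (signed B) (fun T => plugFst (plugFst A) (T.map (Prod.map (b ∘ₗ c) id))) T := by
    funext T
    rw [plugFst_circHat hb hA hB, wedge_comp_map hcomp, wedge_comp_map hflip]
    simp only [map_map_twist]
    congr 1
    refine map_wedge' hflip hflip' (AddMonoidHom.id _) (fun S T => ?_) T
    simp [signed, hBc]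
  rw [circHat, e1, wedge_add_right biAdditive_eval,
    ← wedge_assoc (q := fun (P : WeightModule V σ)
      (h : WeightModule V σ →ₗ[MvPolynomial σ ℂ] WeightModule V σ) => h P)
      (p₁ := fun (P : WeightModule V σ)
      (h : WeightModule V σ →ₗ[MvPolynomial σ ℂ] WeightModule V σ) => h P) biAdditive_eval
      biAdditive_eval biAdditive_eval (fun _ _ _ => rfl), hB'.signed_eq]
  congr 1
  rw [circHat₂, ← wedge_zsmul_right biAdditive_eval]
  congr 1
  funext T
  exact wedge_zsmul_left hflip' _ _ _ _

/-- Exchanging the two inner maps costs the sign of the shuffles and the sign of the alternating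
function `A`. -/
theorem circHat₂_symm {b c : V →ₗ[ℂ] V} (hbc : b ∘ₗ c = c ∘ₗ b) {m n : ℕ}
    {A B C : List (V × MvPolynomial σ ℂ) → WeightModule V σ} (hA : IsSesq A) (hA' : IsAlt A)
    (hB : IsHom m B) (hC : IsHom n C) (L : List (V × MvPolynomial σ ℂ)) :
    circHat₂ b c A B C L = -((-1 : ℤ) ^ (n * m) • circHat₂ c b A C B L) := by
  -- the arguments of `B` and `C` are exchanged first, then their values as arguments of `A`
  rw [circHat₂, wedge_exchange (q₁ := fun (P : WeightModule V σ)
      (h : WeightModule V σ →ₗ[MvPolynomial σ ℂ] WeightModule V σ) => h P)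
    (q₂ := fun (Q : WeightModule V σ) (h : WeightModule V σ →ₗ[MvPolynomial σ ℂ]
        WeightModule V σ →ₗ[MvPolynomial σ ℂ] WeightModule V σ) =>
          (h (twistWeight σ b Q)) ∘ₗ twistWeight σ c) biAdditive_eval
    (biAdditive_flip_comp _ _) biAdditive_eval
    ⟨fun u u' w => by ext; simp, fun u w w' => by ext; simp⟩ (fun _ _ _ => rfl) hC hB,
    ← smul_neg]
  congr 1
  rw [circHat₂, ← hbc]
  have hflip := biAdditive_flip_comp (V := V) (σ := σ) (twistWeight σ b) (twistWeight σ c)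
  refine (map_wedge' biAdditive_eval biAdditive_eval (-AddMonoidHom.id _) (fun S T => ?_) L).symm
  rw [AddMonoidHom.neg_apply, AddMonoidHom.id_apply, ← LinearMap.neg_apply]
  congr 1
  refine map_wedge' hflip ⟨fun u u' w => by ext; simp, fun u w w' => by ext; simp⟩
    (-AddMonoidHom.id _) (fun S T => ?_) T
  ext P
  simp only [AddMonoidHom.neg_apply, AddMonoidHom.id_apply, LinearMap.neg_apply,
    LinearMap.comp_apply, LinearMap.flip_apply]
  rw [plugFst_plugFst_swap hA hA', neg_neg]

/-- The associator of the circle product is graded symmetric in its last two arguments. -/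
theorem preLie_hat {a : V →ₗ[ℂ] V} (ha : ∀ v, a (der V v) = der V (a v)) {k l m : ℕ}
    {f : ConfMap V V k} {g : ConfMap V V l} {h : ConfMap V V m} (hf : f ∈ cochains a a k)
    (hg : g ∈ cochains a a l) (hh : h ∈ cochains a a m) :
    hat σ _ (circ a (circ a f g) h) - hat σ _ (circ a f (circ a g h)) =
      (-1 : ℤ) ^ (l * m) •
        (hat σ _ (circ a (circ a f h) g) - hat σ _ (circ a f (circ a h g))) := by
  have htw : ∀ {n : ℕ} {g : ConfMap V V n}, g ∈ cochains a a n → ∀ j L,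
      hat σ n g (L.map (Prod.map (a ^ j : V →ₗ[ℂ] V) id)) =
        twistWeight σ (a ^ j : V →ₗ[ℂ] V) (hat σ n g L) := by
    intro n g hg j L
    refine hat_twist (pow_apply_der ha j) (fun x => ?_) L
    induction j with
    | zero => simp [Module.End.one_eq_id]
    | succ j ih =>
      have : (a ^ (j + 1) : V →ₗ[ℂ] V) = a ∘ₗ (a ^ j : V →ₗ[ℂ] V) := by
        rw [pow_succ', Module.End.mul_eq_comp]
      rw [this, LinearMap.lTensor_comp_apply, ih, hg.1]
      rfl
  have hpow : ∀ i j : ℕ, (a ^ i : V →ₗ[ℂ] V) ∘ₗ (a ^ j : V →ₗ[ℂ] V) = (a ^ (i + j) : V →ₗ[ℂ] V) :=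
    fun i j => by rw [pow_add, Module.End.mul_eq_comp]
  have key : ∀ {l m : ℕ} {g : ConfMap V V l} {h : ConfMap V V m}, g ∈ cochains a a l →
      h ∈ cochains a a m → hat σ _ (circ a (circ a f g) h) - hat σ _ (circ a f (circ a g h)) =
        fun L => (-1 : ℤ) ^ (l + 1) • circHat₂ (a ^ l : V →ₗ[ℂ] V) (a ^ m : V →ₗ[ℂ] V)
          (hat σ k f) (hat σ l g) (hat σ m h) L := by
    intro l m g h hg hh
    funext L
    rw [Pi.sub_apply, hat_circ (circ_mem_cochains ha hf hg), hat_circ hf, hat_circ hf,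
      hat_circ hg, circHat_circHat (pow_apply_der ha l) (hat_isSesq hf) (hat_isSesq hg)
        (hat_isHom g) (htw hg m), hpow]
    simp
  rw [key hg hh, key hh hg]
  funext L
  rw [Pi.smul_apply, circHat₂_symm (by rw [hpow, hpow, add_comm]) (hat_isSesq hf) (hat_isAlt hf)
    (hat_isHom g) (hat_isHom h), ← smul_neg, smul_smul, smul_neg, ← neg_smul, smul_smul]
  congr 1
  rw [show (m + 1) * (l + 1) = l * m + m + l + 1 by ring]
  rcases Nat.even_or_odd l with hl | hl <;> rcases Nat.even_or_odd m with hm | hm <;>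
    simp [pow_add, pow_mul, hl.neg_one_pow, hm.neg_one_pow]

end PreLie

/-! ### The Nijenhuis-Richardson bracket on cochains -/

section NRLie

/-- The graded commutator of a product whose associator is graded symmetric in the last two
arguments satisfies the graded Jacobi identity. -/
theorem jacobi_of_preLie {P : Type*} [AddCommGroup P] [Module ℂ P] (op : P →ₗ[ℂ] P →ₗ[ℂ] P)
    {x y z : P} {s t u : ℂ} (hs : s = 1 ∨ s = -1) (ht : t = 1 ∨ t = -1) (hu : u = 1 ∨ u = -1)
    (h1 : op (op x y) z - op x (op y z) = t • (op (op x z) y - op x (op z y)))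
    (h2 : op (op y x) z - op y (op x z) = u • (op (op y z) x - op y (op z x)))
    (h3 : op (op z x) y - op z (op x y) = s • (op (op z y) x - op z (op y x))) :
    op x (op y z - t • op z y) - (s * u) • op (op y z - t • op z y) x =
      op (op x y - s • op y x) z - (u * t) • op z (op x y - s • op y x) +
      s • (op y (op x z - u • op z x) - (s * t) • op (op x z - u • op z x) y) := by
  simp only [map_sub, map_smul, LinearMap.sub_apply, LinearMap.smul_apply]
  -- for each choice of the signs, the identity is a signed sum of the three relations
  rcases hs with rfl | rfl <;> rcases ht with rfl | rfl <;> rcases hu with rfl | rfl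
  · linear_combination (norm := module) -h1 + h2 - h3
  · linear_combination (norm := module) -h1 + h2 + h3
  · linear_combination (norm := module) -h1 + h2 + h3
  · linear_combination (norm := module) -h1 + h2 - h3
  · linear_combination (norm := module) -h1 - h2 - h3
  · linear_combination (norm := module) -h1 - h2 + h3
  · linear_combination (norm := module) -h1 - h2 + h3
  · linear_combination (norm := module) -h1 - h2 - h3

theorem eq_zero_of_eq_neg_smul {P : Type*} [AddCommGroup P] [Module ℂ P] {x : P}
    (h : x = (-1 : ℂ) ^ (1 * 1) • x) : x = 0 := by
  have h2 : (2 : ℂ) • x = 0 := by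
    rw [two_smul]
    nth_rewrite 1 [h]
    simp
  exact (smul_eq_zero.1 h2).resolve_left two_ne_zero

variable {V : Type*} [AddCommGroup V] [Module ℂ V] [Module (Polynomial ℂ) V]
  [IsScalarTower ℂ (Polynomial ℂ) V] {σ : Type*}

/-- The extension of `hat` to the graded space. -/
def hatTotal (σ : Type*) :
    GradedConfMap V →ₗ[ℂ] List (V × MvPolynomial σ ℂ) → WeightModule V σ :=
  DirectSum.toModule ℂ ℕ _ fun n => hat σ n

theorem hatTotal_lof (n : ℕ) (f : ConfMap V V n) :
    hatTotal σ (DirectSum.lof ℂ ℕ (ConfMap V V) n f) = hat σ n f :=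
  DirectSum.toModule_lof _ _ _

theorem hatTotal_apply (z : GradedConfMap V) {n : ℕ} (L : List (V × MvPolynomial σ ℂ))
    (hL : L.length = n + 1) : hatTotal σ z L = hat σ n (z n) L := by
  induction z using DirectSum.induction_on with
  | zero => simp
  | add x y hx hy => rw [map_add, Pi.add_apply, hx, hy, DirectSum.add_apply, map_add, Pi.add_apply]
  | of m f =>
    rw [← DirectSum.lof_eq_of ℂ, hatTotal_lof]
    by_cases hmn : m = n
    · subst hmn
      rw [DirectSum.lof_apply]
    · rw [hat_isHom f L (by omega), DirectSum.lof_eq_of, DirectSum.of_eq_of_ne _ _ _ (Ne.symm hmn),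
        map_zero, Pi.zero_apply]

theorem gradedConfMap_ext {z w : GradedConfMap V}
    (h : ∀ n, hatTotal (Fin (n + 1)) z = hatTotal (Fin (n + 1)) w) : z = w := by
  refine DFinsupp.ext fun n => MultilinearMap.ext fun x => eq_of_hat_generic ?_
  have hx : (generic x).length = n + 1 := by simp only [generic, List.length_ofFn]
  rw [← hatTotal_apply z _ hx, ← hatTotal_apply w _ hx, h]

/-- The element is a homogeneous cochain with `n + 1` arguments. -/
def IsCoch (a : V →ₗ[ℂ] V) (n : ℕ) (z : GradedConfMap V) : Prop :=
  ∃ f ∈ cochains a a n, z = DirectSum.lof ℂ ℕ (ConfMap V V) n f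

variable {a : V →ₗ[ℂ] V}

theorem IsCoch.cast {m n : ℕ} (h : m = n) {z : GradedConfMap V} (hz : IsCoch a m z) :
    IsCoch a n z := h ▸ hz

theorem IsCoch.sub {n : ℕ} {z w : GradedConfMap V} (hz : IsCoch a n z) (hw : IsCoch a n w) :
    IsCoch a n (z - w) := by
  obtain ⟨f, hf, rfl⟩ := hz
  obtain ⟨g, hg, rfl⟩ := hw
  exact ⟨f - g, Submodule.sub_mem _ hf hg, by rw [map_sub]⟩

theorem IsCoch.smul {n : ℕ} {z : GradedConfMap V} (hz : IsCoch a n z) (c : ℂ) :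
    IsCoch a n (c • z) := by
  obtain ⟨f, hf, rfl⟩ := hz
  exact ⟨c • f, Submodule.smul_mem _ c hf, by rw [map_smul]⟩

theorem circTotal_lof (a : V →ₗ[ℂ] V) {k l : ℕ} (f : ConfMap V V k) (g : ConfMap V V l) :
    circTotal a (DirectSum.lof ℂ ℕ (ConfMap V V) k f) (DirectSum.lof ℂ ℕ (ConfMap V V) l g) =
      DirectSum.lof ℂ ℕ (ConfMap V V) (k + l) (circ a f g) :=
  bilinExt_lof _ _ _ _ _

theorem nrBracket_lof (a : V →ₗ[ℂ] V) {k l : ℕ} (f : ConfMap V V k) (g : ConfMap V V l) :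
    nrBracket a (DirectSum.lof ℂ ℕ (ConfMap V V) k f) (DirectSum.lof ℂ ℕ (ConfMap V V) l g) =
      DirectSum.lof ℂ ℕ (ConfMap V V) (k + l) (circ a f g) -
        (-1 : ℂ) ^ (k * l) • DirectSum.lof ℂ ℕ (ConfMap V V) (l + k) (circ a g f) := by
  rw [nrBracket, bilinExt_lof, LinearMap.add_apply, LinearMap.add_apply,
    LinearMap.compl₁₂_apply, LinearMap.smul_apply, LinearMap.smul_apply, LinearMap.flip_apply,
    LinearMap.compl₁₂_apply, circTotal_lof, circTotal_lof, neg_smul, sub_eq_add_neg]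

theorem nrBracket_eq {k l : ℕ} {x y : GradedConfMap V} (hx : IsCoch a k x) (hy : IsCoch a l y) :
    nrBracket a x y = circTotal a x y - (-1 : ℂ) ^ (k * l) • circTotal a y x := by
  obtain ⟨f, -, rfl⟩ := hx
  obtain ⟨g, -, rfl⟩ := hy
  rw [nrBracket_lof, circTotal_lof, circTotal_lof]

theorem IsCoch.circTotal (ha : ∀ v, a (der V v) = der V (a v)) {k l : ℕ} {x y : GradedConfMap V}
    (hx : IsCoch a k x) (hy : IsCoch a l y) : IsCoch a (k + l) (circTotal a x y) := by
  obtain ⟨f, hf, rfl⟩ := hx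
  obtain ⟨g, hg, rfl⟩ := hy
  exact ⟨_, circ_mem_cochains ha hf hg, circTotal_lof a f g⟩

theorem IsCoch.nrBracket (ha : ∀ v, a (der V v) = der V (a v)) {k l : ℕ} {x y : GradedConfMap V}
    (hx : IsCoch a k x) (hy : IsCoch a l y) : IsCoch a (k + l) (nrBracket a x y) := by
  rw [nrBracket_eq hx hy]
  exact (hx.circTotal ha hy).sub (((hy.circTotal ha hx).cast (add_comm l k)).smul _)

theorem circTotal_preLie (ha : ∀ v, a (der V v) = der V (a v)) {k l m : ℕ}
    {x y z : GradedConfMap V} (hx : IsCoch a k x) (hy : IsCoch a l y) (hz : IsCoch a m z) :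
    circTotal a (circTotal a x y) z - circTotal a x (circTotal a y z) = (-1 : ℂ) ^ (l * m) •
      (circTotal a (circTotal a x z) y - circTotal a x (circTotal a z y)) := by
  obtain ⟨f, hf, rfl⟩ := hx
  obtain ⟨g, hg, rfl⟩ := hy
  obtain ⟨h, hh, rfl⟩ := hz
  refine gradedConfMap_ext fun n => ?_
  simp only [circTotal_lof, map_sub, map_smul, hatTotal_lof]
  rw [preLie_hat ha hf hg hh]
  rcases neg_one_pow_eq_or ℤ (l * m) with h1 | h1 <;>
    rcases Nat.even_or_odd (l * m) with h2 | h2 <;> simp [h2.neg_one_pow]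

theorem nrBracket_skew {k l : ℕ} {x y : GradedConfMap V} (hx : IsCoch a k x)
    (hy : IsCoch a l y) : nrBracket a x y = -((-1 : ℂ) ^ (k * l) • nrBracket a y x) := by
  rw [nrBracket_eq hx hy, nrBracket_eq hy hx, mul_comm l k, smul_sub, smul_smul, ← mul_pow]
  simp

theorem nrBracket_jacobi (ha : ∀ v, a (der V v) = der V (a v)) {k l m : ℕ}
    {x y z : GradedConfMap V} (hx : IsCoch a k x) (hy : IsCoch a l y) (hz : IsCoch a m z) :
    nrBracket a x (nrBracket a y z) = nrBracket a (nrBracket a x y) z +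
      (-1 : ℂ) ^ (k * l) • nrBracket a y (nrBracket a x z) := by
  have h1 := circTotal_preLie ha hx hy hz
  have h2 := circTotal_preLie ha hy hx hz
  have h3 := circTotal_preLie ha hz hx hy
  rw [nrBracket_eq hx (hy.nrBracket ha hz), nrBracket_eq (hx.nrBracket ha hy) hz,
    nrBracket_eq hy (hx.nrBracket ha hz), nrBracket_eq hx hy, nrBracket_eq hy hz,
    nrBracket_eq hx hz, mul_add, add_mul, mul_add, pow_add, pow_add, pow_add, mul_comm l k]
  exact jacobi_of_preLie (circTotal a) (neg_one_pow_eq_or ℂ _) (neg_one_pow_eq_or ℂ _)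
    (neg_one_pow_eq_or ℂ _) h1 h2 h3

/-- A bracket derived from a square-zero element of degree one is graded skew-symmetric on
elements that commute. -/
theorem derived_skew (ha : ∀ v, a (der V v) = der V (a v)) {k l : ℕ} {d x y : GradedConfMap V}
    (hd : IsCoch a 1 d) (hx : IsCoch a k x) (hy : IsCoch a l y) (hxy : nrBracket a x y = 0) :
    (-1 : ℂ) ^ (k + 1) • nrBracket a (nrBracket a d x) y =
      -((-1 : ℂ) ^ ((k + 1) * (l + 1)) • (-1 : ℂ) ^ (l + 1) •
        nrBracket a (nrBracket a d y) x) := by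
  -- the Jacobi identity for the three elements, in which the bracket of `x` and `y` drops out
  have h1 := nrBracket_jacobi ha hd hx hy
  rw [hxy, map_zero, nrBracket_skew hx (hd.nrBracket ha hy)] at h1
  have h2 : nrBracket a (nrBracket a d x) y =
      (-1 : ℂ) ^ (1 * k) • (-1 : ℂ) ^ (k * (1 + l)) • nrBracket a (nrBracket a d y) x := by
    rw [smul_neg, ← sub_eq_add_neg] at h1
    exact sub_eq_zero.1 h1.symm
  rw [h2, smul_smul, smul_smul, smul_smul, ← neg_smul]
  congr 1
  rcases Nat.even_or_odd k with hk | hk <;> rcases Nat.even_or_odd l with hl | hl <;>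
    simp [pow_add, pow_mul, hk.neg_one_pow, hl.neg_one_pow]

theorem derived_jacobi (ha : ∀ v, a (der V v) = der V (a v)) {k l m : ℕ}
    {d x y z : GradedConfMap V} (hd : IsCoch a 1 d) (hdd : nrBracket a d d = 0)
    (hx : IsCoch a k x) (hy : IsCoch a l y) (hz : IsCoch a m z) :
    (-1 : ℂ) ^ (k + 1) • nrBracket a (nrBracket a d x)
        ((-1 : ℂ) ^ (l + 1) • nrBracket a (nrBracket a d y) z) =
      (-1 : ℂ) ^ (k + 1 + (l + 1)) • nrBracket a
        (nrBracket a d ((-1 : ℂ) ^ (k + 1) • nrBracket a (nrBracket a d x) y)) z +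
      (-1 : ℂ) ^ ((k + 1) * (l + 1)) • (-1 : ℂ) ^ (l + 1) • nrBracket a (nrBracket a d y)
        ((-1 : ℂ) ^ (k + 1) • nrBracket a (nrBracket a d x) z) := by
  have hdx := hd.nrBracket ha hx
  have hdy := hd.nrBracket ha hy
  -- the bracket with a square-zero element is a differential
  have h0 : nrBracket a d (nrBracket a d x) = 0 := by
    have := nrBracket_jacobi ha hd hd hx
    rw [hdd, map_zero, LinearMap.zero_apply, zero_add] at this
    exact eq_zero_of_eq_neg_smul this
  have h1 := nrBracket_jacobi ha hd hdx hy
  rw [h0, map_zero, LinearMap.zero_apply, zero_add] at h1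
  have h2 := nrBracket_jacobi ha hdx hdy hz
  simp only [map_smul, LinearMap.smul_apply, h1, h2, smul_add, smul_smul]
  congr 1
  · congr 1
    rcases Nat.even_or_odd k with hk | hk <;> rcases Nat.even_or_odd l with hl | hl <;>
      simp [pow_add, hk.neg_one_pow, hl.neg_one_pow]
  · congr 1
    rcases Nat.even_or_odd k with hk | hk <;> rcases Nat.even_or_odd l with hl | hl <;>
      simp [pow_add, pow_mul, hk.neg_one_pow, hl.neg_one_pow]

end NRLie

/-! ### Functoriality of cochains, and `λ`-products as cochains -/

section Functoriality

variable {V W V' W' : Type*} [AddCommGroup V] [Module ℂ V] [Module (Polynomial ℂ) V]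
  [IsScalarTower ℂ (Polynomial ℂ) V] [AddCommGroup W] [Module ℂ W] [Module (Polynomial ℂ) W]
  [IsScalarTower ℂ (Polynomial ℂ) W] [AddCommGroup V'] [Module ℂ V'] [Module (Polynomial ℂ) V']
  [IsScalarTower ℂ (Polynomial ℂ) V'] [AddCommGroup W'] [Module ℂ W'] [Module (Polynomial ℂ) W']
  [IsScalarTower ℂ (Polynomial ℂ) W']

theorem comp_mem_cochains {a : V →ₗ[ℂ] V} {b : W →ₗ[ℂ] W} {a' : V' →ₗ[ℂ] V'} {b' : W' →ₗ[ℂ] W'}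
    {n : ℕ} {f : ConfMap V W n} (hf : f ∈ cochains a b n) {φ : V' →ₗ[ℂ] V} {ψ : W →ₗ[ℂ] W'}
    (hφ : ∀ v, φ (der V' v) = der V (φ v)) (hψ : ∀ w, ψ (der W w) = der W' (ψ w))
    (hφa : ∀ v, φ (a' v) = a (φ v)) (hψb : ∀ w, b' (ψ w) = ψ (b w)) :
    (ψ.lTensor _).compMultilinearMap (f.compLinearMap fun _ => φ) ∈ cochains a' b' n := by
  obtain ⟨h1, h2, h3, h4⟩ := hf
  have hup : ∀ (x : Fin (n + 1) → V') i v, (fun j => φ (Function.update x i v j)) =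
      Function.update (fun j => φ (x j)) i (φ v) := fun x i v =>
    funext fun j => Function.apply_update (fun _ => φ) x i v j
  have hψb' : b' ∘ₗ ψ = ψ ∘ₗ b := LinearMap.ext hψb
  have hψ' : ψ ∘ₗ der W = der W' ∘ₗ ψ := LinearMap.ext hψ
  refine ⟨fun x => ?_, fun x i => ?_, fun x => ?_, fun x τ => ?_⟩ <;>
    simp only [LinearMap.compMultilinearMap_apply, MultilinearMap.compLinearMap_apply]
  · rw [← LinearMap.lTensor_comp_apply, hψb', LinearMap.lTensor_comp_apply, h1]
    simp only [hφa]
  · rw [hup, hφ, h2 (fun j => φ (x j)), map_neg, lTensor_polySmul]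
  · rw [hup, hφ, h3 (fun j => φ (x j)), map_add, lTensor_polySmul,
      ← LinearMap.lTensor_comp_apply, hψ', LinearMap.lTensor_comp_apply]
  · rw [h4 _ τ, map_zsmul, subst_lTensor, dagger_lTensor _ hψ]

variable (W) in
/-- The substitution `λ ↦ -∂ - λ`. -/
def opp : PolyMod W (Fin 1) →ₗ[ℂ] PolyMod W (Fin 1) :=
  dagger W 1 ∘ₗ subst W fun _ => MvPolynomial.X (1 : Fin 2)

omit [Module (Polynomial ℂ) V] [IsScalarTower ℂ (Polynomial ℂ) V] [Module (Polynomial ℂ) V']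
  [IsScalarTower ℂ (Polynomial ℂ) V'] in
theorem lamOpp_apply (b : V →ₗ[ℂ] V' →ₗ[ℂ] PolyMod W (Fin 1)) (v : V') (u : V) :
    lamOpp b v u = opp W (b u v) := rfl

theorem opp_X_smul (P : PolyMod W (Fin 1)) :
    opp W ((MvPolynomial.X 0 : MvPolynomial (Fin 1) ℂ) • P) =
      -((MvPolynomial.X 0 : MvPolynomial (Fin 1) ℂ) • opp W P) - (der W).lTensor _ (opp W P) := by
  have h := dagger_last_smul (V := W) 1 (subst W (fun _ => MvPolynomial.X (1 : Fin 2)) P)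
  rw [Fin.sum_univ_one] at h
  simp only [opp, LinearMap.comp_apply, subst_smul, MvPolynomial.aeval_X]
  exact h

theorem opp_lTensor {φ : W →ₗ[ℂ] W'} (hφ : ∀ w, φ (der W w) = der W' (φ w))
    (P : PolyMod W (Fin 1)) : opp W' (φ.lTensor _ P) = φ.lTensor _ (opp W P) := by
  simp only [opp, LinearMap.comp_apply]
  rw [subst_lTensor, dagger_lTensor _ hφ]

theorem opp_opp (P : PolyMod W (Fin 1)) : opp W (opp W P) = P := by
  induction P using polyMod_induction with
  | h1 v => simp [opp, subst_tmul, dagger_one]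
  | hX i P hP =>
    rw [Subsingleton.elim i 0, opp_X_smul, map_sub, map_neg, opp_X_smul,
      opp_lTensor fun _ => rfl, hP]
    abel
  | hadd P Q hP hQ => rw [map_add, map_add, hP, hQ]

theorem ofBilinear_mem_cochains {a : V →ₗ[ℂ] V} {b : V →ₗ[ℂ] V →ₗ[ℂ] PolyMod V (Fin 1)}
    (h1 : ∀ u v, a.lTensor _ (b u v) = b (a u) (a v))
    (h2 : ∀ u v, b (der V u) v = -((MvPolynomial.X 0 : MvPolynomial (Fin 1) ℂ) • b u v))
    (h3 : ∀ u v, b u (der V v) =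
      (der V).lTensor _ (b u v) + (MvPolynomial.X 0 : MvPolynomial (Fin 1) ℂ) • b u v)
    (h4 : ∀ u v, b u v = -opp V (b v u)) : ofBilinear b ∈ cochains a a 1 := by
  have hb : ∀ x : Fin 2 → V, ofBilinear b x = b (x 0) (x 1) := fun x => rfl
  refine ⟨fun x => h1 _ _, fun x i => ?_, fun x => ?_, fun x τ => ?_⟩
  · rw [Subsingleton.elim i 0, hb, hb]
    exact h2 (x 0) (x 1)
  · rw [hb, hb, Fin.sum_univ_one]
    exact h3 (x 0) (x 1)
  · rw [hb, hb]
    have hτ : ∀ τ : Equiv.Perm (Fin 2), τ = 1 ∨ τ = Equiv.swap 0 1 := by decide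
    rcases hτ τ with rfl | rfl
    · simp only [Equiv.Perm.sign_one, Units.val_one, one_smul, Equiv.Perm.one_apply]
      exact (dagger_subst_castSucc 1 _).symm
    · rw [Equiv.Perm.sign_swap (by decide), Equiv.swap_apply_left, Equiv.swap_apply_right, h4]
      simp only [Units.val_neg, Units.val_one, neg_smul, one_smul]
      have h0 : ∀ i : Fin 1, Equiv.swap (0 : Fin 2) 1 i.castSucc = 1 := by decide
      simp only [h0]
      rfl

end Functoriality

section LambdaProducts

variable {V V' W : Type*} [AddCommGroup V] [Module ℂ V] [AddCommGroup W] [Module ℂ W]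
  [AddCommGroup V'] [Module ℂ V'] {σ τ : Type*}

theorem subst_lam (b : V →ₗ[ℂ] V' →ₗ[ℂ] PolyMod W (Fin 1)) (ν : MvPolynomial σ ℂ)
    (μ : σ → MvPolynomial τ ℂ) (u : V) (v : V') :
    subst W μ (lam b ν u v) = lam b (MvPolynomial.aeval μ ν) u v :=
  subst_subst _ _ _

theorem lamRight_tmul (b : V →ₗ[ℂ] V' →ₗ[ℂ] PolyMod W (Fin 1)) (ν : MvPolynomial σ ℂ) (u : V)
    (r : MvPolynomial σ ℂ) (v : V') : lamRight b ν u (r ⊗ₜ v) = r • lam b ν u v := by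
  simp [lamRight]

theorem lamRight_add (b : V →ₗ[ℂ] V' →ₗ[ℂ] PolyMod W (Fin 1)) (ν : MvPolynomial σ ℂ) (u : V)
    (P Q : PolyMod V' σ) : lamRight b ν u (P + Q) = lamRight b ν u P + lamRight b ν u Q := by
  simp [lamRight]

theorem lamLeft_tmul (b : V →ₗ[ℂ] V' →ₗ[ℂ] PolyMod W (Fin 1)) (ν : MvPolynomial σ ℂ) (u : V)
    (r : MvPolynomial σ ℂ) (v : V') : lamLeft b ν (r ⊗ₜ u) v = r • lam b ν u v := by
  simp [lamLeft]

theorem lamLeft_add (b : V →ₗ[ℂ] V' →ₗ[ℂ] PolyMod W (Fin 1)) (ν : MvPolynomial σ ℂ)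
    (P Q : PolyMod V σ) (v : V') : lamLeft b ν (P + Q) v = lamLeft b ν P v + lamLeft b ν Q v := by
  simp [lamLeft]

theorem lamRight_zero (b : V →ₗ[ℂ] V' →ₗ[ℂ] PolyMod W (Fin 1)) (ν : MvPolynomial σ ℂ) (u : V) :
    lamRight b ν u 0 = 0 := by
  simp [lamRight]

theorem lamLeft_zero (b : V →ₗ[ℂ] V' →ₗ[ℂ] PolyMod W (Fin 1)) (ν : MvPolynomial σ ℂ) (v : V') :
    lamLeft b ν 0 v = 0 := by
  simp [lamLeft]

theorem subst_lamRight (b : V →ₗ[ℂ] V' →ₗ[ℂ] PolyMod W (Fin 1)) (ν : MvPolynomial σ ℂ)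
    (μ : σ → MvPolynomial τ ℂ) (u : V) (P : PolyMod V' σ) :
    subst W μ (lamRight b ν u P) = lamRight b (MvPolynomial.aeval μ ν) u (subst V' μ P) := by
  induction P using TensorProduct.induction_on with
  | zero => simp only [map_zero, lamRight_zero]
  | tmul r v => rw [lamRight_tmul, subst_smul, subst_lam, subst_tmul, lamRight_tmul]
  | add P Q hP hQ => rw [lamRight_add, map_add, hP, hQ, map_add, lamRight_add]

theorem subst_lamLeft (b : V →ₗ[ℂ] V' →ₗ[ℂ] PolyMod W (Fin 1)) (ν : MvPolynomial σ ℂ)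
    (μ : σ → MvPolynomial τ ℂ) (P : PolyMod V σ) (v : V') :
    subst W μ (lamLeft b ν P v) = lamLeft b (MvPolynomial.aeval μ ν) (subst V μ P) v := by
  induction P using TensorProduct.induction_on with
  | zero => simp only [map_zero, lamLeft_zero]
  | tmul r v => rw [lamLeft_tmul, subst_smul, subst_lam, subst_tmul, lamLeft_tmul]
  | add P Q hP hQ => rw [lamLeft_add, map_add, hP, hQ, map_add, lamLeft_add]

end LambdaProducts

section Jacobi

variable {V : Type*} [AddCommGroup V] [Module ℂ V] [Module (Polynomial ℂ) V]
  [IsScalarTower ℂ (Polynomial ℂ) V] {σ : Type*}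
variable {a : V →ₗ[ℂ] V} {b : V →ₗ[ℂ] V →ₗ[ℂ] PolyMod V (Fin 1)}

theorem hat_ofBilinear (b : V →ₗ[ℂ] V →ₗ[ℂ] PolyMod V (Fin 1)) (u v : V)
    (ν μ : MvPolynomial σ ℂ) :
    hat σ 1 (ofBilinear b) [(u, ν), (v, μ)] = cls (ν + μ) (lam b ν u v) := by
  have h := hat_ofFn (σ := σ) (ofBilinear b) ![(u, ν), (v, μ)]
  have hw : ∑ i : Fin (1 + 1), (![(u, ν), (v, μ)] i).2 = ν + μ := Fin.sum_univ_two _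
  rw [hw] at h
  simp only [List.ofFn_succ, List.ofFn_zero] at h
  refine h.trans (congrArg (cls (ν + μ)) ?_)
  change subst V _ (b u v) = subst V _ (b u v)
  congr 2
  funext i
  rw [Subsingleton.elim i 0]
  rfl

theorem plugFst_ofBilinear_left (hb : ofBilinear b ∈ cochains a a 1) (v : V)
    (ν μ : MvPolynomial σ ℂ) (P : PolyMod V σ) :
    plugFst (hat σ 1 (ofBilinear b)) [(v, ν)] (cls μ P) = cls (μ + ν) (lamLeft b μ P v) := by
  induction P using TensorProduct.induction_on with
  | zero => simp only [map_zero, lamLeft_zero]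
  | tmul r u =>
    rw [cls_tmul, map_smul, plugFst_gen (hat_isSesq hb), hat_ofBilinear, lamLeft_tmul, map_smul]
  | add P Q hP hQ => rw [map_add, map_add, hP, hQ, lamLeft_add, map_add]

theorem plugFst_ofBilinear_right (hb : ofBilinear b ∈ cochains a a 1) (u : V)
    (ν μ : MvPolynomial σ ℂ) (P : PolyMod V σ) :
    plugFst (hat σ 1 (ofBilinear b)) [(u, ν)] (cls μ P) = -cls (ν + μ) (lamRight b ν u P) := by
  induction P using TensorProduct.induction_on with
  | zero => simp only [map_zero, lamRight_zero, neg_zero]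
  | tmul r v =>
    have := hat_isAlt (σ := σ) hb [] (v, μ) (u, ν) []
    simp only [List.nil_append] at this
    rw [cls_tmul, map_smul, plugFst_gen (hat_isSesq hb), this, hat_ofBilinear, lamRight_tmul,
      map_smul, smul_neg]
  | add P Q hP hQ => rw [map_add, map_add, hP, hQ, lamRight_add, map_add, neg_add]

theorem wedge_two_one {X U W Z : Type*} [AddCommGroup U] [AddCommGroup W] [AddCommGroup Z]
    {p : U → W → Z} (hp : BiAdditive p) {A : List X → U} {B : List X → W} (hA : IsHom 2 A)
    (x y z : X) : wedge p A B [x, y, z] =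
      p (A [x, y]) (B [z]) - p (A [x, z]) (B [y]) + p (A [y, z]) (B [x]) := by
  have h3 := hA [x, y, z] (by simp)
  have h1 : ∀ x, A [x] = 0 := fun x => hA [x] (by simp)
  have h0 := hA [] (by simp)
  have hneg : ∀ u w, p (-u) w = -p u w := fun u w => by simpa using hp.zsmul_left (-1) u w
  simp [wedge, signed, h3, h1, h0, hp.zero_left, hneg]
  abel

/-- The Hom-Jacobi identity for three elements says that the circle square of the bracket
vanishes on them. -/
theorem circ_self_eq_zero_of_jacobi (hb : ofBilinear b ∈ cochains a a 1) (x : Fin 3 → V)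
    (hJ : lamRight b (MvPolynomial.X (0 : Fin 2)) (a (x 0))
        (lam b (MvPolynomial.X (1 : Fin 2)) (x 1) (x 2)) =
      lamLeft b (MvPolynomial.X (0 : Fin 2) + MvPolynomial.X 1)
        (lam b (MvPolynomial.X (0 : Fin 2)) (x 0) (x 1)) (a (x 2)) +
      lamRight b (MvPolynomial.X (1 : Fin 2)) (a (x 1))
        (lam b (MvPolynomial.X (0 : Fin 2)) (x 0) (x 2))) :
    circ a (ofBilinear b) (ofBilinear b) x = 0 := by
  have hg : generic x = [(x 0, MvPolynomial.X 0), (x 1, MvPolynomial.X 1),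
      (x 2, MvPolynomial.X 2)] := by
    simp [generic, List.ofFn_succ]
  change circ a (ofBilinear b) (ofBilinear b) x = (0 : ConfMap V V (1 + 1)) x
  refine eq_of_hat_generic ?_
  -- the Hom-Jacobi identity, read in three variables of which the third does not occur
  have hJ' := congrArg (subst V fun i : Fin 2 =>
    (MvPolynomial.X i.castSucc : MvPolynomial (Fin 3) ℂ)) hJ
  rw [map_add] at hJ'
  simp only [subst_lamRight, subst_lamLeft, subst_lam, map_add, MvPolynomial.aeval_X] at hJ'
  have e0 : (0 : Fin 2).castSucc = (0 : Fin 3) := rfl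
  have e1 : (1 : Fin 2).castSucc = (1 : Fin 3) := rfl
  rw [e0, e1] at hJ'
  rw [hat_circ hb, map_zero, Pi.zero_apply]
  change circHat (σ := Fin 3) _ _ _ _ = 0
  rw [hg, circHat, wedge_two_one biAdditive_eval (hat_isHom _)]
  simp only [List.map_cons, List.map_nil, Prod.map_apply, id_eq, pow_one, hat_ofBilinear]
  rw [plugFst_ofBilinear_left hb, plugFst_ofBilinear_right hb, plugFst_ofBilinear_right hb, hJ',
    map_add]
  have w1 : (MvPolynomial.X 1 + (MvPolynomial.X 0 + MvPolynomial.X 2) :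
      MvPolynomial (Fin 3) ℂ) = MvPolynomial.X 0 + MvPolynomial.X 1 + MvPolynomial.X 2 := by ring
  have w2 : (MvPolynomial.X 0 + (MvPolynomial.X 1 + MvPolynomial.X 2) :
      MvPolynomial (Fin 3) ℂ) = MvPolynomial.X 0 + MvPolynomial.X 1 + MvPolynomial.X 2 := by ring
  rw [w1, w2]
  abel

end Jacobi

/-! ### Weights of maps on `L ⊕ M` -/

section Weights

variable {L M : Type*} [AddCommGroup L] [Module ℂ L] [AddCommGroup M] [Module ℂ M] {σ : Type*}

theorem prod_decomp (P : PolyMod (L × M) σ) :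
    P = (LinearMap.inl ℂ L M).lTensor _ ((LinearMap.fst ℂ L M).lTensor _ P) +
      (LinearMap.inr ℂ L M).lTensor _ ((LinearMap.snd ℂ L M).lTensor _ P) := by
  induction P using TensorProduct.induction_on with
  | zero => simp
  | tmul r v => simp [← TensorProduct.tmul_add]
  | add P Q hP hQ =>
    nth_rewrite 1 [hP, hQ]
    simp only [map_add]
    abel

variable (L M) in
/-- The operator `(x, m) ↦ (x, 2 m)`, whose eigenvalues record the number of components in
`M`. -/
def scaleSnd : (L × M) →ₗ[ℂ] (L × M) :=
  LinearMap.id.prodMap ((2 : ℂ) • LinearMap.id)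

/-- The map has weight `d`: on arguments each of which lies in `L` or in `M`, the value has a
component in `L` only if `d` arguments lie in `M`, and a component in `M` only if `d + 1` do. -/
def HasWeight (d : ℕ) {n : ℕ} (f : ConfMap (L × M) (L × M) n) : Prop :=
  ∀ x, f (fun i => scaleSnd L M (x i)) = (2 : ℂ) ^ d • (scaleSnd L M).lTensor _ (f x)

/-- The arguments with index in `J` are projected to `M`, the others to `L`. -/
def pureArgs {n : ℕ} (J : Finset (Fin n)) (x : Fin n → L × M) : Fin n → L × M :=
  J.piecewise (fun i => (0, (x i).2)) fun i => ((x i).1, 0)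

/-- The expansion by multilinearity along `x_i = (y_i, 0) + (0, m_i)`. -/
theorem sum_pureArgs {n : ℕ} (f : ConfMap (L × M) (L × M) n) (x : Fin (n + 1) → L × M) :
    f x = ∑ J : Finset (Fin (n + 1)), f (pureArgs J x) := by
  have := f.map_add_univ (fun i => (0, (x i).2)) (fun i => ((x i).1, 0))
  rw [show ((fun i => (0, (x i).2)) + fun i => ((x i).1, 0) : Fin (n + 1) → L × M) = x by
    funext i; simp] at this
  exact this

/-- Rescaling the arguments with index in `J` by `2` multiplies the value by `2` to the number of
elements of `J`; compare this with the weight. -/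
theorem HasWeight.pureArgs_eq {d n : ℕ} {f : ConfMap (L × M) (L × M) n} (hf : HasWeight d f)
    (J : Finset (Fin (n + 1))) (x : Fin (n + 1) → L × M) :
    (2 : ℂ) ^ J.card • f (pureArgs J x) =
      (2 : ℂ) ^ d • (scaleSnd L M).lTensor _ (f (pureArgs J x)) := by
  rw [← hf]
  have h1 : (fun i => scaleSnd L M (pureArgs J x i)) =
      fun i => (if i ∈ J then (2 : ℂ) else 1) • pureArgs J x i := by
    funext i
    by_cases hi : i ∈ J <;> simp [pureArgs, hi, scaleSnd]
  rw [h1, MultilinearMap.map_smul_univ, Finset.prod_ite]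
  simp

theorem HasWeight.cast {d e n : ℕ} (h : d = e) {f : ConfMap (L × M) (L × M) n}
    (hf : HasWeight d f) : HasWeight e f := h ▸ hf

theorem two_pow_smul_inj {P : Type*} [AddCommGroup P] [Module ℂ P] {m n : ℕ} (h : m ≠ n) {p : P}
    (hp : (2 : ℂ) ^ m • p = (2 : ℂ) ^ n • p) : p = 0 := by
  rw [← sub_eq_zero, ← sub_smul, smul_eq_zero, sub_eq_zero] at hp
  refine hp.resolve_left fun h2 => h ?_
  have h3 : (2 : ℕ) ^ m = 2 ^ n := by exact_mod_cast h2
  exact Nat.pow_right_injective le_rfl h3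

theorem HasWeight.fst_eq_zero {d n : ℕ} {f : ConfMap (L × M) (L × M) n} (hf : HasWeight d f)
    {J : Finset (Fin (n + 1))} (hJ : J.card ≠ d) (x : Fin (n + 1) → L × M) :
    (LinearMap.fst ℂ L M).lTensor _ (f (pureArgs J x)) = 0 := by
  refine two_pow_smul_inj hJ ?_
  have h := congrArg ((LinearMap.fst ℂ L M).lTensor _) (hf.pureArgs_eq J x)
  have hc : LinearMap.fst ℂ L M ∘ₗ scaleSnd L M = LinearMap.fst ℂ L M := by
    ext <;> simp [scaleSnd]
  rwa [map_smul, map_smul, ← LinearMap.lTensor_comp_apply, hc] at h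

theorem HasWeight.snd_eq_zero {d n : ℕ} {f : ConfMap (L × M) (L × M) n} (hf : HasWeight d f)
    {J : Finset (Fin (n + 1))} (hJ : J.card ≠ d + 1) (x : Fin (n + 1) → L × M) :
    (LinearMap.snd ℂ L M).lTensor _ (f (pureArgs J x)) = 0 := by
  refine two_pow_smul_inj hJ ?_
  have h := congrArg ((LinearMap.snd ℂ L M).lTensor _) (hf.pureArgs_eq J x)
  have hc : LinearMap.snd ℂ L M ∘ₗ scaleSnd L M = (2 : ℂ) • LinearMap.snd ℂ L M := by
    ext <;> simp [scaleSnd]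
  rwa [map_smul, map_smul, ← LinearMap.lTensor_comp_apply, hc, LinearMap.lTensor_smul,
    LinearMap.smul_apply, smul_smul, ← pow_succ] at h

theorem HasWeight.eq_zero_of_card {d n : ℕ} {f : ConfMap (L × M) (L × M) n} (hf : HasWeight d f)
    {J : Finset (Fin (n + 1))} (hJ : J.card ≠ d) (hJ' : J.card ≠ d + 1)
    (x : Fin (n + 1) → L × M) : f (pureArgs J x) = 0 := by
  rw [prod_decomp (f (pureArgs J x)), hf.fst_eq_zero hJ, hf.snd_eq_zero hJ', map_zero, map_zero,
    add_zero]

theorem HasWeight.eq_zero {d n : ℕ} {f : ConfMap (L × M) (L × M) n} (hf : HasWeight d f)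
    (hd : n + 1 < d) : f = 0 := by
  ext1 x
  rw [sum_pureArgs]
  refine Finset.sum_eq_zero fun J _ => ?_
  have : J.card ≤ n + 1 := by simpa using J.card_le_univ
  exact hf.eq_zero_of_card (by omega) (by omega) x

/-- The map on `M` with values in `L` that is cut out of a map on `L ⊕ M`. -/
def unlift {n : ℕ} (f : ConfMap (L × M) (L × M) n) : ConfMap M L n :=
  ((LinearMap.fst ℂ L M).lTensor _).compMultilinearMap
    (f.compLinearMap fun _ => LinearMap.inr ℂ L M)

/-- A map of `n + 1` arguments of the largest possible weight takes all its arguments from `M`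
and its values in `L`. -/
theorem HasWeight.eq_lift {n : ℕ} {f : ConfMap (L × M) (L × M) n} (hf : HasWeight (n + 1) f) :
    f = lift n (unlift f) := by
  ext1 x
  have h1 : f x = f (pureArgs Finset.univ x) := by
    rw [sum_pureArgs]
    refine Finset.sum_eq_single _ (fun J _ hJ => ?_) (by simp)
    have h2 : J.card ≤ n + 1 := by simpa using J.card_le_univ
    have h3 : J.card ≠ n + 1 := fun h => hJ (Finset.card_eq_iff_eq_univ J |>.1 (by simpa using h))
    exact hf.eq_zero_of_card h3 (by omega) x
  have h2 : pureArgs Finset.univ x = fun i => LinearMap.inr ℂ L M (x i).2 := by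
    funext i
    simp [pureArgs]
  rw [h1, prod_decomp (f _), hf.snd_eq_zero (by simp) x, map_zero, add_zero, h2]
  rfl

theorem hasWeight_lift {n : ℕ} (f : ConfMap M L n) : HasWeight (n + 1) (lift n f) := by
  intro x
  have h1 : ∀ x, lift n f x = (LinearMap.inl ℂ L M).lTensor _ (f fun i => (x i).2) := fun x => rfl
  have hc : scaleSnd L M ∘ₗ LinearMap.inl ℂ L M = LinearMap.inl ℂ L M := by
    ext <;> simp [scaleSnd]
  have h2 : (fun i => (scaleSnd L M (x i)).2) = fun i => (2 : ℂ) • (x i).2 := rfl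
  rw [h1, h1, ← LinearMap.lTensor_comp_apply, hc, h2, f.map_smul_univ fun _ => (2 : ℂ)]
  simp

theorem unlift_lift {n : ℕ} (f : ConfMap M L n) : unlift (lift n f) = f := by
  ext1 x
  change (LinearMap.fst ℂ L M).lTensor _ ((LinearMap.inl ℂ L M).lTensor _ (f x)) = f x
  rw [← LinearMap.lTensor_comp_apply, LinearMap.fst_comp_inl, LinearMap.lTensor_id,
    LinearMap.id_apply]

theorem lift_injective (n : ℕ) : Function.Injective (lift (L := L) (M := M) n) :=
  Function.LeftInverse.injective unlift_lift

end Weights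

/-! ### The semi-direct product bracket -/

section Semidirect

variable {L M : Type*} [AddCommGroup L] [Module ℂ L] [Module (Polynomial ℂ) L]
  [IsScalarTower ℂ (Polynomial ℂ) L] [AddCommGroup M] [Module ℂ M] [Module (Polynomial ℂ) M]
  [IsScalarTower ℂ (Polynomial ℂ) M] {H : HomLieConformalAlgebra L} (R : Representation M H)
  {σ : Type*}

theorem der_prod (v : L × M) : der (L × M) v = (der L v.1, der M v.2) := rfl

theorem semidirectTwist_der (v : L × M) :
    R.semidirectTwist (der (L × M) v) = der (L × M) (R.semidirectTwist v) := by
  rw [der_prod, der_prod]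
  exact Prod.ext (H.α_der _) (R.β_der _)

theorem semidirectBracket_apply (u v : L × M) : R.semidirectBracket u v =
    (LinearMap.inl ℂ L M).lTensor _ (H.bracket u.1 v.1) +
      (LinearMap.inr ℂ L M).lTensor _ (R.ρ u.1 v.2 - opp M (R.ρ v.1 u.2)) := rfl

theorem semidirectBracket_mem_cochains (hα : H.IsMultiplicative) :
    ofBilinear R.semidirectBracket ∈ cochains R.semidirectTwist R.semidirectTwist 1 := by
  have hinl : ∀ x, LinearMap.inl ℂ L M (der L x) = der (L × M) (LinearMap.inl ℂ L M x) :=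
    fun x => by rw [der_prod]; simp
  have hinr : ∀ x, LinearMap.inr ℂ L M (der M x) = der (L × M) (LinearMap.inr ℂ L M x) :=
    fun x => by rw [der_prod]; simp
  have hl : der (L × M) ∘ₗ LinearMap.inl ℂ L M = LinearMap.inl ℂ L M ∘ₗ der L :=
    (LinearMap.ext hinl).symm
  have hr : der (L × M) ∘ₗ LinearMap.inr ℂ L M = LinearMap.inr ℂ L M ∘ₗ der M :=
    (LinearMap.ext hinr).symm
  refine ofBilinear_mem_cochains (fun u v => ?_) (fun u v => ?_) (fun u v => ?_) fun u v => ?_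
  · have h1 : R.semidirectTwist ∘ₗ LinearMap.inl ℂ L M = LinearMap.inl ℂ L M ∘ₗ H.α := by
      ext <;> simp [Representation.semidirectTwist]
    have h2 : R.semidirectTwist ∘ₗ LinearMap.inr ℂ L M = LinearMap.inr ℂ L M ∘ₗ R.β := by
      ext <;> simp [Representation.semidirectTwist]
    rw [semidirectBracket_apply, semidirectBracket_apply, map_add, ← LinearMap.lTensor_comp_apply,
      ← LinearMap.lTensor_comp_apply, h1, h2, LinearMap.lTensor_comp_apply,
      LinearMap.lTensor_comp_apply, map_sub, hα, R.twist, ← opp_lTensor R.β_der, R.twist]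
    rfl
  · rw [semidirectBracket_apply, semidirectBracket_apply, der_prod, H.der_left, R.der_left,
      R.der_right, map_add (opp M), opp_X_smul, opp_lTensor fun _ => rfl, map_neg,
      smul_add, lTensor_polySmul, ← lTensor_polySmul (LinearMap.inr ℂ L M), smul_sub, neg_add,
      ← map_neg]
    congr 2
    abel
  · rw [semidirectBracket_apply, semidirectBracket_apply, der_prod, H.der_right, R.der_left,
      R.der_right, map_neg (opp M), opp_X_smul, map_add (LinearMap.lTensor _ (der (L × M))),
      smul_add, ← LinearMap.lTensor_comp_apply, ← LinearMap.lTensor_comp_apply, hl, hr,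
      LinearMap.lTensor_comp_apply, LinearMap.lTensor_comp_apply]
    simp only [← lTensor_polySmul, smul_sub, map_add, map_sub, map_neg]
    abel
  · rw [semidirectBracket_apply, semidirectBracket_apply, map_add, opp_lTensor hinl,
      opp_lTensor hinr, map_sub (opp M), opp_opp, H.skew, lamOpp_apply]
    simp only [map_sub, map_neg]
    abel

theorem hasWeight_semidirectBracket : HasWeight 0 (ofBilinear R.semidirectBracket) := by
  intro x
  change R.semidirectBracket (scaleSnd L M (x 0)) (scaleSnd L M (x 1)) =
    (2 : ℂ) ^ 0 • (scaleSnd L M).lTensor _ (R.semidirectBracket (x 0) (x 1))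
  have h1 : scaleSnd L M ∘ₗ LinearMap.inl ℂ L M = LinearMap.inl ℂ L M := by
    ext <;> simp [scaleSnd]
  have h2 : scaleSnd L M ∘ₗ LinearMap.inr ℂ L M = (2 : ℂ) • LinearMap.inr ℂ L M := by
    ext <;> simp [scaleSnd]
  have h3 : ∀ v : L × M, scaleSnd L M v = (v.1, (2 : ℂ) • v.2) := fun v => rfl
  rw [pow_zero, one_smul, semidirectBracket_apply, semidirectBracket_apply, map_add,
    ← LinearMap.lTensor_comp_apply, ← LinearMap.lTensor_comp_apply, h1, h2, h3, h3,
    LinearMap.lTensor_smul, LinearMap.smul_apply, ← map_smul]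
  congr 2
  simp [smul_sub]

theorem HasWeight.circ {k l d e : ℕ} {f : ConfMap (L × M) (L × M) k}
    {g : ConfMap (L × M) (L × M) l} (hf : HasWeight d f) (hg : HasWeight e g) :
    HasWeight (d + e) (circ R.semidirectTwist f g) := by
  have hs : ∀ v, scaleSnd L M (der (L × M) v) = der (L × M) (scaleSnd L M v) := fun v => by
    rw [der_prod, der_prod]
    exact Prod.ext rfl ((der M).map_smul (2 : ℂ) v.2).symm
  have hc : ∀ v, R.semidirectTwist (scaleSnd L M v) = scaleSnd L M (R.semidirectTwist v) :=
    fun v => Prod.ext rfl (R.β.map_smul (2 : ℂ) v.2)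
  intro x
  rw [circ_intertwine hs hc hf hg, pow_add]

theorem lam_semidirect (ν : MvPolynomial σ ℂ) (x y : L) (n : M) :
    lam R.semidirectBracket ν (x, 0) (y, n) =
      (LinearMap.inl ℂ L M).lTensor _ (lam H.bracket ν x y) +
        (LinearMap.inr ℂ L M).lTensor _ (lam R.ρ ν x n) := by
  change subst _ _ (R.semidirectBracket (x, 0) (y, n)) = _
  rw [semidirectBracket_apply, map_add, subst_lTensor, subst_lTensor]
  simp only [map_zero, sub_zero]
  rfl

theorem lamRight_semidirect (ν : MvPolynomial σ ℂ) (x : L) (P : PolyMod L σ) (Q : PolyMod M σ) :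
    lamRight R.semidirectBracket ν (x, 0) ((LinearMap.inl ℂ L M).lTensor _ P +
        (LinearMap.inr ℂ L M).lTensor _ Q) =
      (LinearMap.inl ℂ L M).lTensor _ (lamRight H.bracket ν x P) +
        (LinearMap.inr ℂ L M).lTensor _ (lamRight R.ρ ν x Q) := by
  rw [lamRight_add]
  congr 1
  · induction P using TensorProduct.induction_on with
    | zero => simp only [map_zero, lamRight_zero]
    | tmul r v =>
      rw [LinearMap.lTensor_tmul, lamRight_tmul, lamRight_tmul, lTensor_polySmul,
        LinearMap.inl_apply, lam_semidirect]
      simp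
    | add P Q hP hQ => rw [map_add, lamRight_add, hP, hQ, lamRight_add, map_add]
  · induction Q using TensorProduct.induction_on with
    | zero => simp only [map_zero, lamRight_zero]
    | tmul r v =>
      rw [LinearMap.lTensor_tmul, lamRight_tmul, lamRight_tmul, lTensor_polySmul,
        LinearMap.inr_apply, lam_semidirect]
      simp
    | add P Q hP hQ => rw [map_add, lamRight_add, hP, hQ, lamRight_add, map_add]

theorem lamLeft_semidirect (ν : MvPolynomial σ ℂ) (P : PolyMod L σ) (y : L) (n : M) :
    lamLeft R.semidirectBracket ν ((LinearMap.inl ℂ L M).lTensor _ P) (y, n) =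
      (LinearMap.inl ℂ L M).lTensor _ (lamLeft H.bracket ν P y) +
        (LinearMap.inr ℂ L M).lTensor _ (lamLeft R.ρ ν P n) := by
  induction P using TensorProduct.induction_on with
  | zero => simp only [map_zero, lamLeft_zero, add_zero]
  | tmul r v =>
    rw [LinearMap.lTensor_tmul, lamLeft_tmul, lamLeft_tmul, lamLeft_tmul, lTensor_polySmul,
      lTensor_polySmul, LinearMap.inl_apply, lam_semidirect, smul_add]
  | add P Q hP hQ =>
    rw [map_add, lamLeft_add, hP, hQ, lamLeft_add, lamLeft_add, map_add, map_add]
    abel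

/-- The Hom-Jacobi identity of the semi-direct product, for two elements of `L`. -/
theorem semidirect_jacobi (x y z : L) (m : M) :
    lamRight R.semidirectBracket (MvPolynomial.X (0 : Fin 2)) (R.semidirectTwist (x, 0))
        (lam R.semidirectBracket (MvPolynomial.X (1 : Fin 2)) (y, 0) (z, m)) =
      lamLeft R.semidirectBracket (MvPolynomial.X (0 : Fin 2) + MvPolynomial.X 1)
        (lam R.semidirectBracket (MvPolynomial.X (0 : Fin 2)) (x, 0) (y, 0))
        (R.semidirectTwist (z, m)) +
      lamRight R.semidirectBracket (MvPolynomial.X (1 : Fin 2)) (R.semidirectTwist (y, 0))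
        (lam R.semidirectBracket (MvPolynomial.X (0 : Fin 2)) (x, 0) (z, m)) := by
  have h : ∀ (x : L) (m : M), R.semidirectTwist (x, m) = (H.α x, R.β m) := fun _ _ => rfl
  simp only [h, map_zero, lam_semidirect, lamRight_semidirect, add_zero, lamLeft_semidirect]
  rw [H.jacobi, R.action, map_add, map_sub]
  abel

/-- The Nijenhuis-Richardson square of the bracket has weight `0`, so it is enough to insert at
most one argument in `M`. -/
theorem circ_semidirectBracket_self (hα : H.IsMultiplicative) :
    circ R.semidirectTwist (ofBilinear R.semidirectBracket) (ofBilinear R.semidirectBracket) =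
      0 := by
  have hΔ := semidirectBracket_mem_cochains R hα
  have hmem := circ_mem_cochains (semidirectTwist_der R) hΔ hΔ
  have hw : HasWeight 0 (circ R.semidirectTwist (ofBilinear R.semidirectBracket)
      (ofBilinear R.semidirectBracket)) :=
    HasWeight.cast (zero_add 0)
      (HasWeight.circ R (hasWeight_semidirectBracket R) (hasWeight_semidirectBracket R))
  -- the case of two arguments in `L` followed by an arbitrary one
  have h0 : ∀ x : Fin 3 → L × M, (x 0).2 = 0 → (x 1).2 = 0 →
      circ R.semidirectTwist (ofBilinear R.semidirectBracket) (ofBilinear R.semidirectBracket)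
        x = 0 := by
    intro x h0 h1
    refine circ_self_eq_zero_of_jacobi hΔ x ?_
    have e0 : x 0 = ((x 0).1, 0) := Prod.ext rfl h0
    have e1 : x 1 = ((x 1).1, 0) := Prod.ext rfl h1
    have e2 : x 2 = ((x 2).1, (x 2).2) := rfl
    rw [e0, e1, e2]
    exact semidirect_jacobi R _ _ _ _
  ext1 x
  rw [sum_pureArgs]
  refine Finset.sum_eq_zero fun J _ => ?_
  by_cases hJ : J.card ≤ 1
  · -- by skew-symmetry the argument in `M`, if there is one, may be put last
    obtain ⟨i, hi⟩ : ∃ i : Fin 3, J ⊆ {i} := Finset.card_le_one_iff_subset_singleton.1 hJ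
    have hne : ∀ j : Fin 3, j ≠ i → (pureArgs J x j).2 = 0 := by
      intro j hj
      have : j ∉ J := fun h => hj (Finset.mem_singleton.1 (hi h))
      simp [pureArgs, this]
    rw [hmem.2.2.2 _ (Equiv.swap i (2 : Fin 3)), h0, map_zero, map_zero, smul_zero]
    · refine hne _ fun h => ?_
      rw [Equiv.swap_apply_eq_iff, Equiv.swap_apply_left] at h
      exact absurd h (by decide)
    · refine hne _ fun h => ?_
      rw [Equiv.swap_apply_eq_iff, Equiv.swap_apply_left] at h
      exact absurd h (by decide)
  · exact hw.eq_zero_of_card (by omega) (by omega) x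

theorem lift_mem_cochains {n : ℕ} {f : ConfMap M L n} (hf : f ∈ cochains R.β H.α n) :
    lift n f ∈ cochains R.semidirectTwist R.semidirectTwist n :=
  comp_mem_cochains hf (φ := LinearMap.snd ℂ L M) (ψ := LinearMap.inl ℂ L M)
    (fun v => rfl) (fun w => by rw [der_prod]; simp) (fun v => rfl)
    (fun w => by simp [Representation.semidirectTwist])

theorem unlift_mem_cochains {n : ℕ} {f : ConfMap (L × M) (L × M) n}
    (hf : f ∈ cochains R.semidirectTwist R.semidirectTwist n) :
    unlift f ∈ cochains R.β H.α n :=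
  comp_mem_cochains hf (φ := LinearMap.inr ℂ L M) (ψ := LinearMap.fst ℂ L M)
    (fun v => by rw [der_prod]; simp) (fun w => rfl)
    (fun v => by simp [Representation.semidirectTwist]) (fun w => rfl)

end Semidirect

/-! ### The derived bracket -/

section Derived

variable {L M : Type*} [AddCommGroup L] [Module ℂ L] [Module (Polynomial ℂ) L]
  [IsScalarTower ℂ (Polynomial ℂ) L] [AddCommGroup M] [Module ℂ M] [Module (Polynomial ℂ) M]
  [IsScalarTower ℂ (Polynomial ℂ) M] {H : HomLieConformalAlgebra L} (R : Representation M H)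

/-- The element is a homogeneous cochain with `n + 1` arguments and of weight `d`. -/
def IsWeightCoch (n d : ℕ) (z : GradedConfMap (L × M)) : Prop :=
  ∃ f ∈ cochains R.semidirectTwist R.semidirectTwist n, HasWeight d f ∧
    z = DirectSum.lof ℂ ℕ (ConfMap (L × M) (L × M)) n f

variable {R}

theorem IsWeightCoch.isCoch {n d : ℕ} {z : GradedConfMap (L × M)} (h : IsWeightCoch R n d z) :
    IsCoch R.semidirectTwist n z :=
  let ⟨f, hf, _, hz⟩ := h
  ⟨f, hf, hz⟩

theorem IsWeightCoch.cast {m n d e : ℕ} (h : m = n) (h' : d = e) {z : GradedConfMap (L × M)}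
    (hz : IsWeightCoch R m d z) : IsWeightCoch R n e z := h ▸ h' ▸ hz

theorem IsWeightCoch.nrBracket {k l d e : ℕ} {y z : GradedConfMap (L × M)}
    (hy : IsWeightCoch R k d y) (hz : IsWeightCoch R l e z) :
    IsWeightCoch R (k + l) (d + e) (nrBracket R.semidirectTwist y z) := by
  obtain ⟨f, hf, hfw, rfl⟩ := hy
  obtain ⟨g, hg, hgw, rfl⟩ := hz
  have h1 : IsWeightCoch R (k + l) (d + e) (DirectSum.lof ℂ ℕ (ConfMap (L × M) (L × M)) (k + l)
      (HomLieConformal.circ R.semidirectTwist f g)) :=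
    ⟨_, circ_mem_cochains (semidirectTwist_der R) hf hg, hfw.circ R hgw, rfl⟩
  have h2 : IsWeightCoch R (l + k) (e + d) (DirectSum.lof ℂ ℕ (ConfMap (L × M) (L × M)) (l + k)
      (HomLieConformal.circ R.semidirectTwist g f)) :=
    ⟨_, circ_mem_cochains (semidirectTwist_der R) hg hf, hgw.circ R hfw, rfl⟩
  rw [nrBracket_lof]
  obtain ⟨u, hu, huw, hu'⟩ := h1
  obtain ⟨v, hv, hvw, hv'⟩ := h2.cast (add_comm l k) (add_comm e d)
  refine ⟨u - (-1 : ℂ) ^ (k * l) • v, Submodule.sub_mem _ hu (Submodule.smul_mem _ _ hv),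
    fun x => ?_, ?_⟩
  · rw [sub_apply, sub_apply, smul_apply, smul_apply, huw, hvw, map_sub, map_smul, smul_sub,
      smul_comm]
  · rw [hu', hv', map_sub, map_smul]

theorem IsWeightCoch.eq_zero {n d : ℕ} {z : GradedConfMap (L × M)} (h : IsWeightCoch R n d z)
    (hd : n + 1 < d) : z = 0 := by
  obtain ⟨f, -, hf, rfl⟩ := h
  rw [hf.eq_zero hd, map_zero]

variable (R)

theorem liftTotal_of (p : ℕ+) (f : R.C p) : R.liftTotal (R.of p f) =
    DirectSum.lof ℂ ℕ (ConfMap (L × M) (L × M)) p.natPred (lift p.natPred f.1) := by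
  rw [Representation.liftTotal, Representation.of, DirectSum.toModule_lof]
  rfl

theorem liftTotal_apply (z : R.GradedC) (p : ℕ+) :
    R.liftTotal z p.natPred = lift p.natPred (z p).1 := by
  induction z using DirectSum.induction_on with
  | zero => rw [map_zero, DirectSum.zero_apply, DirectSum.zero_apply, Submodule.coe_zero, map_zero]
  | add x y hx hy =>
    rw [map_add, DirectSum.add_apply, DirectSum.add_apply, hx, hy, Submodule.coe_add, map_add]
  | of q f =>
    rw [← DirectSum.lof_eq_of ℂ]
    change R.liftTotal (R.of q f) p.natPred = _
    rw [liftTotal_of]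
    by_cases h : q = p
    · subst h
      rw [DirectSum.lof_apply, DirectSum.lof_apply]
    · have h' : p.natPred ≠ q.natPred := fun h1 => h (PNat.natPred_injective h1).symm
      rw [DirectSum.lof_eq_of, DirectSum.lof_eq_of, DirectSum.of_eq_of_ne _ _ _ h',
        DirectSum.of_eq_of_ne _ _ _ (Ne.symm h), Submodule.coe_zero, map_zero]

theorem liftTotal_injective : Function.Injective R.liftTotal := by
  intro z w h
  refine DFinsupp.ext fun p => Subtype.ext (lift_injective _ ?_)
  rw [← liftTotal_apply, ← liftTotal_apply, h]

theorem isWeightCoch_liftTotal (p : ℕ+) (f : R.C p) :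
    IsWeightCoch R p.natPred p (R.liftTotal (R.of p f)) :=
  ⟨_, lift_mem_cochains R f.2, (hasWeight_lift f.1).cast p.natPred_add_one,
    liftTotal_of R p f⟩

theorem exists_liftTotal_of_isWeightCoch {p : ℕ+} {z : GradedConfMap (L × M)}
    (h : IsWeightCoch R p.natPred p z) : ∃ f : R.C p, R.liftTotal (R.of p f) = z := by
  obtain ⟨f, hf, hfw, rfl⟩ := h
  refine ⟨⟨unlift f, unlift_mem_cochains R hf⟩, ?_⟩
  rw [liftTotal_of]
  exact congrArg _ (hfw.cast p.natPred_add_one.symm).eq_lift.symm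

theorem isWeightCoch_mcElement (hα : H.IsMultiplicative) : IsWeightCoch R 1 0 R.mcElement :=
  ⟨_, semidirectBracket_mem_cochains R hα, hasWeight_semidirectBracket R, rfl⟩

theorem nrBracket_mcElement_self (hα : H.IsMultiplicative) :
    nrBracket R.semidirectTwist R.mcElement R.mcElement = 0 := by
  rw [Representation.mcElement, nrBracket_lof, circ_semidirectBracket_self R hα, map_zero,
    smul_zero, sub_zero]

/-- Lifts of cochains on `M` with values in `L` commute. -/
theorem nrBracket_liftTotal (p q : ℕ+) (f : R.C p) (g : R.C q) :
    nrBracket R.semidirectTwist (R.liftTotal (R.of p f)) (R.liftTotal (R.of q g)) = 0 := by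
  refine ((isWeightCoch_liftTotal R p f).nrBracket (isWeightCoch_liftTotal R q g)).eq_zero ?_
  have h1 := PNat.natPred_add_one p
  have h2 := PNat.natPred_add_one q
  omega

/-- The derived bracket of two homogeneous cochains, on `L ⊕ M`. -/
def derivedVal (p : ℕ+) (x y : GradedConfMap (L × M)) : GradedConfMap (L × M) :=
  (-1 : ℂ) ^ (p : ℕ) • nrBracket R.semidirectTwist (nrBracket R.semidirectTwist R.mcElement x) y

/-- The derived bracket of two lifts is a lift, because its weight is the number of its
arguments. -/
theorem exists_derivedVal (hα : H.IsMultiplicative) (p q : ℕ+) (f : R.C p) (g : R.C q) :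
    ∃ h : R.C (p + q), R.liftTotal (R.of (p + q) h) =
      derivedVal R p (R.liftTotal (R.of p f)) (R.liftTotal (R.of q g)) := by
  have h := ((isWeightCoch_mcElement R hα).nrBracket (isWeightCoch_liftTotal R p f)).nrBracket
    (isWeightCoch_liftTotal R q g)
  have e1 : 1 + p.natPred + q.natPred = (p + q).natPred := by
    have h1 := PNat.natPred_add_one p
    have h2 := PNat.natPred_add_one q
    have h3 := PNat.natPred_add_one (p + q)
    rw [PNat.add_coe] at h3
    omega
  have e2 : 0 + (p : ℕ) + q = (p + q : ℕ+) := by rw [PNat.add_coe, zero_add]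
  obtain ⟨u, hu⟩ := exists_liftTotal_of_isWeightCoch R (h.cast e1 e2)
  refine ⟨(-1 : ℂ) ^ (p : ℕ) • u, ?_⟩
  rw [derivedVal, ← hu, ← map_smul]
  congr 1
  exact map_smul (DirectSum.lof ℂ ℕ+ (fun p => R.C p) (p + q)) _ u

/-- The sign `(-1)^p` in degree `p`. -/
def degreeSign : R.GradedC →ₗ[ℂ] R.GradedC :=
  DirectSum.toModule ℂ ℕ+ _ fun p =>
    (-1 : ℂ) ^ (p : ℕ) • DirectSum.lof ℂ ℕ+ (fun p => R.C p) p

/-- The derived bracket as a bilinear map with values in the maps on `L ⊕ M`. -/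
def derivedBilin : R.GradedC →ₗ[ℂ] R.GradedC →ₗ[ℂ] GradedConfMap (L × M) :=
  (nrBracket R.semidirectTwist ∘ₗ nrBracket R.semidirectTwist R.mcElement ∘ₗ R.liftTotal ∘ₗ
    degreeSign R).compl₂ R.liftTotal

theorem derivedBilin_of (p q : ℕ+) (f : R.C p) (g : R.C q) :
    derivedBilin R (R.of p f) (R.of q g) =
      derivedVal R p (R.liftTotal (R.of p f)) (R.liftTotal (R.of q g)) := by
  have h : degreeSign R (R.of p f) = (-1 : ℂ) ^ (p : ℕ) • R.of p f := by
    rw [degreeSign, Representation.of, DirectSum.toModule_lof]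
    rfl
  rw [derivedBilin, LinearMap.compl₂_apply, LinearMap.comp_apply, LinearMap.comp_apply,
    LinearMap.comp_apply, h, map_smul, map_smul, map_smul, LinearMap.smul_apply, derivedVal]

theorem isDerivedBracket_iff (B : R.GradedC →ₗ[ℂ] R.GradedC →ₗ[ℂ] R.GradedC) :
    R.IsDerivedBracket B ↔ ∀ x y, R.liftTotal (B x y) = derivedBilin R x y := by
  constructor
  · intro h x y
    have : B.compr₂ R.liftTotal = derivedBilin R := by
      refine DirectSum.linearMap_ext _ fun p => LinearMap.ext fun f => ?_
      refine DirectSum.linearMap_ext _ fun q => LinearMap.ext fun g => ?_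
      exact (h p q f g).trans (derivedBilin_of R p q f g).symm
    rw [← this]
    rfl
  · intro h p q f g
    rw [h, derivedBilin_of, derivedVal]

theorem existsUnique_derivedBracket (hα : H.IsMultiplicative) :
    ∃! B : R.GradedC →ₗ[ℂ] R.GradedC →ₗ[ℂ] R.GradedC, R.IsDerivedBracket B := by
  have hr : ∀ x y, ∃ z, R.liftTotal z = derivedBilin R x y := by
    intro x y
    induction x using DirectSum.induction_on with
    | zero => exact ⟨0, by rw [map_zero, map_zero, LinearMap.zero_apply]⟩
    | add x x' hx hx' =>
      obtain ⟨z, hz⟩ := hx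
      obtain ⟨z', hz'⟩ := hx'
      exact ⟨z + z', by rw [map_add, map_add, hz, hz', LinearMap.add_apply]⟩
    | of p f =>
      induction y using DirectSum.induction_on with
      | zero => exact ⟨0, by rw [map_zero, map_zero]⟩
      | add x x' hx hx' =>
        obtain ⟨z, hz⟩ := hx
        obtain ⟨z', hz'⟩ := hx'
        exact ⟨z + z', by rw [map_add, map_add, hz, hz']⟩
      | of q g =>
        obtain ⟨h, hh⟩ := exists_derivedVal R hα p q f g
        exact ⟨R.of (p + q) h, hh.trans (derivedBilin_of R p q f g).symm⟩
  -- the bracket is bilinear because this can be checked after lifting to `L ⊕ M`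
  choose b hb using hr
  have hinj := liftTotal_injective R
  refine ⟨LinearMap.mk₂ ℂ b (fun x x' y => hinj ?_) (fun c x y => hinj ?_)
    (fun x y y' => hinj ?_) (fun c x y => hinj ?_), ?_, fun B' hB' => ?_⟩
  · rw [map_add, hb, hb, hb, map_add, LinearMap.add_apply]
  · rw [map_smul, hb, hb, map_smul, LinearMap.smul_apply]
  · rw [map_add, hb, hb, hb, map_add]
  · rw [map_smul, hb, hb, map_smul]
  · exact (isDerivedBracket_iff R _).2 hb
  · refine LinearMap.ext fun x => LinearMap.ext fun y => hinj ?_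
    rw [(isDerivedBracket_iff R B').1 hB']
    exact (hb x y).symm

theorem isGradedLieBracket_of_isDerivedBracket (hα : H.IsMultiplicative)
    {B : R.GradedC →ₗ[ℂ] R.GradedC →ₗ[ℂ] R.GradedC} (hB : R.IsDerivedBracket B) :
    IsGradedLieBracket (A := fun p => R.C p) B := by
  have hinj := liftTotal_injective R
  have ha := semidirectTwist_der R
  have hd := (isWeightCoch_mcElement R hα).isCoch
  have hdd := nrBracket_mcElement_self R hα
  have hc : ∀ (p : ℕ+) (f : R.C p), IsCoch R.semidirectTwist p.natPred (R.liftTotal (R.of p f)) :=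
    fun p f => (isWeightCoch_liftTotal R p f).isCoch
  have hdeg : ∀ (p q : ℕ+) (f : R.C p) (g : R.C q),
      ∃ h : R.C (p + q), B (R.of p f) (R.of q g) = R.of (p + q) h := by
    intro p q f g
    obtain ⟨h, hh⟩ := exists_derivedVal R hα p q f g
    exact ⟨h, hinj ((hB p q f g).trans hh.symm)⟩
  refine ⟨hdeg, fun p q f g => hinj ?_, fun p q r f g h => hinj ?_⟩
  · change R.liftTotal (B (R.of p f) (R.of q g)) =
      R.liftTotal (-((-1 : ℂ) ^ (p * q : ℕ) • B (R.of q g) (R.of p f)))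
    rw [map_neg, map_smul, hB, hB]
    have := derived_skew ha hd (hc p f) (hc q g) (nrBracket_liftTotal R p q f g)
    rwa [PNat.natPred_add_one, PNat.natPred_add_one] at this
  · change R.liftTotal (B (R.of p f) (B (R.of q g) (R.of r h))) =
      R.liftTotal (B (B (R.of p f) (R.of q g)) (R.of r h) +
        (-1 : ℂ) ^ (p * q : ℕ) • B (R.of q g) (B (R.of p f) (R.of r h)))
    obtain ⟨u, hu⟩ := hdeg q r g h
    obtain ⟨v, hv⟩ := hdeg p q f g
    obtain ⟨w, hw⟩ := hdeg p r f h
    have hu' := hB q r g h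
    have hv' := hB p q f g
    have hw' := hB p r f h
    rw [hu] at hu' ⊢
    rw [hv] at hv' ⊢
    rw [hw] at hw' ⊢
    have h1 := hB p (q + r) f u
    have h2 := hB (p + q) r v h
    have h3 := hB q (p + r) g w
    rw [hu'] at h1
    rw [hv'] at h2
    rw [hw'] at h3
    have := derived_jacobi ha hd hdd (hc p f) (hc q g) (hc r h)
    rw [PNat.natPred_add_one, PNat.natPred_add_one, ← PNat.add_coe] at this
    refine (h1.trans this).trans ?_
    rw [R.liftTotal.map_add, R.liftTotal.map_smul, h2, h3]

end Derived

/-! ### Linear operators and the derived bracket -/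

section Operators

variable {V W : Type*} [AddCommGroup V] [Module ℂ V] [Module (Polynomial ℂ) V]
  [IsScalarTower ℂ (Polynomial ℂ) V] [AddCommGroup W] [Module ℂ W] [Module (Polynomial ℂ) W]
  [IsScalarTower ℂ (Polynomial ℂ) W] {σ : Type*}

omit [Module (Polynomial ℂ) W] [IsScalarTower ℂ (Polynomial ℂ) W] in
theorem one_tmul_injective (σ : Type*) :
    Function.Injective fun w : W => (1 : MvPolynomial σ ℂ) ⊗ₜ[ℂ] w := by
  let r : PolyMod W σ →ₗ[ℂ] W := (TensorProduct.lid ℂ W).toLinearMap ∘ₗ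
    LinearMap.rTensor W (MvPolynomial.aeval fun _ => (0 : ℂ)).toLinearMap
  exact Function.LeftInverse.injective (g := r) fun w => by simp [r]

theorem ofLinear_mem_cochains_iff {a : V →ₗ[ℂ] V} {b : W →ₗ[ℂ] W} {T : V →ₗ[ℂ] W} :
    ofLinear T ∈ cochains a b 0 ↔
      (∀ v, b (T v) = T (a v)) ∧ ∀ v, T (der V v) = der W (T v) := by
  have h : ∀ x, ofLinear T x = (1 : MvPolynomial (Fin 0) ℂ) ⊗ₜ[ℂ] T (x 0) := fun x => rfl
  constructor
  · rintro ⟨h1, -, h3, -⟩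
    refine ⟨fun v => one_tmul_injective (Fin 0) ?_, fun v => one_tmul_injective (Fin 0) ?_⟩
    · simpa [h] using h1 fun _ => v
    · simpa [h] using h3 fun _ => v
  · rintro ⟨h1, h3⟩
    refine ⟨fun x => ?_, fun x i => i.elim0, fun x => ?_, fun x τ => ?_⟩
    · simp [h, h1]
    · simp [h, h3]
    · obtain rfl : τ = 1 := Equiv.ext fun i => Subsingleton.elim (α := Fin 1) _ _
      simp [h, subst_tmul, dagger_one]

theorem hat_ofLinear (T : V →ₗ[ℂ] V) (x : V × MvPolynomial σ ℂ) :
    hat σ 0 (ofLinear T) [x] = gen (T x.1, x.2) := by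
  have h := hat_ofFn (σ := σ) (ofLinear T) ![x]
  simp only [List.ofFn_succ, List.ofFn_zero, Fin.sum_univ_succ, Fin.sum_univ_zero] at h
  refine h.trans ?_
  change cls (x.2 + 0) (subst V _ (1 ⊗ₜ[ℂ] T x.1)) = _
  rw [add_zero, subst_tmul, map_one]
  rfl

theorem plugFst_hat_ofLinear {a b T : V →ₗ[ℂ] V} (hT : ofLinear T ∈ cochains a b 0) :
    plugFst (hat σ 0 (ofLinear T)) [] = twistWeight σ T :=
  weightModule_ext fun x => by
    rw [plugFst_gen (hat_isSesq hT), hat_ofLinear,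
      twistWeight_gen (ofLinear_mem_cochains_iff.1 hT).2]

theorem wedge_one_one {X U W Z : Type*} [AddCommGroup U] [AddCommGroup W] [AddCommGroup Z]
    {p : U → W → Z} (hp : BiAdditive p) {A : List X → U} {B : List X → W} (hA : IsHom 1 A)
    (x y : X) : wedge p A B [x, y] = p (A [x]) (B [y]) - p (A [y]) (B [x]) := by
  have h2 := hA [x, y] (by simp)
  have h0 := hA [] (by simp)
  have hneg : ∀ u w, p (-u) w = -p u w := fun u w => by simpa using hp.zsmul_left (-1) u w
  simp [wedge, signed, h2, h0, hp.zero_left, hneg]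
  abel

theorem wedge_two_zero {X U W Z : Type*} [AddCommGroup U] [AddCommGroup W] [AddCommGroup Z]
    {p : U → W → Z} (hp : BiAdditive p) {A : List X → U} {B : List X → W} (hA : IsHom 2 A)
    (x y : X) : wedge p A B [x, y] = p (A [x, y]) (B []) := by
  have h1 : ∀ x, A [x] = 0 := fun x => hA [x] (by simp)
  have h0 := hA [] (by simp)
  simp [wedge, signed, h1, h0, hp.zero_left]

/-- The bracket with a linear operator `T` measures the failure of `T` to be a derivation. -/
theorem hatTotal_nrBracket_ofLinear {a T : V →ₗ[ℂ] V} (hT : ofLinear T ∈ cochains a a 0)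
    {z : GradedConfMap V} (hz : IsCoch a 1 z) (x y : V × MvPolynomial σ ℂ) :
    hatTotal σ (nrBracket a z (DirectSum.lof ℂ ℕ (ConfMap V V) 0 (ofLinear T))) [x, y] =
      hatTotal σ z [(T x.1, x.2), y] + hatTotal σ z [x, (T y.1, y.2)] -
        twistWeight σ T (hatTotal σ z [x, y]) := by
  obtain ⟨f, hf, rfl⟩ := hz
  have halt := hat_isAlt (σ := σ) hf [] (T y.1, y.2) x []
  simp only [List.nil_append] at halt
  rw [nrBracket_lof, map_sub, map_smul, hatTotal_lof, hatTotal_lof, hatTotal_lof, hat_circ hf,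
    hat_circ hT, Pi.sub_apply, Pi.smul_apply, circHat, circHat,
    wedge_one_one biAdditive_eval (hat_isHom _), wedge_two_zero biAdditive_eval (hat_isHom _)]
  have hid : ∀ w : V × MvPolynomial σ ℂ, Prod.map (1 : Module.End ℂ V) id w = w := fun _ => rfl
  simp only [List.map_cons, List.map_nil, hid, pow_zero, hat_ofLinear, mul_zero, one_smul,
    plugFst_gen (hat_isSesq hf), halt,
    plugFst_hat_ofLinear hT, sub_neg_eq_add]

/-- For a square-zero operator `T`, the second bracket of a `λ`-product with `T` vanishes if and
only if `T` satisfies the operator identity. -/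
theorem nrBracket_nrBracket_ofLinear_eq_zero_iff {a T : V →ₗ[ℂ] V}
    (ha : ∀ v, a (der V v) = der V (a v)) (hT : ofLinear T ∈ cochains a a 0)
    (hTT : ∀ v, T (T v) = 0) {b : V →ₗ[ℂ] V →ₗ[ℂ] PolyMod V (Fin 1)}
    (hb : ofBilinear b ∈ cochains a a 1) :
    nrBracket a (nrBracket a (DirectSum.lof ℂ ℕ (ConfMap V V) 1 (ofBilinear b))
        (DirectSum.lof ℂ ℕ (ConfMap V V) 0 (ofLinear T)))
        (DirectSum.lof ℂ ℕ (ConfMap V V) 0 (ofLinear T)) = 0 ↔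
      ∀ u v, b (T u) (T v) = T.lTensor _ (b (T u) v + b u (T v)) := by
  have hTd := (ofLinear_mem_cochains_iff.1 hT).2
  set t := DirectSum.lof ℂ ℕ (ConfMap V V) 0 (ofLinear T) with ht
  set Δ := DirectSum.lof ℂ ℕ (ConfMap V V) 1 (ofBilinear b) with hΔ
  have hct : IsCoch a 0 t := ⟨_, hT, ht⟩
  have hcΔ : IsCoch a 1 Δ := ⟨_, hb, hΔ⟩
  have hc1 : IsCoch a 1 (nrBracket a Δ t) := hcΔ.nrBracket ha hct
  have hc2 : IsCoch a 1 (nrBracket a (nrBracket a Δ t) t) := hc1.nrBracket ha hct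
  have hττ : ∀ P : WeightModule V (Fin 2), twistWeight (Fin 2) T (twistWeight (Fin 2) T P) = 0 := by
    intro P
    have : twistWeight (Fin 2) T ∘ₗ twistWeight (Fin 2) T = 0 := weightModule_ext fun x => by
      rw [LinearMap.comp_apply, twistWeight_gen hTd, twistWeight_gen hTd, hTT]
      simp [gen]
    exact LinearMap.congr_fun this P
  have hval : ∀ x y, hatTotal (Fin 2) Δ [x, y] = cls (x.2 + y.2) (lam b x.2 x.1 y.1) := by
    intro x y
    rw [hΔ, hatTotal_lof]
    exact hat_ofBilinear b x.1 y.1 x.2 y.2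
  -- `T` is applied at two different places among `u`, `v` and the value, in either order, whence
  -- the factor `2`; the terms with `T` applied twice at the same place vanish
  have key : ∀ u v, hatTotal (Fin 2) (nrBracket a (nrBracket a Δ t) t)
      [(u, MvPolynomial.X 0), (v, MvPolynomial.X 1)] =
      (2 : ℂ) • (cls (∑ i, MvPolynomial.X i)
          (subst V (fun i : Fin 1 => MvPolynomial.X i.castSucc) (b (T u) (T v))) -
        cls (∑ i, MvPolynomial.X i) (subst V (fun i : Fin 1 => MvPolynomial.X i.castSucc)
          (T.lTensor _ (b (T u) v + b u (T v))))) := by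
    intro u v
    have hs : (fun i : Fin 1 => (MvPolynomial.X i.castSucc : MvPolynomial (Fin 2) ℂ)) =
        fun _ => MvPolynomial.X 0 := funext fun i => by rw [Subsingleton.elim i 0]; rfl
    rw [hs, Fin.sum_univ_two, subst_lTensor, ← twistWeight_cls hTd, map_add, map_add, map_add,
      ht, hatTotal_nrBracket_ofLinear hT hc1, hatTotal_nrBracket_ofLinear hT hcΔ,
      hatTotal_nrBracket_ofLinear hT hcΔ, hatTotal_nrBracket_ofLinear hT hcΔ]
    simp only [hval, hTT, map_sub, map_add, hττ, map_zero, LinearMap.zero_apply]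
    simp only [lam, LinearMap.compr₂_apply]
    module
  constructor
  · intro h u v
    have h1 := key u v
    rw [h, map_zero, Pi.zero_apply, eq_comm, smul_eq_zero] at h1
    exact eq_of_cls_eq (sub_eq_zero.1 (h1.resolve_left two_ne_zero))
  · intro h
    obtain ⟨f, hf, hz⟩ := hc2
    rw [hz] at key ⊢
    have : f = 0 := by
      ext1 x
      refine eq_of_hat_generic ?_
      have hg : generic x = [(x 0, MvPolynomial.X 0), (x 1, MvPolynomial.X 1)] := by
        simp [generic, List.ofFn_succ]
      have h1 := key (x 0) (x 1)
      rw [hatTotal_lof, h, sub_self, smul_zero] at h1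
      rw [hg, h1, map_zero, Pi.zero_apply]
    rw [this, map_zero]

end Operators

section OOperators

variable {L M : Type*} [AddCommGroup L] [Module ℂ L] [Module (Polynomial ℂ) L]
  [IsScalarTower ℂ (Polynomial ℂ) L] [AddCommGroup M] [Module ℂ M] [Module (Polynomial ℂ) M]
  [IsScalarTower ℂ (Polynomial ℂ) M] {H : HomLieConformalAlgebra L} (R : Representation M H)

omit [Module (Polynomial ℂ) L] [IsScalarTower ℂ (Polynomial ℂ) L] [Module (Polynomial ℂ) M]
  [IsScalarTower ℂ (Polynomial ℂ) M] in
theorem lTensor_inl_injective (σ : Type*) :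
    Function.Injective ((LinearMap.inl ℂ L M).lTensor (MvPolynomial σ ℂ)) :=
  Function.LeftInverse.injective (g := (LinearMap.fst ℂ L M).lTensor (MvPolynomial σ ℂ))
    fun P => by
      rw [← LinearMap.lTensor_comp_apply, LinearMap.fst_comp_inl, LinearMap.lTensor_id,
        LinearMap.id_apply]

/-- The operator identity of `(x, m) ↦ (T m, 0)` for the semi-direct product is the identity of
an `𝒪`-operator for `T`. -/
theorem semidirect_operator_iff (T : M →ₗ[ℂ] L) (u v : L × M) :
    R.semidirectBracket (T u.2, 0) (T v.2, 0) =
      (LinearMap.inl ℂ L M ∘ₗ T ∘ₗ LinearMap.snd ℂ L M).lTensor _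
        (R.semidirectBracket (T u.2, 0) v + R.semidirectBracket u (T v.2, 0)) ↔
    H.bracket (T u.2) (T v.2) =
      T.lTensor _ (R.ρ (T u.2) v.2 - lamOpp R.ρ u.2 (T v.2)) := by
  have h1 : LinearMap.snd ℂ L M ∘ₗ LinearMap.inl ℂ L M = 0 := LinearMap.snd_comp_inl _ _ _
  have h2 : LinearMap.snd ℂ L M ∘ₗ LinearMap.inr ℂ L M = LinearMap.id :=
    LinearMap.snd_comp_inr _ _ _
  have hs : ∀ (P : PolyMod L (Fin 1)) (Q : PolyMod M (Fin 1)),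
      (LinearMap.snd ℂ L M).lTensor _ ((LinearMap.inl ℂ L M).lTensor _ P +
        (LinearMap.inr ℂ L M).lTensor _ Q) = Q := by
    intro P Q
    rw [map_add, ← LinearMap.lTensor_comp_apply, ← LinearMap.lTensor_comp_apply, h1, h2,
      LinearMap.lTensor_zero, LinearMap.lTensor_id, LinearMap.zero_apply, LinearMap.id_apply,
      zero_add]
  rw [LinearMap.lTensor_comp_apply, LinearMap.lTensor_comp_apply, map_add,
    semidirectBracket_apply, semidirectBracket_apply R _ v, semidirectBracket_apply R u, hs, hs]
  simp only [map_zero, sub_zero, zero_sub, add_zero, lamOpp_apply,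
    ← sub_eq_add_neg]
  exact (lTensor_inl_injective (Fin 1)).eq_iff

theorem derivedBracket_self_eq_zero_iff {B : R.GradedC →ₗ[ℂ] R.GradedC →ₗ[ℂ] R.GradedC}
    (hB : R.IsDerivedBracket B) (p : ℕ+) (f : R.C p) : B (R.of p f) (R.of p f) = 0 ↔
      nrBracket R.semidirectTwist (nrBracket R.semidirectTwist R.mcElement
        (R.liftTotal (R.of p f))) (R.liftTotal (R.of p f)) = 0 := by
  rw [← (liftTotal_injective R).eq_iff, hB, map_zero,
    smul_eq_zero_iff_right (pow_ne_zero _ (neg_ne_zero.2 one_ne_zero))]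

theorem isOOperator_iff_derivedBracket_self_eq_zero (hα : H.IsMultiplicative)
    {B : R.GradedC →ₗ[ℂ] R.GradedC →ₗ[ℂ] R.GradedC} (hB : R.IsDerivedBracket B)
    {T : M →ₗ[ℂ] L} (hT : ∀ m, H.α (T m) = T (R.β m)) :
    IsOOperator R T ↔ ∃ hT : ofLinear T ∈ R.C 1,
      B (R.of 1 ⟨ofLinear T, hT⟩) (R.of 1 ⟨ofLinear T, hT⟩) = 0 := by
  have hmem : ofLinear T ∈ R.C 1 ↔ ∀ m, T (der M m) = der L (T m) :=
    ofLinear_mem_cochains_iff.trans (and_iff_right hT)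
  have key : ∀ h : ofLinear T ∈ R.C 1,
      B (R.of 1 ⟨ofLinear T, h⟩) (R.of 1 ⟨ofLinear T, h⟩) = 0 ↔
      ∀ m n, H.bracket (T m) (T n) = T.lTensor _ (R.ρ (T m) n - lamOpp R.ρ m (T n)) := by
    intro h
    have hl : R.liftTotal (R.of 1 ⟨ofLinear T, h⟩) =
        DirectSum.lof ℂ ℕ (ConfMap (L × M) (L × M)) 0
          (ofLinear (LinearMap.inl ℂ L M ∘ₗ T ∘ₗ LinearMap.snd ℂ L M)) :=
      liftTotal_of R 1 ⟨ofLinear T, h⟩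
    have hl' : ofLinear (LinearMap.inl ℂ L M ∘ₗ T ∘ₗ LinearMap.snd ℂ L M) ∈
        cochains R.semidirectTwist R.semidirectTwist 0 := lift_mem_cochains R (n := 0) h
    refine (derivedBracket_self_eq_zero_iff R hB 1 ⟨ofLinear T, h⟩).trans ?_
    rw [hl, Representation.mcElement,
      nrBracket_nrBracket_ofLinear_eq_zero_iff (semidirectTwist_der R) hl' (fun v => by simp)
        (semidirectBracket_mem_cochains R hα)]
    constructor
    · exact fun h m n => (semidirect_operator_iff R T (0, m) (0, n)).1 (h (0, m) (0, n))
    · exact fun h u v => (semidirect_operator_iff R T u v).2 (h u.2 v.2)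
  constructor
  · rintro ⟨h1, -, h3⟩
    exact ⟨hmem.2 h1, (key _).2 h3⟩
  · rintro ⟨h, h0⟩
    exact ⟨hmem.1 h, fun m => (hT m).symm, (key h).1 h0⟩

end OOperators

end HomLieConformal

end

theorem mainTheorem1 {L M : Type*}
    [AddCommGroup L] [Module ℂ L] [Module (Polynomial ℂ) L] [IsScalarTower ℂ (Polynomial ℂ) L]
    [AddCommGroup M] [Module ℂ M] [Module (Polynomial ℂ) M] [IsScalarTower ℂ (Polynomial ℂ) M]
    (H : HomLieConformal.HomLieConformalAlgebra L) (hα : H.IsMultiplicative)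
    (R : HomLieConformal.Representation M H) :
    (∃! B : R.GradedC →ₗ[ℂ] R.GradedC →ₗ[ℂ] R.GradedC, R.IsDerivedBracket B) ∧
    ∀ B : R.GradedC →ₗ[ℂ] R.GradedC →ₗ[ℂ] R.GradedC, R.IsDerivedBracket B →
      HomLieConformal.IsGradedLieBracket (A := fun p => R.C p) B ∧
      ∀ T : M →ₗ[ℂ] L, (∀ m, H.α (T m) = T (R.β m)) →
        (HomLieConformal.IsOOperator R T ↔
          ∃ hT : HomLieConformal.ofLinear T ∈ R.C 1,
            B (R.of 1 ⟨HomLieConformal.ofLinear T, hT⟩)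
              (R.of 1 ⟨HomLieConformal.ofLinear T, hT⟩) = 0) :=
  ⟨HomLieConformal.existsUnique_derivedBracket R hα, fun _ hB =>
    ⟨HomLieConformal.isGradedLieBracket_of_isDerivedBracket R hα hB, fun _ hT =>
      HomLieConformal.isOOperator_iff_derivedBracket_self_eq_zero R hα hB hT⟩⟩
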